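/- Let $\omega\in(0,2\pi]$, $\nu\in\mathbb R$, $k\in\mathbb N=\{0,1,2,\dots\}$, $\lambda_k:=\frac{(2k+1)\pi}{2\omega}$, and put $\delta:=\lambda_k^2-\nu^2$. In $L^2((0,+\infty);\mathbb C^2)$ let $h_{\nu,k}$ be the operator with domain $C_c^\infty((0,+\infty);\mathbb C^2)$ and $$h_{\nu,k}\begin{pmatrix}u_1\\u_2\end{pmatrix}=\begin{pmatrix}\frac{\nu}{r}u_1-u_2'-\frac{\lambda_k}{r}u_2\\[2pt] u_1'-\frac{\lambda_k}{r}u_1+\frac{\nu}{r}u_2\end{pmatrix}.$$ Let $H^1_0((0,+\infty);\mathbb C^2)$ be the closure of $C_c^\infty((0,+\infty);\mathbb C^2)$ in the $H^1$ norm, and let $\chi$ be a smooth cut-off with $0\le\chi\le1$ and $\chi'\le0$ on $(0,+\infty)$, $\chi=1$ on $(0,1]$ and $\chi=0$ on $[2,+\infty)$. 1. If $\delta\ge\frac14$, then $h_{\nu,k}$ is essentially self-adjoint. Moreover $\mathcal D(\overline{h_{\nu,k}})=H^1_0((0,+\infty);\mathbb C^2)$ if $\delta>\frac14$, and $\mathcal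 D(\overline{h_{\nu,k}})\supsetneq H^1_0((0,+\infty);\mathbb C^2)$ if $\delta=\frac14$. 2. If $\delta<\frac14$, then $h_{\nu,k}$ is not essentially self-adjoint, and its self-adjoint extensions form a one-parameter family $\{t^{(\alpha)}_{\nu,k}\}_{\alpha\in[0,\pi)}$ (the $t^{(\alpha)}_{\nu,k}$ are pairwise different, and every self-adjoint extension of $h_{\nu,k}$ is one of them) with $$\mathcal D(t^{(\alpha)}_{\nu,k})=\operatorname{span}\{u^{(\alpha)}_{\nu,k}\}+H^1_0((0,+\infty);\mathbb C^2),$$ where the functions $u^{(\alpha)}_{\nu,k}\in L^2((0,+\infty);\mathbb C^2)$ are as follows. (a) If $0<\delta<\frac14$, with $s:=\sqrt\delta$, $$u^{(\alpha)}_{\nu,k}(r)=P_{\nu,k}\begin{pmatrix}\cos(\alpha)\,r^{s}\\ \sin(\alpha)\,r^{-s}\end{pmatrix}\chi(r),\qquad P_{\nu,k}:=\frac1{2s(-\lambda_k-s)}\begin{pmatrix}-\lambda_k-s&\nu\\-\nu&\lambda_k+s\end{pmatrix},$$ and the matrix $P_{\nu,k}\in\mathbb R^{2\times2}$ is invertible.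 (b) If $\delta=0$, $$u^{(\alpha)}_{\nu,k}(r)=\bigl(Q_{\nu,k}\log r+\mathbb 1_2\bigr)\begin{pmatrix}\cos\alpha\\ \sin\alpha\end{pmatrix}\chi(r),\qquad Q_{\nu,k}:=\begin{pmatrix}\lambda_k&-\nu\\ \nu&-\lambda_k\end{pmatrix},$$ and $Q_{\nu,k}^2=0$. (c) If $\delta<0$, with $\sigma:=\sqrt{\nu^2-\lambda_k^2}$, $$u^{(\alpha)}_{\nu,k}(r)=R_{\nu,k}\begin{pmatrix}e^{i\alpha}\,r^{i\sigma}\\ e^{-i\alpha}\,r^{-i\sigma}\end{pmatrix}\chi(r),\qquad R_{\nu,k}:=\frac1{2i\sigma(-\lambda_k-i\sigma)}\begin{pmatrix}-\lambda_k-i\sigma&\nu\\-\nu&\lambda_k+i\sigma\end{pmatrix},$$ and the matrix $R_{\nu,k}\in\mathbb C^{2\times2}$ is invertible. -/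

import Mathlib

namespace RadialDirac

noncomputable section

open MeasureTheory Set Matrix
open scoped ContDiff

/-- The Hilbert space `L²((0,+∞); ℂ²)`. -/
abbrev L2 : Type :=
  Lp (EuclideanSpace ℂ (Fin 2)) 2 ((volume : Measure ℝ).restrict (Ioi 0))

/-- `C_c^∞((0,+∞); ℂ²)`: smooth functions on `ℝ` whose support is a compact subset of `(0,+∞)`. -/
def testSpace : Submodule ℂ (ℝ → EuclideanSpace ℂ (Fin 2)) where
  carrier := {φ | ContDiff ℝ ∞ φ ∧ HasCompactSupport φ ∧ tsupport φ ⊆ Ioi 0}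
  add_mem' := by
    rintro φ ψ ⟨h1, h2, h3⟩ ⟨k1, k2, k3⟩
    exact ⟨h1.add k1, h2.add k2, (tsupport_add φ ψ).trans (union_subset h3 k3)⟩
  zero_mem' := by
    refine ⟨contDiff_const, HasCompactSupport.zero, ?_⟩
    have h : tsupport (0 : ℝ → EuclideanSpace ℂ (Fin 2)) = ∅ := tsupport_eq_empty_iff.2 rfl
    rw [h]
    exact empty_subset _
  smul_mem' := by
    rintro c φ ⟨h1, h2, h3⟩
    exact ⟨contDiff_const.smul h1, h2.smul_left,
      (tsupport_smul_subset_right (fun _ => c) φ).trans h3⟩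

/-- The number `λ_k = (2k+1)π/(2w)`, where `w` is the aperture of the sector. -/
def lam (w : ℝ) (k : ℕ) : ℝ := (2 * (k : ℝ) + 1) * Real.pi / (2 * w)

/-- The differential expression `d u = (ν/r u₁ - u₂' - l/r u₂, u₁' - l/r u₁ + ν/r u₂)`. -/
def dExpr (ν l : ℝ) (u : ℝ → EuclideanSpace ℂ (Fin 2)) (r : ℝ) : EuclideanSpace ℂ (Fin 2) :=
  !₂[((ν / r : ℝ) : ℂ) * u r 0 - deriv u r 1 - ((l / r : ℝ) : ℂ) * u r 1,
    deriv u r 0 - ((l / r : ℝ) : ℂ) * u r 0 + ((ν / r : ℝ) : ℂ) * u r 1]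

theorem testSpace_memLp (φ : testSpace) :
    MemLp φ.1 2 ((volume : Measure ℝ).restrict (Ioi 0)) :=
  φ.2.1.continuous.memLp_of_hasCompactSupport φ.2.2.1

theorem testSpace_deriv_memLp (φ : testSpace) :
    MemLp (deriv φ.1) 2 ((volume : Measure ℝ).restrict (Ioi 0)) :=
  (φ.2.1.continuous_deriv (by simp)).memLp_of_hasCompactSupport φ.2.2.1.deriv

theorem testSpace_div_continuous (φ : testSpace) (a : ℝ) (i : Fin 2) :
    Continuous fun r : ℝ => ((a / r : ℝ) : ℂ) * φ.1 r i := by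
  rw [continuous_iff_continuousAt]
  intro x
  by_cases hx : x ∈ tsupport φ.1
  · have hx0 : x ≠ 0 := ne_of_gt (φ.2.2.2 hx)
    have hc : Continuous φ.1 := φ.2.1.continuous
    have h1 : ContinuousAt (fun r : ℝ => ((a / r : ℝ) : ℂ)) x :=
      Complex.continuous_ofReal.continuousAt.comp (continuousAt_const.div continuousAt_id hx0)
    have h2 : Continuous (fun r : ℝ => φ.1 r i) := by fun_prop
    exact h1.mul h2.continuousAt
  · have h := notMem_tsupport_iff_eventuallyEq.1 hx
    refine ContinuousAt.congr (f := fun _ => (0 : ℂ)) continuousAt_const ?_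
    filter_upwards [h] with r hr
    simp [hr]

theorem testSpace_dExpr_memLp (ν l : ℝ) (φ : testSpace) :
    MemLp (dExpr ν l φ.1) 2 ((volume : Measure ℝ).restrict (Ioi 0)) := by
  have hd : Continuous (deriv φ.1) := φ.2.1.continuous_deriv (by simp)
  have hd' : ∀ i : Fin 2, Continuous fun r : ℝ => deriv φ.1 r i := fun i => by fun_prop
  have hc : Continuous (dExpr ν l φ.1) := by
    refine (PiLp.continuous_toLp 2 _).comp (continuous_pi fun i => ?_)
    fin_cases i
    · exact ((testSpace_div_continuous φ ν 0).sub (hd' 1)).sub (testSpace_div_continuous φ l 1)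
    · exact ((hd' 0).sub (testSpace_div_continuous φ l 0)).add (testSpace_div_continuous φ ν 1)
  refine hc.memLp_of_hasCompactSupport (φ.2.2.1.mono' fun r hr => ?_)
  by_contra h
  apply hr
  have h1 : φ.1 r = 0 := image_eq_zero_of_notMem_tsupport h
  have h2 : deriv φ.1 r = 0 := by
    by_contra h2
    exact h (support_deriv_subset h2)
  ext i
  fin_cases i <;> simp [dExpr, h1, h2]

theorem testSpace_differentiable (φ : testSpace) : Differentiable ℝ φ.1 :=
  φ.2.1.differentiable (by simp)

theorem dExpr_add (ν l : ℝ) (φ ψ : testSpace) :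
    dExpr ν l (φ + ψ).1 = dExpr ν l φ.1 + dExpr ν l ψ.1 := by
  funext r
  have h : deriv (φ.1 + ψ.1) r = deriv φ.1 r + deriv ψ.1 r :=
    deriv_add (testSpace_differentiable φ r) (testSpace_differentiable ψ r)
  ext i
  fin_cases i <;> simp [dExpr, h] <;> ring

theorem dExpr_smul (ν l : ℝ) (c : ℂ) (φ : testSpace) :
    dExpr ν l (c • φ).1 = c • dExpr ν l φ.1 := by
  funext r
  have h : deriv (c • φ.1) r = c • deriv φ.1 r :=
    deriv_const_smul c (testSpace_differentiable φ r)
  ext i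
  fin_cases i <;> simp [dExpr, h] <;> ring

/-- The embedding `C_c^∞((0,+∞); ℂ²) → L²((0,+∞); ℂ²)`. -/
def testToL2 : testSpace →ₗ[ℂ] L2 where
  toFun φ := (testSpace_memLp φ).toLp φ.1
  map_add' _ _ := rfl
  map_smul' _ _ := rfl

/-- The derivative `φ ↦ φ'` from `C_c^∞((0,+∞); ℂ²)` to `L²((0,+∞); ℂ²)`. -/
def derivToL2 : testSpace →ₗ[ℂ] L2 where
  toFun φ := (testSpace_deriv_memLp φ).toLp (deriv φ.1)
  map_add' φ ψ := by
    rw [← MemLp.toLp_add]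
    congr 1
    funext r
    exact deriv_add (testSpace_differentiable φ r) (testSpace_differentiable ψ r)
  map_smul' c φ := by
    rw [RingHom.id_apply, ← MemLp.toLp_const_smul]
    congr 1
    funext r
    exact deriv_const_smul c (testSpace_differentiable φ r)

/-- The map `φ ↦ d φ` from `C_c^∞((0,+∞); ℂ²)` to `L²((0,+∞); ℂ²)`. -/
def dToL2 (ν l : ℝ) : testSpace →ₗ[ℂ] L2 where
  toFun φ := (testSpace_dExpr_memLp ν l φ).toLp (dExpr ν l φ.1)
  map_add' φ ψ := by
    rw [← MemLp.toLp_add]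
    congr 1
    exact dExpr_add ν l φ ψ
  map_smul' c φ := by
    rw [RingHom.id_apply, ← MemLp.toLp_const_smul]
    congr 1
    exact dExpr_smul ν l c φ

theorem testToL2_injective : Function.Injective testToL2 := by
  intro φ ψ h
  have h1 : φ.1 =ᵐ[(volume : Measure ℝ).restrict (Ioi 0)] ψ.1 :=
    (MemLp.toLp_eq_toLp_iff (testSpace_memLp φ) (testSpace_memLp ψ)).1 h
  have h2 : EqOn φ.1 ψ.1 (Ioi 0) :=
    Measure.eqOn_open_of_ae_eq h1 isOpen_Ioi
      φ.2.1.continuous.continuousOn ψ.2.1.continuous.continuousOn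
  apply Subtype.ext
  funext r
  by_cases hr : r ∈ Ioi (0 : ℝ)
  · exact h2 hr
  · rw [image_eq_zero_of_notMem_tsupport fun h => hr (φ.2.2.2 h),
      image_eq_zero_of_notMem_tsupport fun h => hr (ψ.2.2.2 h)]

/-- The radial Dirac operator `h` on `L²((0,+∞); ℂ²)`: its domain is `C_c^∞((0,+∞); ℂ²)`, and
`h φ = d φ` there. -/
def radialOp (ν l : ℝ) : L2 →ₗ.[ℂ] L2 where
  domain := LinearMap.range testToL2
  toFun := (dToL2 ν l).comp (LinearEquiv.ofInjective testToL2 testToL2_injective).symm.toLinearMap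

theorem radialOp_apply (ν l : ℝ) (φ : testSpace) :
    radialOp ν l ⟨testToL2 φ, LinearMap.mem_range_self testToL2 φ⟩ = dToL2 ν l φ := by
  have h : (LinearEquiv.ofInjective testToL2 testToL2_injective).symm
      ⟨testToL2 φ, LinearMap.mem_range_self testToL2 φ⟩ = φ := by
    rw [LinearEquiv.symm_apply_eq]
    rfl
  exact congrArg (dToL2 ν l) h

/-- The Sobolev space `H¹₀((0,+∞); ℂ²)`, the closure of `C_c^∞((0,+∞); ℂ²)` in the `H¹` norm:
the `u ∈ L²` for which there is `v ∈ L²` (then the weak derivative of `u`) such that `(u, v)` is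
a limit in `L² × L²` of pairs `(φ, φ')` with `φ` in `C_c^∞((0,+∞); ℂ²)`. -/
def H10 : Submodule ℂ L2 :=
  (LinearMap.range (testToL2.prod derivToL2)).topologicalClosure.map (LinearMap.fst ℂ L2 L2)

/-- A densely defined operator is essentially self-adjoint if it is closable and its closure is
self-adjoint. -/
def IsEssentiallySelfAdjoint (T : L2 →ₗ.[ℂ] L2) : Prop :=
  T.IsClosable ∧ IsSelfAdjoint T.closure

/-- Given functions `u α`, `α ∈ [0,π)`, the self-adjoint extensions of `T` form a one-parameter
family `t α`, `α ∈ [0,π)`, with domains `span {u α} + H¹₀`: each `u α` is in `L²`, each `t α` is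
a self-adjoint extension of `T` with that domain, the `t α` are pairwise different, and every
self-adjoint extension of `T` is one of them. -/
def HasExtensionFamily (T : L2 →ₗ.[ℂ] L2) (u : ℝ → ℝ → EuclideanSpace ℂ (Fin 2)) : Prop :=
  ∃ hu : ∀ α ∈ Ico 0 Real.pi, MemLp (u α) 2 ((volume : Measure ℝ).restrict (Ioi 0)),
  ∃ t : Ico 0 Real.pi → (L2 →ₗ.[ℂ] L2),
    (∀ α, T ≤ t α ∧ IsSelfAdjoint (t α) ∧
      (t α).domain = Submodule.span ℂ {(hu α.1 α.2).toLp (u α.1)} ⊔ H10) ∧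
    Function.Injective t ∧
    ∀ S : L2 →ₗ.[ℂ] L2, T ≤ S → IsSelfAdjoint S → ∃ α, S = t α

/-- A smooth nonincreasing cut-off on the half-line with values in `[0,1]`, equal to `1` on
`(0,1]` and to `0` on `[2,+∞)`. Only its values on `(0,+∞)` are constrained. -/
structure IsCutoff (χ : ℝ → ℝ) : Prop where
  smooth : ContDiff ℝ ∞ χ
  mem_Icc : ∀ r > 0, χ r ∈ Icc (0 : ℝ) 1
  deriv_nonpos : ∀ r > 0, deriv χ r ≤ 0
  eq_one : ∀ r > 0, r ≤ 1 → χ r = 1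
  eq_zero : ∀ r ≥ 2, χ r = 0

/-- The matrix `P`, with `s = √(l² - ν²)`. -/
def matP (ν l : ℝ) : Matrix (Fin 2) (Fin 2) ℝ :=
  (1 / (2 * √(l ^ 2 - ν ^ 2) * (-l - √(l ^ 2 - ν ^ 2)))) •
    !![-l - √(l ^ 2 - ν ^ 2), ν; -ν, l + √(l ^ 2 - ν ^ 2)]

/-- The matrix `Q`. -/
def matQ (ν l : ℝ) : Matrix (Fin 2) (Fin 2) ℝ := !![l, -ν; ν, -l]

/-- The complex matrix `R`, with `σ = √(ν² - l²)`. -/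
def matR (ν l : ℝ) : Matrix (Fin 2) (Fin 2) ℂ :=
  (1 / (2 * Complex.I * (√(ν ^ 2 - l ^ 2) : ℂ) *
      (-(l : ℂ) - Complex.I * (√(ν ^ 2 - l ^ 2) : ℂ)))) •
    !![-(l : ℂ) - Complex.I * (√(ν ^ 2 - l ^ 2) : ℂ), (ν : ℂ);
      -(ν : ℂ), (l : ℂ) + Complex.I * (√(ν ^ 2 - l ^ 2) : ℂ)]

/-- `P (cos α r^s, sin α r^{-s}) χ(r)` with `s = √(l² - ν²)`. -/
def uSub (χ : ℝ → ℝ) (ν l α r : ℝ) : EuclideanSpace ℂ (Fin 2) :=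
  WithLp.toLp 2 fun i => ((χ r *
    (matP ν l *ᵥ ![Real.cos α * r ^ √(l ^ 2 - ν ^ 2),
      Real.sin α * r ^ (-√(l ^ 2 - ν ^ 2))]) i : ℝ) : ℂ)

/-- `(Q log r + 1) (cos α, sin α) χ(r)`. -/
def uCrit (χ : ℝ → ℝ) (ν l α r : ℝ) : EuclideanSpace ℂ (Fin 2) :=
  WithLp.toLp 2 fun i => ((χ r *
    ((Real.log r • matQ ν l + 1) *ᵥ ![Real.cos α, Real.sin α]) i : ℝ) : ℂ)

/-- `R (e^{iα} r^{iσ}, e^{-iα} r^{-iσ}) χ(r)` with `σ = √(ν² - l²)`. -/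
def uSuper (χ : ℝ → ℝ) (ν l α r : ℝ) : EuclideanSpace ℂ (Fin 2) :=
  WithLp.toLp 2 fun i => (χ r : ℂ) *
    (matR ν l *ᵥ
      ![Complex.exp (Complex.I * α) * (r : ℂ) ^ (Complex.I * (√(ν ^ 2 - l ^ 2) : ℂ)),
        Complex.exp (-(Complex.I * α)) * (r : ℂ) ^ (-(Complex.I * (√(ν ^ 2 - l ^ 2) : ℂ)))]) i

end

end RadialDirac

/-!
The eigenvalues of `Q = !![l, -ν; ν, -l]` are `±√δ` with `δ = l² - ν²`, and solutions of
`r ψ' = Q ψ` behave like `r^(±√δ)` at zero. The operator is symmetric, and elements `u` of the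
domain of its adjoint are the square-integrable solutions of `u' = Q u / r + F` with `F` in `L²`
(`exists_radialODE`, `RadialODE.mem_adjoint_graph`).

For an eigenvector `p` of `Q` with eigenvalue `q`, the Wronskian `Y = u₀ p₁ - u₁ p₀` solves the
scalar equation `Y' = -q Y / r + G` with `G` in `L²`. A Schur test for the kernel of its solution
operator gives Hardy-type inequalities: `Y / r` is square-integrable near zero if the homogeneous
part of `Y` vanishes, which is a vanishing limit for `Re q > -1/2` (`memLp_div_of_tendsto`) and is
automatic for `Re q ≥ 1/2` (`tendsto_zero_of_memLp`), and always for `Re q < -1/2`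
(`memLp_div_of_half_lt`). Functions with `u'` in `L²` and `u / r` square-integrable near zero are
those of `H¹₀` (`mem_closure_of_hasWeakDeriv`, by duality), and the Hardy inequality puts `H¹₀` in
the domain of the closure (`exists_mem_closure_graph_of_mem_H10`).

* `δ > 1/4`: both Wronskians qualify, so the domain of the adjoint is `H¹₀`.
* `δ = 1/4`: only the Wronskian with the eigenvector for `q = 1/2` qualifies. Modulo `H¹₀` every
  element of the domain of the adjoint is a multiple of that eigenvector at each point, with image
  orthogonal to it, and the boundary form of the adjoint vanishes (`inner_eq_of_eigenvector`). The
  argument covers all `δ ≥ 1/4`. The solution with exponent `1/2` is in the domain but has no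
  square-integrable derivative.
* `δ < 1/4`: all solutions are square-integrable near zero, and the Wronskians of `u` with a basis
  of solutions have limits at zero. Subtracting the cut-off solution with these limits leaves an
  element of `H¹₀` (`IsRegularBasis.exists_sub_mem_H10`), so the domain of the adjoint modulo `H¹₀`
  is the two-dimensional space of solutions, on which the boundary form is a nondegenerate
  Wronskian. Self-adjoint extensions are the isotropic lines of that form
  (`BoundaryData.exists_extensions`). They are `w₁ / w₀ ∈ ℝ ∪ {∞}` in real bases and
  `|w₀| = |w₁|` in a basis with imaginary exponents; `[0,π)` parametrizes both
  (`isotropic_lines_real`, `isotropic_lines_exp`). At `δ = 0` the matrix `Q` is nilpotent, and the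
  basis `1 + Q log r` replaces the powers (`isRegularBasis_log`).
-/

namespace RadialDirac

open MeasureTheory Set Filter Topology
open scoped ContDiff

/-! ### Absolutely continuous functions on the half-line -/

/-- `f` is locally absolutely continuous on `(0,+∞)` with derivative `g`. -/
structure IsPrimitive (f g : ℝ → ℂ) : Prop where
  intervalIntegrable : ∀ ⦃x y : ℝ⦄, 0 < x → 0 < y → IntervalIntegrable g volume x y
  integral_eq : ∀ ⦃x y : ℝ⦄, 0 < x → 0 < y → ∫ t in x..y, g t = f y - f x

theorem uIcc_subset_Ioi {x y : ℝ} (hx : 0 < x) (hy : 0 < y) : uIcc x y ⊆ Ioi 0 :=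
  fun _ ht => lt_of_lt_of_le (lt_min hx hy) ht.1

theorem absolutelyContinuousOnInterval_congr {f g : ℝ → ℂ} {a b : ℝ}
    (hf : AbsolutelyContinuousOnInterval f a b) (h : EqOn f g (uIcc a b)) :
    AbsolutelyContinuousOnInterval g a b := by
  rw [absolutelyContinuousOnInterval_iff] at hf ⊢
  intro ε hε
  obtain ⟨δ, hδ, H⟩ := hf ε hε
  refine ⟨δ, hδ, fun E hE hlt => ?_⟩
  convert H E hE hlt using 1
  refine Finset.sum_congr rfl fun i hi => ?_
  rw [h (hE.1 i hi).1, h (hE.1 i hi).2]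

theorem absolutelyContinuousOnInterval_ofReal {f : ℝ → ℝ} {a b : ℝ}
    (hf : AbsolutelyContinuousOnInterval f a b) :
    AbsolutelyContinuousOnInterval (fun x => (f x : ℂ)) a b := by
  rw [absolutelyContinuousOnInterval_iff] at hf ⊢
  intro ε hε
  obtain ⟨δ, hδ, H⟩ := hf ε hε
  refine ⟨δ, hδ, fun E hE hlt => ?_⟩
  convert H E hE hlt using 1
  refine Finset.sum_congr rfl fun i hi => ?_
  rw [Complex.dist_of_im_eq (by simp)]
  simp

theorem absolutelyContinuousOnInterval_integral {g : ℝ → ℂ} {a b : ℝ}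
    (h : IntervalIntegrable g volume a b) :
    AbsolutelyContinuousOnInterval (fun x => ∫ t in a..x, g t) a b := by
  have hre : IntervalIntegrable (fun t => (g t).re) volume a b := ⟨h.1.re, h.2.re⟩
  have him : IntervalIntegrable (fun t => (g t).im) volume a b := ⟨h.1.im, h.2.im⟩
  have h1 := absolutelyContinuousOnInterval_ofReal
    (hre.absolutelyContinuousOnInterval_intervalIntegral (c := a) (by simp))
  have h2 := absolutelyContinuousOnInterval_ofReal
    (him.absolutelyContinuousOnInterval_intervalIntegral (c := a) (by simp))
  refine absolutelyContinuousOnInterval_congr (h1.add (h2.const_smul Complex.I)) ?_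
  intro x hx
  have hs : uIcc a x ⊆ uIcc a b := uIcc_subset_uIcc left_mem_uIcc hx
  have hre' := hre.mono_set hs
  have him' := him.mono_set hs
  have e1 : IntervalIntegrable (fun t => ((g t).re : ℂ)) volume a x := ⟨hre'.1.ofReal, hre'.2.ofReal⟩
  have e2 : IntervalIntegrable (fun t => ((g t).im : ℂ)) volume a x := ⟨him'.1.ofReal, him'.2.ofReal⟩
  simp only [Pi.add_apply, smul_eq_mul]
  rw [← intervalIntegral.integral_ofReal, ← intervalIntegral.integral_ofReal,
    ← intervalIntegral.integral_const_mul, ← intervalIntegral.integral_add e1 (e2.const_mul _)]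
  congr 1
  funext t
  rw [mul_comm, Complex.re_add_im]

namespace IsPrimitive

variable {f g f' g' : ℝ → ℂ}

theorem eq_add (hf : IsPrimitive f f') {x y : ℝ} (hx : 0 < x) (hy : 0 < y) :
    f y = f x + ∫ t in x..y, f' t := by
  rw [hf.integral_eq hx hy]; ring

theorem absolutelyContinuous (hf : IsPrimitive f f') {x y : ℝ} (hx : 0 < x) (hy : 0 < y) :
    AbsolutelyContinuousOnInterval f x y := by
  have h0 : AbsolutelyContinuousOnInterval (fun _ : ℝ => f x) x y := by
    rw [absolutelyContinuousOnInterval_iff]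
    exact fun ε hε => ⟨1, one_pos, fun E _ _ => by simpa using hε⟩
  refine absolutelyContinuousOnInterval_congr
    (h0.add (absolutelyContinuousOnInterval_integral (hf.intervalIntegrable hx hy))) fun t ht => ?_
  exact (hf.eq_add hx (uIcc_subset_Ioi hx hy ht)).symm

theorem ae_hasDerivAt (hf : IsPrimitive f f') {x y : ℝ} (hx : 0 < x) (hy : 0 < y) :
    ∀ᵐ t, t ∈ uIcc x y → HasDerivAt f (f' t) t := by
  filter_upwards [(hf.intervalIntegrable hx hy).ae_hasDerivAt_integral] with t ht h
  have h1 := (ht h x left_mem_uIcc).const_add (f x)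
  refine h1.congr_of_eventuallyEq ?_
  filter_upwards [Ioi_mem_nhds (uIcc_subset_Ioi hx hy h)] with s hs
  exact hf.eq_add hx hs

theorem continuousOn (hf : IsPrimitive f f') : ContinuousOn f (Ioi 0) := by
  intro x hx
  have hx' : (0 : ℝ) < x := hx
  have h := (hf.absolutelyContinuous (half_pos hx') (show 0 < x + 1 by linarith)).continuousOn
  rw [uIcc_of_le (by linarith)] at h
  exact (h.continuousAt (Icc_mem_nhds (by linarith) (by linarith))).continuousWithinAt

theorem locallyIntegrableOn (hf : IsPrimitive f f') : LocallyIntegrableOn f' (Ioi 0) := by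
  rw [locallyIntegrableOn_iff isOpen_Ioi.isLocallyClosed]
  intro k hk hc
  rcases k.eq_empty_or_nonempty with rfl | hne
  · simp
  obtain ⟨a, ha⟩ := hc.exists_isLeast hne
  obtain ⟨b, hb⟩ := hc.exists_isGreatest hne
  have hab : a ≤ b := ha.2 hb.1
  have h := hf.intervalIntegrable (hk ha.1) (hk hb.1)
  rw [intervalIntegrable_iff_integrableOn_Icc_of_le hab] at h
  exact h.mono_set fun t ht => ⟨ha.2 ht, hb.2 ht⟩

theorem congr_ae (hf : IsPrimitive f f') (h : f' =ᵐ[volume.restrict (Ioi 0)] g') :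
    IsPrimitive f g' := by
  have key : ∀ ⦃x y : ℝ⦄, 0 < x → 0 < y → f' =ᵐ[volume.restrict (uIoc x y)] g' := fun x y hx hy =>
    ae_mono (Measure.restrict_mono (uIoc_subset_uIcc.trans (uIcc_subset_Ioi hx hy)) le_rfl) h
  refine ⟨fun x y hx hy => (hf.intervalIntegrable hx hy).congr_ae (key hx hy), fun x y hx hy => ?_⟩
  rw [← hf.integral_eq hx hy]
  exact (intervalIntegral.integral_congr_ae_restrict (key hx hy)).symm

theorem add (hf : IsPrimitive f f') (hg : IsPrimitive g g') :
    IsPrimitive (fun x => f x + g x) (fun x => f' x + g' x) :=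
  ⟨fun _ _ hx hy => (hf.intervalIntegrable hx hy).add (hg.intervalIntegrable hx hy),
   fun x y hx hy => by
    rw [intervalIntegral.integral_add (hf.intervalIntegrable hx hy) (hg.intervalIntegrable hx hy),
      hf.integral_eq hx hy, hg.integral_eq hx hy]
    ring⟩

theorem const_mul (c : ℂ) (hf : IsPrimitive f f') :
    IsPrimitive (fun x => c * f x) (fun x => c * f' x) :=
  ⟨fun _ _ hx hy => (hf.intervalIntegrable hx hy).const_mul c,
   fun x y hx hy => by
    rw [intervalIntegral.integral_const_mul, hf.integral_eq hx hy]
    ring⟩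

theorem sub (hf : IsPrimitive f f') (hg : IsPrimitive g g') :
    IsPrimitive (fun x => f x - g x) (fun x => f' x - g' x) := by
  simpa [sub_eq_add_neg] using hf.add (hg.const_mul (-1))

theorem conj (hf : IsPrimitive f f') :
    IsPrimitive (fun x => starRingEnd ℂ (f x)) (fun x => starRingEnd ℂ (f' x)) := by
  refine ⟨fun x y hx hy => ?_, fun x y hx hy => ?_⟩
  · have h := hf.intervalIntegrable hx hy
    exact ⟨Complex.conjCLE.toContinuousLinearMap.integrable_comp h.1,
      Complex.conjCLE.toContinuousLinearMap.integrable_comp h.2⟩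
  · rw [← map_sub, ← hf.integral_eq hx hy]
    simp only [intervalIntegral, integral_conj, map_sub]

theorem of_hasDerivAt (h : ∀ x, 0 < x → HasDerivAt f (f' x) x) (hc : ContinuousOn f' (Ioi 0)) :
    IsPrimitive f f' :=
  have hi : ∀ ⦃x y : ℝ⦄, 0 < x → 0 < y → IntervalIntegrable f' volume x y := fun _ _ hx hy =>
    (hc.mono (uIcc_subset_Ioi hx hy)).intervalIntegrable
  ⟨hi, fun _ _ hx hy => intervalIntegral.integral_eq_sub_of_hasDerivAt
    (fun t ht => h t (uIcc_subset_Ioi hx hy ht)) (hi hx hy)⟩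

/-- The product rule for locally absolutely continuous functions. -/
theorem mul (hf : IsPrimitive f f') (hg : IsPrimitive g g') :
    IsPrimitive (fun x => f x * g x) (fun x => f' x * g x + f x * g' x) := by
  have hi : ∀ ⦃x y : ℝ⦄, 0 < x → 0 < y →
      IntervalIntegrable (fun x => f' x * g x + f x * g' x) volume x y := fun x y hx hy =>
    ((hf.intervalIntegrable hx hy).mul_continuousOn
      (hg.continuousOn.mono (uIcc_subset_Ioi hx hy))).add
    ((hg.intervalIntegrable hx hy).continuousOn_mul
      (hf.continuousOn.mono (uIcc_subset_Ioi hx hy)))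
  refine ⟨hi, fun x y hx hy => ?_⟩
  have hac : AbsolutelyContinuousOnInterval
      (fun t => f t * g t - ∫ s in x..t, (f' s * g s + f s * g' s)) x y :=
    ((hf.absolutelyContinuous hx hy).smul (hg.absolutelyContinuous hx hy)).sub
      (absolutelyContinuousOnInterval_integral (hi hx hy))
  obtain ⟨C, hC⟩ := hac.const_of_ae_hasDerivAt_zero (by
    filter_upwards [hf.ae_hasDerivAt hx hy, hg.ae_hasDerivAt hx hy,
      (hi hx hy).ae_hasDerivAt_integral] with t h1 h2 h3 ht
    have h4 := ((h1 ht).mul (h2 ht)).sub (h3 ht x left_mem_uIcc)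
    rw [sub_self] at h4
    exact h4)
  have h1 := hC x left_mem_uIcc
  have h2 := hC y right_mem_uIcc
  simp only [intervalIntegral.integral_same, sub_zero] at h1
  rw [← h1] at h2
  linear_combination -h2

/-- A primitive with compact support in `(0,+∞)` has a derivative of integral zero. -/
theorem integral_eq_zero_of_eq_zero (hf : IsPrimitive f f') {a b : ℝ} (ha : 0 < a) (hab : a ≤ b)
    (h0 : ∀ x ∉ Icc a b, f x = 0) (h1 : ∀ x ∉ Icc a b, f' x = 0) : ∫ x in Ioi 0, f' x = 0 := by
  have hs : Ioc (a / 2) (b + 1) ⊆ Ioi 0 := fun t ht => (half_pos ha).trans ht.1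
  rw [setIntegral_eq_of_subset_of_forall_sdiff_eq_zero measurableSet_Ioi hs,
    ← intervalIntegral.integral_of_le (by linarith),
    hf.integral_eq (half_pos ha) (by linarith), h0 _ fun h => by linarith [h.2],
    h0 _ fun h => by linarith [h.1], sub_zero]
  intro x hx
  exact h1 x fun h => hx.2 ⟨by linarith [h.1], by linarith [h.2]⟩

end IsPrimitive

/-! ### Weak derivatives -/

/-- Real test functions on the half-line. -/
structure IsTest (θ : ℝ → ℝ) : Prop where
  contDiff : ContDiff ℝ ∞ θ
  hasCompactSupport : HasCompactSupport θ
  tsupport_subset : tsupport θ ⊆ Ioi 0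

/-- `v` is the distributional derivative of `u` on `(0,+∞)`. -/
def HasWeakDeriv (u v : ℝ → ℂ) : Prop :=
  ∀ θ : ℝ → ℝ, IsTest θ →
    ∫ x in Ioi 0, ((deriv θ x : ℝ) : ℂ) * u x = -∫ x in Ioi 0, (θ x : ℂ) * v x

theorem exists_Icc_of_tsupport_subset {E : Type*} [NormedAddCommGroup E] [NormedSpace ℝ E]
    {θ : ℝ → E} (hc : HasCompactSupport θ) (hs : tsupport θ ⊆ Ioi 0) :
    ∃ a b : ℝ, 0 < a ∧ a ≤ b ∧ ∀ x ∉ Icc a b, θ x = 0 ∧ deriv θ x = 0 := by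
  have key : ∀ x ∉ tsupport θ, θ x = 0 ∧ deriv θ x = 0 := fun x hx =>
    ⟨image_eq_zero_of_notMem_tsupport hx, by
      by_contra h
      exact hx (support_deriv_subset h)⟩
  rcases (tsupport θ).eq_empty_or_nonempty with he | hne
  · exact ⟨1, 1, one_pos, le_rfl, fun x _ => key x (by simp [he])⟩
  obtain ⟨a, ha⟩ := hc.isCompact.exists_isLeast hne
  obtain ⟨b, hb⟩ := hc.isCompact.exists_isGreatest hne
  exact ⟨a, b, hs ha.1, ha.2 hb.1, fun x hx => key x fun h => hx ⟨ha.2 h, hb.2 h⟩⟩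

theorem integrableOn_mul_of_eq_zero {θ u : ℝ → ℂ} {a b : ℝ} (ha : 0 < a)
    (hθ : ContinuousOn θ (Ioi 0)) (h0 : ∀ x ∉ Icc a b, θ x = 0)
    (hu : LocallyIntegrableOn u (Ioi 0)) :
    IntegrableOn (fun x => θ x * u x) (Ioi 0) := by
  have hs : Icc a b ⊆ Ioi 0 := fun t ht => ha.trans_le ht.1
  have h1 : IntegrableOn (fun x => θ x * u x) (Icc a b) :=
    (hu.integrableOn_compact_subset hs isCompact_Icc).continuousOn_mul (hθ.mono hs) isCompact_Icc
  exact (integrableOn_iff_integrable_of_support_subset (s := Icc a b) (fun x hx => by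
    by_contra h
    exact hx (by simp [h0 x h]))).1 h1 |>.integrableOn

theorem exists_isTest_integral_eq_one : ∃ ψ : ℝ → ℝ, IsTest ψ ∧ ∫ x in Ioi 0, ψ x = 1 := by
  let f : ContDiffBump (2 : ℝ) := ⟨1 / 4, 1 / 2, by norm_num, by norm_num⟩
  have hs : tsupport (f.normed volume) ⊆ Ioi 0 := by
    rw [f.tsupport_normed_eq]
    intro x hx
    rw [Metric.mem_closedBall, Real.dist_eq, abs_le] at hx
    have := hx.1
    simp only [f] at this
    show 0 < x
    linarith
  refine ⟨f.normed volume, ⟨f.contDiff_normed, f.hasCompactSupport_normed, hs⟩, ?_⟩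
  rw [setIntegral_eq_integral_of_forall_compl_eq_zero, f.integral_normed]
  exact fun x hx => image_eq_zero_of_notMem_tsupport fun h => hx (hs h)

theorem IsTest.exists_primitive {θ : ℝ → ℝ} (hθ : IsTest θ) (h0 : ∫ x in Ioi 0, θ x = 0) :
    ∃ Θ : ℝ → ℝ, IsTest Θ ∧ ∀ x, deriv Θ x = θ x := by
  obtain ⟨a, b, ha, hab, hz⟩ := exists_Icc_of_tsupport_subset hθ.hasCompactSupport hθ.tsupport_subset
  have hc := hθ.contDiff.continuous
  have hd : ∀ x, HasDerivAt (fun x => ∫ t in 0..x, θ t) (θ x) x := fun x =>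
    intervalIntegral.integral_hasDerivAt_right (hc.intervalIntegrable _ _)
      (hc.stronglyMeasurableAtFilter _ _) hc.continuousAt
  have hd' : deriv (fun x => ∫ t in 0..x, θ t) = θ := funext fun x => (hd x).deriv
  have hI : IntegrableOn θ (Ioi 0) := (hc.integrable_of_hasCompactSupport hθ.hasCompactSupport).integrableOn
  have hout : ∀ x ∉ Icc a b, ∫ t in 0..x, θ t = 0 := by
    intro x hx
    rcases lt_or_ge x a with h | h
    · refine intervalIntegral.integral_zero_ae (Eventually.of_forall fun t ht => (hz t fun h' => ?_).1)
      rcases le_total 0 x with h1 | h1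
      · rw [uIoc_of_le h1] at ht
        linarith [ht.2, h'.1]
      · rw [uIoc_of_ge h1] at ht
        linarith [ht.2, h'.1]
    · have hb : b < x := by
        by_contra h'
        exact hx ⟨h, not_lt.1 h'⟩
      refine Eq.trans ?_ h0
      rw [intervalIntegral.integral_of_le (by linarith)]
      refine (setIntegral_eq_of_subset_of_forall_sdiff_eq_zero measurableSet_Ioi
        (fun t ht => ht.1) fun t ht => (hz t fun h' => ?_).1).symm
      exact ht.2 ⟨ht.1, by linarith [h'.2]⟩
  have hts : tsupport (fun x => ∫ t in 0..x, θ t) ⊆ Icc a b :=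
    closure_minimal (fun x hx => by
      by_contra h
      exact hx (hout x h)) isClosed_Icc
  refine ⟨fun x => ∫ t in 0..x, θ t, ⟨?_, ?_, hts.trans fun t ht => ha.trans_le ht.1⟩,
    fun x => (hd x).deriv⟩
  · rw [contDiff_infty_iff_deriv, hd']
    exact ⟨fun x => (hd x).differentiableAt, hθ.contDiff⟩
  · exact isCompact_Icc.of_isClosed_subset (isClosed_tsupport _) hts

/-- The du Bois-Reymond lemma: a locally integrable function with a locally integrable weak
derivative agrees almost everywhere with a primitive of that derivative. -/
theorem HasWeakDeriv.exists_isPrimitive {u v : ℝ → ℂ} (h : HasWeakDeriv u v)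
    (hu : LocallyIntegrableOn u (Ioi 0)) (hv : LocallyIntegrableOn v (Ioi 0)) :
    ∃ U, IsPrimitive U v ∧ u =ᵐ[volume.restrict (Ioi 0)] U := by
  have hvi : ∀ ⦃x y : ℝ⦄, 0 < x → 0 < y → IntervalIntegrable v volume x y := fun x y hx hy => by
    rw [intervalIntegrable_iff]
    exact (hv.integrableOn_compact_subset (uIcc_subset_Ioi hx hy) isCompact_uIcc).mono_set
      uIoc_subset_uIcc
  have hV : IsPrimitive (fun x => ∫ t in 1..x, v t) v :=
    ⟨hvi, fun x y hx hy => by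
      rw [intervalIntegral.integral_interval_sub_left (hvi one_pos hy) (hvi one_pos hx)]⟩
  set V : ℝ → ℂ := fun x => ∫ t in 1..x, v t with hVdef
  have hVl : LocallyIntegrableOn V (Ioi 0) := hV.continuousOn.locallyIntegrableOn measurableSet_Ioi
  have hWl : LocallyIntegrableOn (fun x => u x - V x) (Ioi 0) := hu.sub hVl
  -- `u - V` has vanishing weak derivative
  have hW : ∀ θ : ℝ → ℝ, IsTest θ → ∫ x in Ioi 0, ((deriv θ x : ℝ) : ℂ) * (u x - V x) = 0 := by
    intro θ hθ
    obtain ⟨a, b, ha, hab, hz⟩ :=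
      exists_Icc_of_tsupport_subset hθ.hasCompactSupport hθ.tsupport_subset
    have hcd : Continuous (fun x => ((deriv θ x : ℝ) : ℂ)) :=
      Complex.continuous_ofReal.comp (hθ.contDiff.continuous_deriv (by simp))
    have hcθ : Continuous (fun x => (θ x : ℂ)) := Complex.continuous_ofReal.comp hθ.contDiff.continuous
    have hp : IsPrimitive (fun x => (θ x : ℂ)) (fun x => ((deriv θ x : ℝ) : ℂ)) :=
      IsPrimitive.of_hasDerivAt (fun x _ =>
        (hθ.contDiff.differentiable (by simp) x).hasDerivAt.ofReal_comp) hcd.continuousOn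
    have h1 := (hp.mul hV).integral_eq_zero_of_eq_zero ha hab
      (fun x hx => by simp [(hz x hx).1]) (fun x hx => by simp [(hz x hx).1, (hz x hx).2])
    have i1 := integrableOn_mul_of_eq_zero ha hcd.continuousOn
      (fun x hx => by simp [(hz x hx).2]) hVl (b := b)
    have i2 := integrableOn_mul_of_eq_zero ha hcθ.continuousOn
      (fun x hx => by simp [(hz x hx).1]) hv (b := b)
    have i3 := integrableOn_mul_of_eq_zero ha hcd.continuousOn
      (fun x hx => by simp [(hz x hx).2]) hu (b := b)
    rw [integral_add i1 i2] at h1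
    simp_rw [mul_sub]
    rw [integral_sub i3 i1, h θ hθ]
    linear_combination -h1
  obtain ⟨ψ, hψ, hψ1⟩ := exists_isTest_integral_eq_one
  set c : ℂ := ∫ x in Ioi 0, (ψ x : ℂ) * (u x - V x) with hc
  have hint : ∀ θ : ℝ → ℝ, IsTest θ → ∀ w : ℝ → ℂ, LocallyIntegrableOn w (Ioi 0) →
      IntegrableOn (fun x => (θ x : ℂ) * w x) (Ioi 0) := by
    intro θ hθ w hw
    obtain ⟨a, b, ha, hab, hz⟩ :=
      exists_Icc_of_tsupport_subset hθ.hasCompactSupport hθ.tsupport_subset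
    exact integrableOn_mul_of_eq_zero ha
      (Complex.continuous_ofReal.comp hθ.contDiff.continuous).continuousOn
      (fun x hx => by simp [(hz x hx).1]) hw (b := b)
  have hcl : LocallyIntegrableOn (fun _ : ℝ => c) (Ioi 0) :=
    continuousOn_const.locallyIntegrableOn measurableSet_Ioi
  have hfin : ∀ᵐ x, x ∈ Ioi (0 : ℝ) → u x - V x - c = 0 := by
    refine isOpen_Ioi.ae_eq_zero_of_integral_contDiff_smul_eq_zero (hWl.sub hcl)
      fun θ h1 h2 h3 => ?_
    have hθ : IsTest θ := ⟨h1, h2, h3⟩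
    set m : ℝ := ∫ x in Ioi 0, θ x with hm
    have hr : ∀ θ : ℝ → ℝ, IsTest θ → IntegrableOn θ (Ioi 0) := fun θ hθ =>
      (hθ.contDiff.continuous.integrable_of_hasCompactSupport hθ.hasCompactSupport).integrableOn
    have hη : IsTest (fun x => θ x - m * ψ x) := by
      refine ⟨h1.sub (contDiff_const.mul hψ.contDiff), h2.sub hψ.hasCompactSupport.mul_left, ?_⟩
      exact (tsupport_sub _ _).trans (union_subset h3
        ((tsupport_mul_subset_right).trans hψ.tsupport_subset))
    obtain ⟨Θ, hΘ, hΘd⟩ := hη.exists_primitive (by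
      rw [integral_sub (hr θ hθ) ((hr ψ hψ).const_mul m), integral_const_mul, hψ1]
      ring)
    have h4 := hW Θ hΘ
    simp_rw [hΘd] at h4
    have h5 : ∫ x in Ioi 0, (θ x : ℂ) * (u x - V x) = m * c := by
      have : ∀ x, ((θ x - m * ψ x : ℝ) : ℂ) * (u x - V x) =
          (θ x : ℂ) * (u x - V x) - m * ((ψ x : ℂ) * (u x - V x)) := fun x => by push_cast; ring
      simp_rw [this] at h4
      rw [integral_sub (hint θ hθ _ hWl) ((hint ψ hψ _ hWl).const_mul _), integral_const_mul] at h4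
      exact sub_eq_zero.1 h4
    have h6 : ∫ x, θ x • (u x - V x - c) = ∫ x in Ioi 0, (θ x : ℂ) * (u x - V x - c) := by
      rw [← setIntegral_eq_integral_of_forall_compl_eq_zero (s := Ioi 0)]
      · rfl
      · exact fun x hx => by rw [image_eq_zero_of_notMem_tsupport fun h => hx (h3 h), zero_smul]
    change ∫ x, θ x • (u x - V x - c) = 0
    rw [h6]
    simp_rw [mul_sub _ _ c]
    rw [integral_sub (hint θ hθ _ hWl) (hint θ hθ _ hcl), h5, integral_mul_const,
      integral_complex_ofReal, sub_self]
  refine ⟨fun x => c + V x, ⟨hvi, fun x y hx hy => ?_⟩, ?_⟩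
  · rw [hV.integral_eq hx hy]; ring
  · rw [EventuallyEq, ae_restrict_iff' measurableSet_Ioi]
    filter_upwards [hfin] with x hx hx0
    linear_combination hx hx0

/-- A primitive of a function integrable near zero has a limit at zero. -/
theorem IsPrimitive.tendsto_nhdsGT_zero {f g : ℝ → ℂ} (h : IsPrimitive f g)
    (hg : IntegrableOn g (Ioc 0 1)) :
    Tendsto f (𝓝[>] 0) (𝓝 (f 1 - ∫ x in 0..1, g x)) := by
  have hg1 : IntervalIntegrable g volume 0 1 := by
    rwa [intervalIntegrable_iff_integrableOn_Ioc_of_le zero_le_one]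
  have h1 : Tendsto (fun x => ∫ t in 0..x, g t) (𝓝[>] 0) (𝓝 0) := by
    have hc := intervalIntegral.continuousOn_primitive_interval' hg1 left_mem_uIcc
    have := (hc 0 left_mem_uIcc).tendsto
    rw [intervalIntegral.integral_same] at this
    refine this.mono_left ?_
    rw [uIcc_of_le zero_le_one]
    exact nhdsWithin_le_iff.2 (mem_of_superset (Ioo_mem_nhdsGT one_pos) Ioo_subset_Icc_self)
  rw [← add_zero (f 1 - ∫ x in 0..1, g x)]
  refine (h1.const_add _).congr' ?_
  filter_upwards [Ioo_mem_nhdsGT one_pos] with x hx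
  have h3 := h.eq_add one_pos hx.1
  have h4 : IntervalIntegrable g volume 0 x := hg1.mono_set (by
    rw [uIcc_of_le zero_le_one, uIcc_of_le hx.1.le]
    exact Icc_subset_Icc_right hx.2.le)
  have h5 := intervalIntegral.integral_add_adjacent_intervals h4
    (h.intervalIntegrable hx.1 one_pos)
  rw [intervalIntegral.integral_symm] at h3
  linear_combination h5 - h3

theorem IsPrimitive.eq_integral_of_tendsto {f g : ℝ → ℂ} (h : IsPrimitive f g)
    (hg : IntegrableOn g (Ioc 0 1)) (h0 : Tendsto f (𝓝[>] 0) (𝓝 0)) {x : ℝ} (hx : x ∈ Ioc 0 1) :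
    f x = ∫ t in Ioc 0 x, g t := by
  have hg1 : IntervalIntegrable g volume 0 1 := by
    rwa [intervalIntegrable_iff_integrableOn_Ioc_of_le zero_le_one]
  have h4 : IntervalIntegrable g volume 0 x := hg1.mono_set (by
    rw [uIcc_of_le zero_le_one, uIcc_of_le hx.1.le]
    exact Icc_subset_Icc_right hx.2)
  have h1 := tendsto_nhds_unique (h.tendsto_nhdsGT_zero hg) h0
  have h3 := h.eq_add hx.1 one_pos
  have h5 := intervalIntegral.integral_add_adjacent_intervals h4
    (h.intervalIntegrable hx.1 one_pos)
  rw [← intervalIntegral.integral_of_le hx.1.le]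
  linear_combination h1 - h3 - h5

/-- A primitive that is integrable near infinity and vanishes at zero in the mean has a
derivative of integral zero. -/
theorem IsPrimitive.integral_eq_zero {f g : ℝ → ℂ} (h : IsPrimitive f g)
    (hg : IntegrableOn g (Ioi 0)) (hf : IntegrableOn f (Ioi 0))
    (hf' : IntegrableOn (fun x => f x / x) (Ioc 0 1)) : ∫ x in Ioi 0, g x = 0 := by
  have hsplit : ∫ x in Ioi 0, g x = (∫ x in Ioc 0 1, g x) + ∫ x in Ioi 1, g x := by
    rw [← setIntegral_union (Ioc_disjoint_Ioi le_rfl) measurableSet_Ioi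
      (hg.mono_set Ioc_subset_Ioi_self) (hg.mono_set (Ioi_subset_Ioi zero_le_one)),
      Ioc_union_Ioi_eq_Ioi zero_le_one]
  have htop : ∫ x in Ioi 1, g x = - f 1 := by
    have h1 := intervalIntegral_tendsto_integral_Ioi 1 (hg.mono_set (Ioi_subset_Ioi zero_le_one))
      tendsto_id
    have h2 : Tendsto f atTop (𝓝 (f 1 + ∫ x in Ioi 1, g x)) := by
      refine (h1.const_add (f 1)).congr' ?_
      filter_upwards [Ioi_mem_atTop 0] with x hx
      exact (h.eq_add one_pos hx).symm
    have h3 : IntegrableAtFilter f atTop volume := ⟨Ioi 0, Ioi_mem_atTop 0, hf⟩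
    have h4 := h3.eq_zero_of_tendsto (fun s hs => by
      obtain ⟨b, hb⟩ := mem_atTop_sets.1 hs
      rw [eq_top_iff, ← Real.volume_Ici (a := b)]
      exact measure_mono fun x hx => hb x hx) h2
    linear_combination h4
  have hbot : ∫ x in Ioc 0 1, g x = f 1 := by
    set L : ℂ := f 1 - ∫ x in 0..1, g x with hL
    have h2 : Tendsto f (𝓝[>] 0) (𝓝 L) := h.tendsto_nhdsGT_zero (hg.mono_set Ioc_subset_Ioi_self)
    -- a nonzero limit contradicts the integrability of `f x / x`
    have h3 : L = 0 := by
      by_contra hne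
      have hpos : 0 < ‖L‖ / 2 := by positivity
      have h4 : ∀ᶠ x in 𝓝[>] (0 : ℝ), ‖L‖ / 2 < ‖f x‖ :=
        h2.norm.eventually_const_lt (half_lt_self (norm_pos_iff.2 hne))
      obtain ⟨ε, hε, hsub⟩ := mem_nhdsGT_iff_exists_Ioc_subset.1 h4
      have hε0 : (0 : ℝ) < ε := hε
      set δ := min ε 1
      have hδ : 0 < δ := lt_min hε0 one_pos
      have h5 : IntegrableOn (fun x : ℝ => x⁻¹) (Ioc 0 δ) := by
        refine Integrable.mono' ((hf'.mono_set (Ioc_subset_Ioc_right (min_le_right ε 1))).norm.const_mul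
          (‖L‖ / 2)⁻¹) measurable_inv.aestronglyMeasurable ?_
        rw [ae_restrict_iff' measurableSet_Ioc]
        refine Eventually.of_forall fun x hx => ?_
        have h6 : ‖L‖ / 2 < ‖f x‖ := hsub ⟨hx.1, hx.2.trans (min_le_left _ _)⟩
        have hx0 : 0 < x := hx.1
        rw [norm_div, norm_inv, Complex.norm_real, Real.norm_of_nonneg hx0.le, ← div_eq_inv_mul,
          le_div_iff₀ hpos, inv_mul_eq_div]
        gcongr
      have h6 := (intervalIntegrable_iff_integrableOn_Ioc_of_le hδ.le).2 h5
      rw [intervalIntegrable_inv_iff] at h6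
      rcases h6 with h6 | h6
      · exact hδ.ne h6
      · exact h6 left_mem_uIcc
    rw [← intervalIntegral.integral_of_le zero_le_one]
    linear_combination -h3
  rw [hsplit, htop, hbot]
  ring

end RadialDirac

namespace RadialDirac

open MeasureTheory Set Filter Topology
open scoped ENNReal

/-! ### Hardy inequalities -/

/-- Schur's test with the same weight on both sides. -/
theorem lintegral_sq_lintegral_le {μ : Measure ℝ} [SFinite μ] {K : ℝ → ℝ → ℝ≥0∞}
    (hK : Measurable (Function.uncurry K)) {p : ℝ → ℝ≥0∞} (hp : Measurable p)
    (hp0 : ∀ᵐ x ∂μ, p x ≠ 0 ∧ p x ≠ ⊤) {A : ℝ≥0∞}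
    (h1 : ∀ᵐ r ∂μ, ∫⁻ ρ, K r ρ * p ρ ∂μ ≤ A * p r)
    (h2 : ∀ᵐ ρ ∂μ, ∫⁻ r, K r ρ * p r ∂μ ≤ A * p ρ) {G : ℝ → ℝ≥0∞} (hG : AEMeasurable G μ) :
    ∫⁻ r, (∫⁻ ρ, K r ρ * G ρ ∂μ) ^ 2 ∂μ ≤ A ^ 2 * ∫⁻ ρ, G ρ ^ 2 ∂μ := by
  have hKr : ∀ r, Measurable (K r) := fun r => hK.of_uncurry_left
  have step : ∀ᵐ r ∂μ, (∫⁻ ρ, K r ρ * G ρ ∂μ) ^ 2 ≤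
      A * ∫⁻ ρ, p r * (K r ρ * (G ρ ^ 2 * (p ρ)⁻¹)) ∂μ := by
    filter_upwards [h1] with r hr
    have hm1 : AEMeasurable (fun ρ => K r ρ * p ρ) μ := ((hKr r).mul hp).aemeasurable
    have hm2 : AEMeasurable (fun ρ => K r ρ * (G ρ ^ 2 * (p ρ)⁻¹)) μ :=
      (hKr r).aemeasurable.mul ((hG.pow_const 2).mul hp.inv.aemeasurable)
    have hcs := ENNReal.lintegral_mul_le_Lp_mul_Lq μ Real.HolderConjugate.two_two
      (hm1.pow_const (1 / 2 : ℝ)) (hm2.pow_const (1 / 2 : ℝ))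
    have hl : ∫⁻ ρ, K r ρ * G ρ ∂μ = ∫⁻ ρ, ((fun ρ => (K r ρ * p ρ) ^ (1 / 2 : ℝ)) *
        (fun ρ => (K r ρ * (G ρ ^ 2 * (p ρ)⁻¹)) ^ (1 / 2 : ℝ))) ρ ∂μ := by
      refine lintegral_congr_ae ?_
      filter_upwards [hp0] with ρ hρ
      rw [Pi.mul_apply, ← ENNReal.mul_rpow_of_nonneg _ _ (by norm_num)]
      have : K r ρ * p ρ * (K r ρ * (G ρ ^ 2 * (p ρ)⁻¹)) = (K r ρ * G ρ) ^ (2 : ℝ) := by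
        rw [ENNReal.rpow_two]
        calc _ = (K r ρ * G ρ) ^ 2 * (p ρ * (p ρ)⁻¹) := by ring
          _ = _ := by rw [ENNReal.mul_inv_cancel hρ.1 hρ.2, mul_one]
      rw [this, ← ENNReal.rpow_mul]
      norm_num
    simp only [← ENNReal.rpow_mul] at hcs
    norm_num at hcs
    rw [hl]
    calc _ ≤ ((∫⁻ ρ, K r ρ * p ρ ∂μ) ^ (1 / 2 : ℝ) *
          (∫⁻ ρ, K r ρ * (G ρ ^ 2 * (p ρ)⁻¹) ∂μ) ^ (1 / 2 : ℝ)) ^ 2 := by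
          gcongr
          simpa using hcs
      _ = (∫⁻ ρ, K r ρ * p ρ ∂μ) * ∫⁻ ρ, K r ρ * (G ρ ^ 2 * (p ρ)⁻¹) ∂μ := by
          rw [mul_pow, ← ENNReal.rpow_two, ← ENNReal.rpow_two, ← ENNReal.rpow_mul,
            ← ENNReal.rpow_mul]
          norm_num
      _ ≤ (A * p r) * ∫⁻ ρ, K r ρ * (G ρ ^ 2 * (p ρ)⁻¹) ∂μ := by gcongr
      _ = _ := by rw [lintegral_const_mul'' _ hm2, mul_assoc]
  have hmeas : AEMeasurable (Function.uncurry fun r ρ => p r * (K r ρ * (G ρ ^ 2 * (p ρ)⁻¹)))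
      (μ.prod μ) := by
    refine (hp.comp measurable_fst).aemeasurable.mul (hK.aemeasurable.mul ?_)
    have hG' : AEMeasurable (fun z : ℝ × ℝ => G z.2) (μ.prod μ) :=
      hG.comp_quasiMeasurePreserving Measure.quasiMeasurePreserving_snd
    exact (hG'.pow_const 2).mul (hp.comp measurable_snd).inv.aemeasurable
  calc ∫⁻ r, (∫⁻ ρ, K r ρ * G ρ ∂μ) ^ 2 ∂μ
      ≤ ∫⁻ r, A * ∫⁻ ρ, p r * (K r ρ * (G ρ ^ 2 * (p ρ)⁻¹)) ∂μ ∂μ := lintegral_mono_ae step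
    _ = A * ∫⁻ r, ∫⁻ ρ, p r * (K r ρ * (G ρ ^ 2 * (p ρ)⁻¹)) ∂μ ∂μ :=
        lintegral_const_mul'' _ hmeas.lintegral_prod_right'
    _ = A * ∫⁻ ρ, ∫⁻ r, p r * (K r ρ * (G ρ ^ 2 * (p ρ)⁻¹)) ∂μ ∂μ := by
        rw [lintegral_lintegral_swap hmeas]
    _ ≤ A * ∫⁻ ρ, A * G ρ ^ 2 ∂μ := by
        gcongr 1
        refine lintegral_mono_ae ?_
        filter_upwards [h2, hp0] with ρ hρ hρ0
        calc _ = ∫⁻ r, (K r ρ * p r) * (G ρ ^ 2 * (p ρ)⁻¹) ∂μ :=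
              lintegral_congr fun r => by ring
          _ = (∫⁻ r, K r ρ * p r ∂μ) * (G ρ ^ 2 * (p ρ)⁻¹) :=
              lintegral_mul_const _ (hK.of_uncurry_right.mul hp)
          _ ≤ (A * p ρ) * (G ρ ^ 2 * (p ρ)⁻¹) := by gcongr
          _ = A * G ρ ^ 2 * (p ρ * (p ρ)⁻¹) := by ring
          _ = _ := by rw [ENNReal.mul_inv_cancel hρ0.1 hρ0.2, mul_one]
    _ = A ^ 2 * ∫⁻ ρ, G ρ ^ 2 ∂μ := by
        rw [lintegral_const_mul'' _ (hG.pow_const 2), sq, mul_assoc]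

/-- The kernel `r^{b-1} ρ^{-b}` on `0 < ρ ≤ r`, homogeneous of degree `-1`. -/
noncomputable def hardyKernel (b r ρ : ℝ) : ℝ≥0∞ :=
  if ρ ≤ r then ENNReal.ofReal (r ^ (b - 1) * ρ ^ (-b)) else 0

theorem measurable_hardyKernel (b : ℝ) : Measurable (Function.uncurry (hardyKernel b)) := by
  refine Measurable.ite (measurableSet_le measurable_snd measurable_fst) ?_ measurable_const
  exact ENNReal.measurable_ofReal.comp
    ((measurable_fst.pow_const _).mul (measurable_snd.pow_const _))

theorem lintegral_hardyKernel_left {b r : ℝ} (hb : b < 1 / 2) (hr : 0 < r) :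
    ∫⁻ ρ in Ioi 0, hardyKernel b r ρ * ENNReal.ofReal (ρ ^ (-(1 / 2) : ℝ)) ≤
      ENNReal.ofReal (1 / (1 / 2 - b)) * ENNReal.ofReal (r ^ (-(1 / 2) : ℝ)) := by
  have e : -1 < -b - 1 / 2 := by linarith
  have hi : IntegrableOn (fun ρ : ℝ => ρ ^ (-b - 1 / 2)) (Ioc 0 r) :=
    (intervalIntegrable_iff_integrableOn_Ioc_of_le hr.le).1
      (intervalIntegral.intervalIntegrable_rpow' e)
  have h1 : ∫⁻ ρ in Ioi 0, hardyKernel b r ρ * ENNReal.ofReal (ρ ^ (-(1 / 2) : ℝ)) =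
      ∫⁻ ρ in Ioc 0 r, ENNReal.ofReal (r ^ (b - 1) * ρ ^ (-b - 1 / 2)) := by
    rw [← lintegral_indicator measurableSet_Ioi, ← lintegral_indicator measurableSet_Ioc]
    refine lintegral_congr fun ρ => ?_
    by_cases h0 : 0 < ρ
    · by_cases h : ρ ≤ r
      · rw [indicator_of_mem (show ρ ∈ Ioi 0 from h0), indicator_of_mem (show ρ ∈ Ioc 0 r from ⟨h0, h⟩),
          hardyKernel, if_pos h, ← ENNReal.ofReal_mul (by positivity), mul_assoc, ← Real.rpow_add h0]
        congr 3
      · rw [indicator_of_mem (show ρ ∈ Ioi 0 from h0), indicator_of_notMem (fun h' => h h'.2),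
          hardyKernel, if_neg h, zero_mul]
    · rw [indicator_of_notMem (show ρ ∉ Ioi 0 from h0), indicator_of_notMem (fun h' => h0 h'.1)]
  rw [h1, ← ofReal_integral_eq_lintegral_ofReal (hi.const_mul _), integral_const_mul,
    ← intervalIntegral.integral_of_le hr.le, integral_rpow (Or.inl e),
    ← ENNReal.ofReal_mul (by apply one_div_nonneg.2; linarith)]
  · apply le_of_eq
    congr 1
    rw [Real.zero_rpow (by linarith), sub_zero, ← mul_div_assoc, ← Real.rpow_add hr]
    rw [show b - 1 + (-b - 1 / 2 + 1) = -(1 / 2) by ring,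
      show -b - 1 / 2 + 1 = 1 / 2 - b by ring]
    ring
  · filter_upwards [ae_restrict_mem measurableSet_Ioc] with ρ hρ
    have : 0 < ρ := hρ.1
    positivity

theorem lintegral_hardyKernel_right {b ρ : ℝ} (hb : b < 1 / 2) (hρ : 0 < ρ) :
    ∫⁻ r in Ioi 0, hardyKernel b r ρ * ENNReal.ofReal (r ^ (-(1 / 2) : ℝ)) ≤
      ENNReal.ofReal (1 / (1 / 2 - b)) * ENNReal.ofReal (ρ ^ (-(1 / 2) : ℝ)) := by
  have e : b - 3 / 2 < -1 := by linarith
  have hi : IntegrableOn (fun r : ℝ => r ^ (b - 3 / 2)) (Ioi ρ) := integrableOn_Ioi_rpow_of_lt e hρ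
  have h1 : ∫⁻ r in Ioi 0, hardyKernel b r ρ * ENNReal.ofReal (r ^ (-(1 / 2) : ℝ)) =
      ∫⁻ r in Ici ρ, ENNReal.ofReal (ρ ^ (-b) * r ^ (b - 3 / 2)) := by
    rw [← lintegral_indicator measurableSet_Ioi, ← lintegral_indicator measurableSet_Ici]
    refine lintegral_congr fun r => ?_
    by_cases h : ρ ≤ r
    · have h0 : 0 < r := hρ.trans_le h
      rw [indicator_of_mem (show r ∈ Ioi 0 from h0), indicator_of_mem (show r ∈ Ici ρ from h),
        hardyKernel, if_pos h, ← ENNReal.ofReal_mul (by positivity)]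
      rw [show b - 3 / 2 = b - 1 + -(1 / 2) by ring, Real.rpow_add h0 (b - 1)]
      congr 1
      ring
    · rw [indicator_of_notMem (show r ∉ Ici ρ from h)]
      simp [indicator, hardyKernel, h]
  rw [h1, setLIntegral_congr (Ioi_ae_eq_Ici (a := ρ)).symm,
    ← ofReal_integral_eq_lintegral_ofReal (hi.const_mul _), integral_const_mul,
    integral_Ioi_rpow_of_lt e hρ, ← ENNReal.ofReal_mul (by apply one_div_nonneg.2; linarith)]
  · apply le_of_eq
    congr 1
    rw [mul_div_assoc', mul_neg, ← Real.rpow_add hρ,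
      show -b + (b - 3 / 2 + 1) = -(1 / 2) by ring,
      show b - 3 / 2 + 1 = -(1 / 2 - b) by ring, neg_div_neg_eq]
    ring
  · filter_upwards [ae_restrict_mem measurableSet_Ioi] with r hr
    have : 0 < r := hρ.trans hr
    positivity

theorem ae_rpow_ne_zero_and_ne_top (c : ℝ) :
    ∀ᵐ x ∂(volume.restrict (Ioi (0 : ℝ))), ENNReal.ofReal (x ^ c) ≠ 0 ∧ ENNReal.ofReal (x ^ c) ≠ ⊤ := by
  filter_upwards [ae_restrict_mem measurableSet_Ioi] with x hx
  have : 0 < x := hx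
  exact ⟨by simpa using (by positivity), ENNReal.ofReal_ne_top⟩

theorem memLp_two_of_lintegral {E : Type*} [NormedAddCommGroup E] {μ : Measure ℝ} {v : ℝ → E}
    (hv : AEStronglyMeasurable v μ) (h : ∫⁻ x, ‖v x‖ₑ ^ 2 ∂μ < ⊤) : MemLp v 2 μ := by
  refine ⟨hv, ?_⟩
  rw [eLpNorm_lt_top_iff_lintegral_rpow_enorm_lt_top (by norm_num) (by norm_num)]
  simpa using h

theorem lintegral_lt_top_of_memLp_two {E : Type*} [NormedAddCommGroup E] {μ : Measure ℝ} {v : ℝ → E}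
    (h : MemLp v 2 μ) : ∫⁻ x, ‖v x‖ₑ ^ 2 ∂μ < ⊤ := by
  have := (eLpNorm_lt_top_iff_lintegral_rpow_enorm_lt_top (by norm_num) (by norm_num)).1 h.2
  simpa using this

/-- The integral operator with kernel `hardyKernel b`, `b < 1/2`, is bounded on `L²(0,+∞)`. -/
theorem memLp_of_enorm_le_hardyKernel {b : ℝ} (hb : b < 1 / 2) {g v : ℝ → ℂ} {s : Set ℝ}
    (hg : MemLp g 2 (volume.restrict (Ioi 0))) (hs : s ⊆ Ioi 0)
    (hv : AEStronglyMeasurable v (volume.restrict s))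
    (h : ∀ᵐ r ∂(volume.restrict s), ‖v r‖ₑ ≤ ∫⁻ ρ in Ioi 0, hardyKernel b r ρ * ‖g ρ‖ₑ) :
    MemLp v 2 (volume.restrict s) := by
  refine memLp_two_of_lintegral hv ?_
  calc ∫⁻ x in s, ‖v x‖ₑ ^ 2
      ≤ ∫⁻ r in s, (∫⁻ ρ in Ioi 0, hardyKernel b r ρ * ‖g ρ‖ₑ) ^ 2 :=
        lintegral_mono_ae (by filter_upwards [h] with r hr; gcongr)
    _ ≤ ∫⁻ r in Ioi 0, (∫⁻ ρ in Ioi 0, hardyKernel b r ρ * ‖g ρ‖ₑ) ^ 2 :=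
        lintegral_mono_set hs
    _ ≤ _ := lintegral_sq_lintegral_le (measurable_hardyKernel b) (by fun_prop)
        (ae_rpow_ne_zero_and_ne_top (-(1 / 2)))
        (by filter_upwards [ae_restrict_mem measurableSet_Ioi] with r hr
            exact lintegral_hardyKernel_left hb hr)
        (by filter_upwards [ae_restrict_mem measurableSet_Ioi] with r hr
            exact lintegral_hardyKernel_right hb hr) hg.1.enorm
    _ < ⊤ := ENNReal.mul_lt_top (by simp) (lintegral_lt_top_of_memLp_two hg)

/-- The transpose of `hardyKernel (1 - b)`, `b > 1/2`, is bounded on `L²(0,+∞)`. -/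
theorem memLp_of_enorm_le_hardyKernel_transpose {b : ℝ} (hb : 1 / 2 < b) {g v : ℝ → ℂ} {s : Set ℝ}
    (hg : MemLp g 2 (volume.restrict (Ioi 0))) (hs : s ⊆ Ioi 0)
    (hv : AEStronglyMeasurable v (volume.restrict s))
    (h : ∀ᵐ r ∂(volume.restrict s), ‖v r‖ₑ ≤ ∫⁻ ρ in Ioi 0, hardyKernel (1 - b) ρ r * ‖g ρ‖ₑ) :
    MemLp v 2 (volume.restrict s) := by
  refine memLp_two_of_lintegral hv ?_
  calc ∫⁻ x in s, ‖v x‖ₑ ^ 2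
      ≤ ∫⁻ r in s, (∫⁻ ρ in Ioi 0, hardyKernel (1 - b) ρ r * ‖g ρ‖ₑ) ^ 2 :=
        lintegral_mono_ae (by filter_upwards [h] with r hr; gcongr)
    _ ≤ ∫⁻ r in Ioi 0, (∫⁻ ρ in Ioi 0, hardyKernel (1 - b) ρ r * ‖g ρ‖ₑ) ^ 2 :=
        lintegral_mono_set hs
    _ ≤ _ := lintegral_sq_lintegral_le (K := fun r ρ => hardyKernel (1 - b) ρ r)
        ((measurable_hardyKernel (1 - b)).comp measurable_swap) (by fun_prop)
        (ae_rpow_ne_zero_and_ne_top (-(1 / 2)))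
        (by filter_upwards [ae_restrict_mem measurableSet_Ioi] with r hr
            exact lintegral_hardyKernel_right (by linarith) hr)
        (by filter_upwards [ae_restrict_mem measurableSet_Ioi] with r hr
            exact lintegral_hardyKernel_left (by linarith) hr) hg.1.enorm
    _ < ⊤ := ENNReal.mul_lt_top (by simp) (lintegral_lt_top_of_memLp_two hg)

/-! ### The scalar equation `r Y' = a Y + r g` -/

theorem hasDerivAt_cpow {c : ℂ} {x : ℝ} (hx : 0 < x) :
    HasDerivAt (fun y : ℝ => (y : ℂ) ^ c) (c * (x : ℂ) ^ c / x) x := by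
  rcases eq_or_ne c 0 with rfl | hc
  · simpa using hasDerivAt_const x (1 : ℂ)
  · convert! hasDerivAt_ofReal_cpow_const hx.ne' hc using 1
    rw [Complex.cpow_sub _ _ (by exact_mod_cast hx.ne'), Complex.cpow_one, mul_div_assoc]

theorem continuousOn_cpow (c : ℂ) : ContinuousOn (fun y : ℝ => (y : ℂ) ^ c) (Ioi 0) :=
  fun _ hx => (hasDerivAt_cpow hx).continuousAt.continuousWithinAt

theorem memLp_cpow_iff {c : ℂ} {R : ℝ} (hR : 0 < R) :
    MemLp (fun r : ℝ => (r : ℂ) ^ c) 2 (volume.restrict (Ioc 0 R)) ↔ -(1 / 2) < c.re := by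
  have hm : AEStronglyMeasurable (fun r : ℝ => (r : ℂ) ^ c) (volume.restrict (Ioc 0 R)) :=
    ((continuousOn_cpow c).mono Ioc_subset_Ioi_self).aestronglyMeasurable measurableSet_Ioc
  rw [memLp_two_iff_integrable_sq_norm hm]
  have h1 : IntegrableOn (fun x : ℝ => x ^ (2 * c.re)) (Ioc 0 R) ↔ -1 < 2 * c.re := by
    rw [← intervalIntegral.integrableOn_Ioo_rpow_iff hR, integrableOn_Ioc_iff_integrableOn_Ioo]
  rw [show -(1 / 2) < c.re ↔ -1 < 2 * c.re by constructor <;> intro h <;> linarith, ← h1]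
  refine integrable_congr ?_
  filter_upwards [ae_restrict_mem measurableSet_Ioc] with x hx
  rw [Complex.norm_cpow_eq_rpow_re_of_pos hx.1, ← Real.rpow_mul_natCast hx.1.le, mul_comm]
  norm_num

theorem MemLp.mono_Ioc {E : Type*} [NormedAddCommGroup E] {g : ℝ → E}
    (hg : MemLp g 2 (volume.restrict (Ioi 0))) (R : ℝ) : MemLp g 2 (volume.restrict (Ioc 0 R)) :=
  hg.mono_measure (Measure.restrict_mono Ioc_subset_Ioi_self le_rfl)

theorem integrableOn_cpow_mul {a : ℂ} {g : ℝ → ℂ} {R : ℝ} (hR : 0 < R) (ha : a.re < 1 / 2)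
    (hg : MemLp g 2 (volume.restrict (Ioi 0))) :
    IntegrableOn (fun r : ℝ => (r : ℂ) ^ (-a) * g r) (Ioc 0 R) := by
  have h := (memLp_cpow_iff (c := -a) hR).2 (by rw [Complex.neg_re]; linarith)
  exact h.integrable_mul (MemLp.mono_Ioc hg R)

/-- The integrating factor `r^{-a}`. -/
theorem IsPrimitive.cpow_mul {a : ℂ} {Y g : ℝ → ℂ}
    (h : IsPrimitive Y fun r => a * Y r / r + g r) :
    IsPrimitive (fun r : ℝ => (r : ℂ) ^ (-a) * Y r) (fun r => (r : ℂ) ^ (-a) * g r) := by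
  have h1 : IsPrimitive (fun r : ℝ => (r : ℂ) ^ (-a)) (fun r => -a * (r : ℂ) ^ (-a) / r) :=
    IsPrimitive.of_hasDerivAt (fun x hx => hasDerivAt_cpow hx)
      ((continuousOn_const.mul (continuousOn_cpow _)).div Complex.continuous_ofReal.continuousOn
        fun x hx => by exact_mod_cast (ne_of_gt hx))
  refine (h1.mul h).congr_ae (Eventually.of_forall fun r => ?_)
  ring

theorem cpow_mul_cpow_neg {a : ℂ} {r : ℝ} (hr : 0 < r) (y : ℂ) :
    (r : ℂ) ^ a * ((r : ℂ) ^ (-a) * y) = y := by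
  have h0 : (r : ℂ) ≠ 0 := by exact_mod_cast hr.ne'
  rw [← mul_assoc, ← Complex.cpow_add _ _ h0, add_neg_cancel, Complex.cpow_zero, one_mul]

theorem aestronglyMeasurable_div {Y : ℝ → ℂ} (hY : ContinuousOn Y (Ioi 0)) (R : ℝ) :
    AEStronglyMeasurable (fun r : ℝ => Y r / r) (volume.restrict (Ioc 0 R)) :=
  ((hY.div Complex.continuous_ofReal.continuousOn
    fun x hx => by exact_mod_cast (ne_of_gt hx)).mono Ioc_subset_Ioi_self).aestronglyMeasurable
    measurableSet_Ioc

theorem enorm_cpow {r : ℝ} (hr : 0 < r) (c : ℂ) :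
    ‖(r : ℂ) ^ c‖ₑ = ENNReal.ofReal (r ^ c.re) := by
  rw [← ofReal_norm, Complex.norm_cpow_eq_rpow_re_of_pos hr]

/-- Hardy's inequality below the critical exponent: if the homogeneous part `r^a` is absent, then
`Y = r^a ∫₀ʳ ρ^(-a) g`. -/
theorem memLp_div_of_tendsto {a : ℂ} {Y g : ℝ → ℂ} (ha : a.re < 1 / 2)
    (h : IsPrimitive Y fun r => a * Y r / r + g r) (hg : MemLp g 2 (volume.restrict (Ioi 0)))
    (h0 : Tendsto (fun r : ℝ => (r : ℂ) ^ (-a) * Y r) (𝓝[>] 0) (𝓝 0)) :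
    MemLp (fun r : ℝ => Y r / r) 2 (volume.restrict (Ioc 0 1)) := by
  refine memLp_of_enorm_le_hardyKernel ha hg Ioc_subset_Ioi_self
    (aestronglyMeasurable_div h.continuousOn 1) ?_
  filter_upwards [ae_restrict_mem measurableSet_Ioc] with r hr
  have h1 := h.cpow_mul.eq_integral_of_tendsto (integrableOn_cpow_mul one_pos ha hg) h0 hr
  have hr0 : (r : ℂ) ≠ 0 := by exact_mod_cast hr.1.ne'
  have h2 : Y r / r = (r : ℂ) ^ (a - 1) * ∫ t in Ioc 0 r, (t : ℂ) ^ (-a) * g t := by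
    rw [← h1, Complex.cpow_sub _ _ hr0, Complex.cpow_one, div_mul_eq_mul_div, cpow_mul_cpow_neg hr.1]
  rw [h2, enorm_mul, enorm_cpow hr.1]
  calc _ ≤ ENNReal.ofReal (r ^ (a - 1).re) * ∫⁻ t in Ioc 0 r, ‖(t : ℂ) ^ (-a) * g t‖ₑ := by
        gcongr
        exact enorm_integral_le_lintegral_enorm _
    _ = ∫⁻ t in Ioc 0 r, ENNReal.ofReal (r ^ (a - 1).re) * ‖(t : ℂ) ^ (-a) * g t‖ₑ :=
        (lintegral_const_mul' _ _ ENNReal.ofReal_ne_top).symm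
    _ = ∫⁻ t in Ioc 0 r, hardyKernel a.re r t * ‖g t‖ₑ := by
        refine setLIntegral_congr_fun measurableSet_Ioc fun t ht => ?_
        have hr1 := hr.1
        rw [hardyKernel, if_pos ht.2, enorm_mul, enorm_cpow ht.1, ← mul_assoc,
          ENNReal.ofReal_mul (by positivity)]
        simp
    _ ≤ _ := lintegral_mono_set Ioc_subset_Ioi_self

/-- Hardy's inequality above the critical exponent, with integration starting at `1`: the
homogeneous part `r^a` satisfies the bound as well. -/
theorem memLp_div_of_half_lt {a : ℂ} {Y g : ℝ → ℂ} (ha : 1 / 2 < a.re)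
    (h : IsPrimitive Y fun r => a * Y r / r + g r) (hg : MemLp g 2 (volume.restrict (Ioi 0))) :
    MemLp (fun r : ℝ => Y r / r) 2 (volume.restrict (Ioc 0 1)) := by
  have hp := h.cpow_mul
  have h1 : MemLp (fun r : ℝ => Y 1 * (r : ℂ) ^ (a - 1)) 2 (volume.restrict (Ioc 0 1)) :=
    ((memLp_cpow_iff one_pos).2 (by simp; linarith)).const_mul _
  have key : ∀ r ∈ Ioc (0 : ℝ) 1, Y r / r = Y 1 * (r : ℂ) ^ (a - 1) -
      (r : ℂ) ^ (a - 1) * ∫ t in Ioc r 1, (t : ℂ) ^ (-a) * g t := by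
    intro r hr
    have hr0 : (r : ℂ) ≠ 0 := by exact_mod_cast hr.1.ne'
    have h2 := hp.integral_eq hr.1 one_pos
    rw [intervalIntegral.integral_of_le hr.2] at h2
    have h3 : Y r / r = (r : ℂ) ^ (a - 1) * ((r : ℂ) ^ (-a) * Y r) := by
      rw [Complex.cpow_sub _ _ hr0, Complex.cpow_one, div_mul_eq_mul_div, cpow_mul_cpow_neg hr.1]
    rw [h2, h3]
    simp only [Complex.ofReal_one, Complex.one_cpow]
    ring
  have h2 : MemLp (fun r : ℝ => Y 1 * (r : ℂ) ^ (a - 1) - Y r / r) 2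
      (volume.restrict (Ioc 0 1)) := by
    refine memLp_of_enorm_le_hardyKernel_transpose ha hg Ioc_subset_Ioi_self
      (h1.1.sub (aestronglyMeasurable_div h.continuousOn 1)) ?_
    filter_upwards [ae_restrict_mem measurableSet_Ioc] with r hr
    rw [key r hr, sub_sub_cancel, enorm_mul, enorm_cpow hr.1]
    calc _ ≤ ENNReal.ofReal (r ^ (a - 1).re) * ∫⁻ t in Ioc r 1, ‖(t : ℂ) ^ (-a) * g t‖ₑ := by
          gcongr
          exact enorm_integral_le_lintegral_enorm _
      _ = ∫⁻ t in Ioc r 1, ENNReal.ofReal (r ^ (a - 1).re) * ‖(t : ℂ) ^ (-a) * g t‖ₑ :=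
          (lintegral_const_mul' _ _ ENNReal.ofReal_ne_top).symm
      _ = ∫⁻ t in Ioc r 1, hardyKernel (1 - a.re) t r * ‖g t‖ₑ := by
          refine setLIntegral_congr_fun measurableSet_Ioc fun t ht => ?_
          have hr1 := hr.1
          have ht0 : 0 < t := hr1.trans ht.1
          rw [hardyKernel, if_pos ht.1.le, enorm_mul, enorm_cpow ht0, ← mul_assoc, mul_comm (t ^ _),
            ENNReal.ofReal_mul (by positivity)]
          simp
      _ ≤ _ := lintegral_mono_set fun t ht => hr.1.trans ht.1
  refine (h1.sub h2).ae_eq (Eventually.of_forall fun r => ?_)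
  simp

/-- For `Re a ≤ -1/2` the homogeneous solution `r^a` is not square-integrable near zero, hence absent
from a square-integrable solution. -/
theorem tendsto_zero_of_memLp {a : ℂ} {Y g : ℝ → ℂ} (ha : a.re ≤ -(1 / 2))
    (h : IsPrimitive Y fun r => a * Y r / r + g r) (hg : MemLp g 2 (volume.restrict (Ioi 0)))
    (hY : MemLp Y 2 (volume.restrict (Ioc 0 1))) :
    Tendsto (fun r : ℝ => (r : ℂ) ^ (-a) * Y r) (𝓝[>] 0) (𝓝 0) := by
  have h2 := h.cpow_mul.tendsto_nhdsGT_zero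
    (integrableOn_cpow_mul one_pos (by linarith) hg)
  generalize ((1 : ℝ) : ℂ) ^ (-a) * Y 1 - _ = L at h2
  -- a nonzero limit `L` would force `|Y r| ≥ |L|/2 * r^{Re a}` near zero
  suffices hL : L = 0 by rwa [hL] at h2
  by_contra hne
  have hpos : 0 < ‖L‖ / 2 := by positivity
  have h4 : ∀ᶠ x : ℝ in 𝓝[>] 0, ‖L‖ / 2 < ‖(x : ℂ) ^ (-a) * Y x‖ :=
    h2.norm.eventually_const_lt (half_lt_self (norm_pos_iff.2 hne))
  obtain ⟨ε, hε, hsub⟩ := mem_nhdsGT_iff_exists_Ioc_subset.1 h4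
  have hδ : 0 < min ε 1 := lt_min hε one_pos
  have h5 : MemLp (fun r : ℝ => (r : ℂ) ^ a) 2 (volume.restrict (Ioc 0 (min ε 1))) := by
    refine MemLp.of_le_mul (c := (‖L‖ / 2)⁻¹) (hY.mono_measure (Measure.restrict_mono
      (Ioc_subset_Ioc_right (min_le_right ε 1)) le_rfl))
      (((continuousOn_cpow a).mono Ioc_subset_Ioi_self).aestronglyMeasurable measurableSet_Ioc) ?_
    filter_upwards [ae_restrict_mem measurableSet_Ioc] with x hx
    have h6 : ‖L‖ / 2 < ‖(x : ℂ) ^ (-a) * Y x‖ := hsub ⟨hx.1, hx.2.trans (min_le_left _ _)⟩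
    rw [← cpow_mul_cpow_neg hx.1 (Y x) (a := a), norm_mul _ ((x : ℂ) ^ (-a) * Y x)]
    calc ‖(x : ℂ) ^ a‖ = (‖L‖ / 2)⁻¹ * (‖(x : ℂ) ^ a‖ * (‖L‖ / 2)) := by field_simp
      _ ≤ _ := by gcongr
  have h6 := (memLp_cpow_iff hδ).1 h5
  linarith

end RadialDirac

namespace RadialDirac

open MeasureTheory Set Filter Topology
open scoped ContDiff InnerProductSpace ComplexConjugate

/-! ### The Sobolev space `H¹₀` -/

/-- A point of a product of Hilbert spaces lies in the closure of a subspace as soon as it is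
annihilated by the orthogonal complement of that subspace. -/
theorem mem_topologicalClosure_of_forall_inner {E F : Type*} [NormedAddCommGroup E]
    [InnerProductSpace ℂ E] [CompleteSpace E] [NormedAddCommGroup F] [InnerProductSpace ℂ F]
    [CompleteSpace F] (g : Submodule ℂ (E × F)) (x : E × F)
    (h : ∀ a b, (∀ y ∈ g, ⟪a, y.1⟫_ℂ + ⟪b, y.2⟫_ℂ = 0) → ⟪a, x.1⟫_ℂ + ⟪b, x.2⟫_ℂ = 0) :
    x ∈ g.topologicalClosure := by
  set G : Submodule ℂ (WithLp 2 (E × F)) :=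
    g.map ((WithLp.linearEquiv 2 ℂ (E × F)).symm : E × F →ₗ[ℂ] WithLp 2 (E × F)) with hG
  have h1 : WithLp.toLp 2 x ∈ Gᗮᗮ := by
    rw [Submodule.mem_orthogonal]
    intro c hc
    rw [Submodule.mem_orthogonal'] at hc
    rw [WithLp.prod_inner_apply]
    refine h _ _ fun y hy => ?_
    have h2 := hc (WithLp.toLp 2 y) ⟨y, hy, rfl⟩
    rwa [WithLp.prod_inner_apply] at h2
  rw [Submodule.orthogonal_orthogonal_eq_closure] at h1
  have h3 := map_mem_closure (WithLp.prod_continuous_ofLp 2 E F) h1 (t := (g : Set (E × F))) (by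
    rintro _ ⟨y, hy, rfl⟩
    exact hy)
  exact h3

theorem memLp_apply (u : L2) (i : Fin 2) :
    MemLp (fun x => u x i) 2 (volume.restrict (Ioi 0)) :=
  (EuclideanSpace.proj i : EuclideanSpace ℂ (Fin 2) →L[ℂ] ℂ).comp_memLp' (Lp.memLp u)

theorem locallyIntegrableOn_of_memLp {w : ℝ → ℂ} (h : MemLp w 2 (volume.restrict (Ioi 0))) :
    LocallyIntegrableOn w (Ioi 0) := by
  rw [locallyIntegrableOn_iff isOpen_Ioi.isLocallyClosed]
  intro k hk hc
  have : IsFiniteMeasure (volume.restrict k) := ⟨by simpa using hc.measure_lt_top⟩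
  exact (h.mono_measure (Measure.restrict_mono hk le_rfl)).integrable (by norm_num)

theorem inner_eq_integral (u v : L2) :
    ⟪u, v⟫_ℂ = ∫ x in Ioi 0, (conj (u x 0) * v x 0 + conj (u x 1) * v x 1) := by
  rw [L2.inner_def]
  refine integral_congr_ae (Eventually.of_forall fun x => ?_)
  simp [PiLp.inner_apply, Fin.sum_univ_two, mul_comm]

theorem inner_toLp_right (u : L2) {f : ℝ → EuclideanSpace ℂ (Fin 2)}
    (hf : MemLp f 2 (volume.restrict (Ioi 0))) :
    ⟪u, hf.toLp f⟫_ℂ = ∫ x in Ioi 0, (conj (u x 0) * f x 0 + conj (u x 1) * f x 1) := by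
  rw [inner_eq_integral]
  refine integral_congr_ae ?_
  filter_upwards [hf.coeFn_toLp] with x hx
  rw [hx]

theorem IsTest.deriv {θ : ℝ → ℝ} (hθ : IsTest θ) : IsTest (deriv θ) :=
  ⟨(contDiff_infty_iff_deriv.1 hθ.contDiff).2, hθ.hasCompactSupport.deriv,
    (closure_minimal support_deriv_subset (isClosed_tsupport _)).trans hθ.tsupport_subset⟩

theorem IsTest.integrableOn_mul {θ : ℝ → ℝ} (hθ : IsTest θ) {w : ℝ → ℂ}
    (hw : LocallyIntegrableOn w (Ioi 0)) : IntegrableOn (fun x => (θ x : ℂ) * w x) (Ioi 0) := by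
  obtain ⟨a, b, ha, -, hz⟩ :=
    exists_Icc_of_tsupport_subset hθ.hasCompactSupport hθ.tsupport_subset
  exact integrableOn_mul_of_eq_zero ha
    (Complex.continuous_ofReal.comp hθ.contDiff.continuous).continuousOn
    (fun x hx => by simp [(hz x hx).1]) hw (b := b)

theorem IsTest.isPrimitive {θ : ℝ → ℝ} (hθ : IsTest θ) :
    IsPrimitive (fun x => (θ x : ℂ)) (fun x => ((_root_.deriv θ x : ℝ) : ℂ)) :=
  IsPrimitive.of_hasDerivAt (fun x _ =>
    (hθ.contDiff.differentiable (by simp) x).hasDerivAt.ofReal_comp)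
    (Complex.continuous_ofReal.comp hθ.deriv.contDiff.continuous).continuousOn

/-- The test function `θ eᵢ` with values in `ℂ²`. -/
noncomputable def testVec {θ : ℝ → ℝ} (hθ : IsTest θ) (i : Fin 2) : testSpace :=
  ⟨fun r => (θ r : ℂ) • EuclideanSpace.single i (1 : ℂ), by
    refine ⟨?_, ?_, ?_⟩
    · exact (Complex.ofRealCLM.contDiff.comp hθ.contDiff).smul contDiff_const
    · refine hθ.hasCompactSupport.mono' fun r hr => subset_tsupport _ fun h => hr ?_
      simp [h]
    · refine (closure_mono fun r hr => ?_).trans hθ.tsupport_subset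
      exact fun h => hr (by simp [h])⟩

theorem testVec_apply {θ : ℝ → ℝ} (hθ : IsTest θ) (i : Fin 2) (r : ℝ) :
    (testVec hθ i).1 r = (θ r : ℂ) • EuclideanSpace.single i (1 : ℂ) := rfl

theorem deriv_testVec {θ : ℝ → ℝ} (hθ : IsTest θ) (i : Fin 2) (r : ℝ) :
    deriv (testVec hθ i).1 r = ((deriv θ r : ℝ) : ℂ) • EuclideanSpace.single i (1 : ℂ) := by
  have h : HasDerivAt (fun r => (θ r : ℂ)) ((deriv θ r : ℝ) : ℂ) r :=
    (hθ.contDiff.differentiable (by simp) r).hasDerivAt.ofReal_comp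
  exact (h.smul_const _).deriv

theorem testSpace_isPrimitive (φ : testSpace) (i : Fin 2) :
    IsPrimitive (fun x => φ.1 x i) (fun x => deriv φ.1 x i) := by
  refine IsPrimitive.of_hasDerivAt (fun x _ => ?_) ?_
  · exact ((EuclideanSpace.proj i : EuclideanSpace ℂ (Fin 2) →L[ℂ] ℂ)).restrictScalars ℝ
      |>.hasFDerivAt.comp_hasDerivAt x (testSpace_differentiable φ x).hasDerivAt
  · have : Continuous (deriv φ.1) := φ.2.1.continuous_deriv (by simp)
    exact (by fun_prop : Continuous fun x => deriv φ.1 x i).continuousOn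

theorem inner_testVec (u : L2) {θ : ℝ → ℝ} (hθ : IsTest θ) (i : Fin 2) :
    ⟪testToL2 (testVec hθ i), u⟫_ℂ = ∫ x in Ioi 0, (θ x : ℂ) * u x i := by
  rw [← inner_conj_symm]
  change conj ⟪u, (testSpace_memLp (testVec hθ i)).toLp (testVec hθ i).1⟫_ℂ = _
  rw [inner_toLp_right, ← integral_conj]
  refine integral_congr_ae (Eventually.of_forall fun x => ?_)
  fin_cases i <;> simp [testVec_apply, mul_comm]

theorem inner_deriv_testVec (u : L2) {θ : ℝ → ℝ} (hθ : IsTest θ) (i : Fin 2) :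
    ⟪derivToL2 (testVec hθ i), u⟫_ℂ = ∫ x in Ioi 0, ((deriv θ x : ℝ) : ℂ) * u x i := by
  rw [← inner_conj_symm]
  change conj ⟪u, (testSpace_deriv_memLp (testVec hθ i)).toLp (deriv (testVec hθ i).1)⟫_ℂ = _
  rw [inner_toLp_right, ← integral_conj]
  refine integral_congr_ae (Eventually.of_forall fun x => ?_)
  fin_cases i <;> simp [deriv_testVec, mul_comm]

theorem memLp_conj {w : ℝ → ℂ} {μ : Measure ℝ} (h : MemLp w 2 μ) : MemLp (fun x => conj (w x)) 2 μ :=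
  h.star

/-- A square-integrable function with a square-integrable weak derivative, and with `u / r`
square-integrable near zero, is a limit of test functions in the `H¹` norm. -/
theorem mem_closure_of_hasWeakDeriv {u v : L2}
    (h : ∀ i, HasWeakDeriv (fun x => u x i) (fun x => v x i))
    (hdiv : ∀ i, MemLp (fun x => u x i / x) 2 (volume.restrict (Ioc 0 1))) :
    (u, v) ∈ (LinearMap.range (testToL2.prod derivToL2)).topologicalClosure := by
  refine mem_topologicalClosure_of_forall_inner _ _ fun a b hab => ?_
  -- the annihilator consists of pairs `(a, b)` with `b' = a`
  have hba : ∀ i, HasWeakDeriv (fun x => b x i) (fun x => a x i) := by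
    intro i θ hθ
    have h1 := hab _ ⟨testVec hθ i, rfl⟩
    rw [← inner_conj_symm, ← inner_conj_symm b, ← map_add, map_eq_zero_iff _ (RingHom.injective _)] at h1
    change ⟪testToL2 (testVec hθ i), a⟫_ℂ + ⟪derivToL2 (testVec hθ i), b⟫_ℂ = 0 at h1
    rw [inner_testVec, inner_deriv_testVec] at h1
    linear_combination h1
  have hloc : ∀ (w : L2) i, LocallyIntegrableOn (fun x => w x i) (Ioi 0) := fun w i =>
    locallyIntegrableOn_of_memLp (memLp_apply w i)
  choose U hU hUae using fun i => (h i).exists_isPrimitive (hloc u i) (hloc v i)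
  choose B hB hBae using fun i => (hba i).exists_isPrimitive (hloc b i) (hloc a i)
  have hUL : ∀ i, MemLp (U i) 2 (volume.restrict (Ioi 0)) := fun i =>
    (memLp_apply u i).ae_eq (hUae i)
  have hBL : ∀ i, MemLp (B i) 2 (volume.restrict (Ioi 0)) := fun i =>
    (memLp_apply b i).ae_eq (hBae i)
  have hle : volume.restrict (Ioc (0 : ℝ) 1) ≤ volume.restrict (Ioi 0) :=
    Measure.restrict_mono Ioc_subset_Ioi_self le_rfl
  have key : ∀ i, ∫ x in Ioi 0, (conj (a x i) * U i x + conj (B i x) * v x i) = 0 := by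
    intro i
    refine ((hB i).conj.mul (hU i)).integral_eq_zero ?_ ?_ ?_
    · exact ((memLp_conj (memLp_apply a i)).integrable_mul (hUL i)).add
        ((memLp_conj (hBL i)).integrable_mul (memLp_apply v i))
    · exact (memLp_conj (hBL i)).integrable_mul (hUL i)
    · have h1 : MemLp (fun x => U i x / x) 2 (volume.restrict (Ioc 0 1)) := by
        refine (hdiv i).ae_eq ?_
        filter_upwards [ae_mono hle (hUae i)] with x hx
        rw [hx]
      refine Integrable.congr ((memLp_conj ((hBL i).mono_measure hle)).integrable_mul h1)
        (Eventually.of_forall fun x => ?_)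
      simp only [Pi.mul_apply]
      ring
  have hint : ∀ i, Integrable (fun x => conj (a x i) * U i x + conj (B i x) * v x i)
      (volume.restrict (Ioi 0)) := fun i =>
    ((memLp_conj (memLp_apply a i)).integrable_mul (hUL i)).add
        ((memLp_conj (hBL i)).integrable_mul (memLp_apply v i))
  have hi : ∀ p q : L2, Integrable (fun x => conj (p x 0) * q x 0 + conj (p x 1) * q x 1)
      (volume.restrict (Ioi 0)) := fun p q =>
    ((memLp_conj (memLp_apply p 0)).integrable_mul (memLp_apply q 0)).add
      ((memLp_conj (memLp_apply p 1)).integrable_mul (memLp_apply q 1))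
  rw [inner_eq_integral, inner_eq_integral, ← integral_add (hi a u) (hi b v)]
  calc _ = ∫ x in Ioi 0, ((conj (a x 0) * U 0 x + conj (B 0 x) * v x 0) +
        (conj (a x 1) * U 1 x + conj (B 1 x) * v x 1)) := by
        refine integral_congr_ae ?_
        filter_upwards [hUae 0, hUae 1, hBae 0, hBae 1] with x h1 h2 h3 h4
        rw [← h1, ← h2, ← h3, ← h4]
        ring
    _ = 0 := by rw [integral_add (hint 0) (hint 1), key 0, key 1, add_zero]

/-- Elements of `H¹₀` have a square-integrable weak derivative. -/
theorem exists_hasWeakDeriv_of_mem_H10 {u : L2} (hu : u ∈ H10) :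
    ∃ v : L2, ∀ i, HasWeakDeriv (fun x => u x i) (fun x => v x i) := by
  obtain ⟨⟨u', v⟩, h, rfl⟩ := hu
  refine ⟨v, fun i θ hθ => ?_⟩
  have hcl : IsClosed {z : L2 × L2 | ⟪testToL2 (testVec hθ.deriv i), z.1⟫_ℂ +
      ⟪testToL2 (testVec hθ i), z.2⟫_ℂ = 0} :=
    isClosed_eq (by fun_prop) continuous_const
  have hsub := closure_minimal (s := (LinearMap.range (testToL2.prod derivToL2) : Set (L2 × L2)))
    ?_ hcl h
  · simp only [mem_ofPred_eq, inner_testVec] at hsub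
    exact eq_neg_of_add_eq_zero_left hsub
  · rintro _ ⟨φ, rfl⟩
    change ⟪testToL2 (testVec hθ.deriv i), testToL2 φ⟫_ℂ +
      ⟪testToL2 (testVec hθ i), derivToL2 φ⟫_ℂ = 0
    rw [inner_testVec, inner_testVec]
    obtain ⟨a, b, ha, hab, hz⟩ :=
      exists_Icc_of_tsupport_subset hθ.hasCompactSupport hθ.tsupport_subset
    have h1 := (hθ.isPrimitive.mul (testSpace_isPrimitive φ i)).integral_eq_zero_of_eq_zero ha hab
      (fun x hx => by simp [(hz x hx).1]) (fun x hx => by simp [(hz x hx).1, (hz x hx).2])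
    have hcd : Continuous (deriv φ.1) := φ.2.1.continuous_deriv (by simp)
    have hc : Continuous φ.1 := φ.2.1.continuous
    rw [integral_add (hθ.deriv.integrableOn_mul
        ((by fun_prop : Continuous fun x => φ.1 x i).locallyIntegrable.locallyIntegrableOn _))
      (hθ.integrableOn_mul ((by fun_prop :
        Continuous fun x => deriv φ.1 x i).locallyIntegrable.locallyIntegrableOn _))] at h1
    rw [← h1]
    congr 1
    · refine integral_congr_ae ?_
      filter_upwards [(testSpace_memLp φ).coeFn_toLp] with x hx
      rw [← hx]
      rfl
    · refine integral_congr_ae ?_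
      filter_upwards [(testSpace_deriv_memLp φ).coeFn_toLp] with x hx
      rw [← hx]
      rfl

end RadialDirac

namespace RadialDirac

open MeasureTheory Set Filter Topology
open scoped ContDiff InnerProductSpace ComplexConjugate

/-! ### The adjoint of the radial operator -/

theorem radialOp_dense (ν l : ℝ) : Dense ((radialOp ν l).domain : Set L2) := by
  rw [Submodule.dense_iff_topologicalClosure_eq_top, Submodule.topologicalClosure_eq_top_iff,
    Submodule.eq_bot_iff]
  intro u hu
  rw [Submodule.mem_orthogonal] at hu
  have key : ∀ i, ∀ᵐ x ∂(volume.restrict (Ioi 0)), u x i = 0 := by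
    intro i
    rw [ae_restrict_iff' measurableSet_Ioi]
    refine isOpen_Ioi.ae_eq_zero_of_integral_contDiff_smul_eq_zero
      (locallyIntegrableOn_of_memLp (memLp_apply u i)) fun θ h1 h2 h3 => ?_
    have h := hu _ ⟨testVec ⟨h1, h2, h3⟩ i, rfl⟩
    rw [inner_testVec] at h
    rw [← h, ← setIntegral_eq_integral_of_forall_compl_eq_zero (s := Ioi 0)]
    · rfl
    · exact fun x hx => by rw [image_eq_zero_of_notMem_tsupport fun h => hx (h3 h), zero_smul]
  refine (Lp.eq_zero_iff_ae_eq_zero).2 ?_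
  filter_upwards [key 0, key 1] with x h0 h1
  ext i
  fin_cases i
  · exact h0
  · exact h1

theorem mem_adjoint_graph_iff {ν l : ℝ} {u f : L2} :
    (u, f) ∈ (radialOp ν l).adjoint.graph ↔
      ∀ φ : testSpace, ⟪f, testToL2 φ⟫_ℂ = ⟪u, dToL2 ν l φ⟫_ℂ := by
  rw [LinearPMap.adjoint_graph_eq_graph_adjoint (radialOp_dense ν l), Submodule.mem_adjoint_iff]
  constructor
  · intro h φ
    have h1 := h (testToL2 φ) (dToL2 ν l φ) (by
      rw [LinearPMap.mem_graph_iff]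
      exact ⟨⟨testToL2 φ, LinearMap.mem_range_self testToL2 φ⟩, rfl, radialOp_apply ν l φ⟩)
    rw [← inner_conj_symm, ← inner_conj_symm u, sub_eq_zero.1 h1]
  · rintro h a b hab
    rw [LinearPMap.mem_graph_iff] at hab
    obtain ⟨⟨_, φ, rfl⟩, h1, h2⟩ := hab
    have h3 := radialOp_apply ν l φ
    simp only at h1 h2
    rw [← h1, ← h2]
    refine Eq.trans (congrArg₂ (· - ·) (congrArg (⟪·, u⟫_ℂ) h3) rfl) ?_
    simp only
    rw [← inner_conj_symm, ← inner_conj_symm _ f, h φ, sub_self]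

/-- The first-order system `d U = F`, solved for the derivatives of the locally absolutely
continuous functions `U 0` and `U 1`: the second row of `d` gives `U 0`, the first gives `U 1`. -/
structure RadialODE (ν l : ℝ) (U F : Fin 2 → ℝ → ℂ) : Prop where
  fst : IsPrimitive (U 0) fun r => (l * U 0 r - ν * U 1 r) / r + F 1 r
  snd : IsPrimitive (U 1) fun r => (ν * U 0 r - l * U 1 r) / r - F 0 r

theorem locallyIntegrableOn_div {w : ℝ → ℂ} (hw : LocallyIntegrableOn w (Ioi 0)) :
    LocallyIntegrableOn (fun x : ℝ => w x / x) (Ioi 0) := by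
  have hc : ContinuousOn (fun x : ℝ => ((x : ℂ))⁻¹) (Ioi 0) :=
    Complex.continuous_ofReal.continuousOn.inv₀ fun x hx => by exact_mod_cast (ne_of_gt hx)
  simp_rw [div_eq_mul_inv]
  exact hw.mul_continuousOn hc isOpen_Ioi.isLocallyClosed

theorem dExpr_testVec_zero {θ : ℝ → ℝ} (hθ : IsTest θ) (ν l r : ℝ) :
    dExpr ν l (testVec hθ 0).1 r 0 = (θ r : ℂ) * (ν / r) ∧
    dExpr ν l (testVec hθ 0).1 r 1 = ((deriv θ r : ℝ) : ℂ) - (θ r : ℂ) * (l / r) := by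
  constructor <;> simp [dExpr, testVec_apply, deriv_testVec, mul_comm]

theorem dExpr_testVec_one {θ : ℝ → ℝ} (hθ : IsTest θ) (ν l r : ℝ) :
    dExpr ν l (testVec hθ 1).1 r 0 = -((deriv θ r : ℝ) : ℂ) - (θ r : ℂ) * (l / r) ∧
    dExpr ν l (testVec hθ 1).1 r 1 = (θ r : ℂ) * (ν / r) := by
  constructor <;> simp [dExpr, testVec_apply, deriv_testVec, mul_comm]

theorem inner_dToL2 (u : L2) (ν l : ℝ) (φ : testSpace) :
    ⟪dToL2 ν l φ, u⟫_ℂ = ∫ x in Ioi 0,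
      (u x 0 * conj (dExpr ν l φ.1 x 0) + u x 1 * conj (dExpr ν l φ.1 x 1)) := by
  rw [← inner_conj_symm]
  change conj ⟪u, (testSpace_dExpr_memLp ν l φ).toLp (dExpr ν l φ.1)⟫_ℂ = _
  rw [inner_toLp_right, ← integral_conj]
  refine integral_congr_ae (Eventually.of_forall fun x => ?_)
  simp

/-- Elements of the domain of the adjoint solve the differential equation. -/
theorem exists_radialODE {ν l : ℝ} {u f : L2} (h : (u, f) ∈ (radialOp ν l).adjoint.graph) :
    ∃ U : Fin 2 → ℝ → ℂ, RadialODE ν l U (fun i r => f r i) ∧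
      ∀ i, (fun r => u r i) =ᵐ[volume.restrict (Ioi 0)] U i := by
  rw [mem_adjoint_graph_iff] at h
  have h' : ∀ φ : testSpace, ⟪testToL2 φ, f⟫_ℂ = ⟪dToL2 ν l φ, u⟫_ℂ := fun φ => by
    rw [← inner_conj_symm, h φ, inner_conj_symm]
  have hloc : ∀ (w : L2) i, LocallyIntegrableOn (fun x => w x i) (Ioi 0) := fun w i =>
    locallyIntegrableOn_of_memLp (memLp_apply w i)
  have l0 : LocallyIntegrableOn (fun x : ℝ => (ν * u x 0 - l * u x 1) / x) (Ioi 0) :=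
    locallyIntegrableOn_div (((hloc u 0).smul (ν : ℂ)).sub ((hloc u 1).smul (l : ℂ)))
  have l1 : LocallyIntegrableOn (fun x : ℝ => (l * u x 0 - ν * u x 1) / x) (Ioi 0) :=
    locallyIntegrableOn_div (((hloc u 0).smul (l : ℂ)).sub ((hloc u 1).smul (ν : ℂ)))
  have w1 : HasWeakDeriv (fun x => u x 1) (fun x : ℝ => (ν * u x 0 - l * u x 1) / x - f x 0) := by
    intro θ hθ
    have h1 := h' (testVec hθ 0)
    rw [inner_testVec, inner_dToL2] at h1
    have e1 : ∫ x in Ioi 0, (θ x : ℂ) * ((ν * u x 0 - l * u x 1) / x - f x 0) =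
        (∫ x in Ioi 0, (θ x : ℂ) * ((ν * u x 0 - l * u x 1) / x)) -
          ∫ x in Ioi 0, (θ x : ℂ) * f x 0 := by
      rw [← integral_sub (hθ.integrableOn_mul l0) (hθ.integrableOn_mul (hloc f 0))]
      simp_rw [mul_sub]
    have e2 : ∫ x in Ioi 0, (u x 0 * conj (dExpr ν l (testVec hθ 0).1 x 0) +
        u x 1 * conj (dExpr ν l (testVec hθ 0).1 x 1)) =
        (∫ x in Ioi 0, (θ x : ℂ) * ((ν * u x 0 - l * u x 1) / x)) +
          ∫ x in Ioi 0, ((deriv θ x : ℝ) : ℂ) * u x 1 := by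
      rw [← integral_add (hθ.integrableOn_mul l0) (hθ.deriv.integrableOn_mul (hloc u 1))]
      refine integral_congr_ae (Eventually.of_forall fun x => ?_)
      simp only [dExpr_testVec_zero hθ, map_sub, map_mul, map_div₀, Complex.conj_ofReal]
      ring
    rw [e1]
    rw [e2] at h1
    linear_combination -h1
  have w0 : HasWeakDeriv (fun x => u x 0) (fun x : ℝ => (l * u x 0 - ν * u x 1) / x + f x 1) := by
    intro θ hθ
    have h1 := h' (testVec hθ 1)
    rw [inner_testVec, inner_dToL2] at h1
    have e1 : ∫ x in Ioi 0, (θ x : ℂ) * ((l * u x 0 - ν * u x 1) / x + f x 1) =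
        (∫ x in Ioi 0, (θ x : ℂ) * ((l * u x 0 - ν * u x 1) / x)) +
          ∫ x in Ioi 0, (θ x : ℂ) * f x 1 := by
      rw [← integral_add (hθ.integrableOn_mul l1) (hθ.integrableOn_mul (hloc f 1))]
      simp_rw [mul_add]
    have e2 : ∫ x in Ioi 0, (u x 0 * conj (dExpr ν l (testVec hθ 1).1 x 0) +
        u x 1 * conj (dExpr ν l (testVec hθ 1).1 x 1)) =
        -((∫ x in Ioi 0, (θ x : ℂ) * ((l * u x 0 - ν * u x 1) / x)) +
          ∫ x in Ioi 0, ((deriv θ x : ℝ) : ℂ) * u x 0) := by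
      rw [← integral_add (hθ.integrableOn_mul l1) (hθ.deriv.integrableOn_mul (hloc u 0)),
        ← integral_neg]
      refine integral_congr_ae (Eventually.of_forall fun x => ?_)
      simp only [dExpr_testVec_one hθ, map_sub, map_neg, map_mul, map_div₀, Complex.conj_ofReal]
      ring
    rw [e1]
    rw [e2] at h1
    linear_combination h1
  obtain ⟨U1, hU1, h1⟩ := w1.exists_isPrimitive (hloc u 1) (l0.sub (hloc f 0))
  obtain ⟨U0, hU0, h0⟩ := w0.exists_isPrimitive (hloc u 0) (l1.add (hloc f 1))
  refine ⟨![U0, U1], ⟨hU0.congr_ae ?_, hU1.congr_ae ?_⟩, fun i => ?_⟩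
  · filter_upwards [h0, h1] with x h0 h1
    simp [h0, h1]
  · filter_upwards [h0, h1] with x h0 h1
    simp [h0, h1]
  · fin_cases i
    · exact h0
    · exact h1

theorem integrable_inner (p q : L2) :
    Integrable (fun x => conj (p x 0) * q x 0 + conj (p x 1) * q x 1)
      (volume.restrict (Ioi 0)) :=
  ((memLp_conj (memLp_apply p 0)).integrable_mul (memLp_apply q 0)).add
    ((memLp_conj (memLp_apply p 1)).integrable_mul (memLp_apply q 1))

/-- Square-integrable solutions of the differential equation lie in the domain of the adjoint. -/
theorem RadialODE.mem_adjoint_graph {ν l : ℝ} {U F : Fin 2 → ℝ → ℂ} (h : RadialODE ν l U F)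
    {u f : L2} (hu : ∀ i, (fun r => u r i) =ᵐ[volume.restrict (Ioi 0)] U i)
    (hf : ∀ i, (fun r => f r i) =ᵐ[volume.restrict (Ioi 0)] F i) :
    (u, f) ∈ (radialOp ν l).adjoint.graph := by
  rw [mem_adjoint_graph_iff]
  intro φ
  obtain ⟨a, b, ha, hab, hz⟩ := exists_Icc_of_tsupport_subset φ.2.2.1 φ.2.2.2
  have h0 := (h.fst.conj.mul (testSpace_isPrimitive φ 1)).sub
    (h.snd.conj.mul (testSpace_isPrimitive φ 0))
  have h1 := h0.integral_eq_zero_of_eq_zero ha hab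
    (fun x hx => by simp [(hz x hx).1]) (fun x hx => by simp [(hz x hx).1, (hz x hx).2])
  have hL := (testSpace_memLp φ).coeFn_toLp
  have hD := (testSpace_dExpr_memLp ν l φ).coeFn_toLp
  have i1 := integrable_inner f (testToL2 φ)
  have i2 := integrable_inner u (dToL2 ν l φ)
  rw [← sub_eq_zero, inner_eq_integral, inner_eq_integral, ← integral_sub i1 i2, ← h1]
  refine integral_congr_ae ?_
  filter_upwards [hu 0, hu 1, hf 0, hf 1, hL, hD, ae_restrict_mem measurableSet_Ioi] with
    x u0 u1 f0 f1 hLx hDx hx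
  have e1 : (testToL2 φ : ℝ → EuclideanSpace ℂ (Fin 2)) x = φ.1 x := hLx
  have e2 : (dToL2 ν l φ : ℝ → EuclideanSpace ℂ (Fin 2)) x = dExpr ν l φ.1 x := hDx
  rw [e1, e2, u0, u1, f0, f1]
  simp only [dExpr, map_sub, map_add, map_mul, map_div₀, Complex.conj_ofReal, Complex.ofReal_div,
    PiLp.toLp_apply, Matrix.cons_val_zero, Matrix.cons_val_one]
  ring

/-- The radial operator is symmetric. -/
theorem radialOp_le_adjoint (ν l : ℝ) : radialOp ν l ≤ (radialOp ν l).adjoint := by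
  refine LinearPMap.le_of_le_graph ?_
  rintro ⟨u, f⟩ h
  rw [LinearPMap.mem_graph_iff] at h
  obtain ⟨⟨_, φ, rfl⟩, h1, h2⟩ := h
  have h3 : dToL2 ν l φ = f := (radialOp_apply ν l φ).symm.trans h2
  simp only at h1
  subst h1 h3
  have hp := testSpace_isPrimitive φ
  refine RadialODE.mem_adjoint_graph (U := fun i r => φ.1 r i)
    (F := fun i r => dExpr ν l φ.1 r i) ⟨?_, ?_⟩ ?_ ?_
  · refine (hp 0).congr_ae ?_
    filter_upwards [ae_restrict_mem measurableSet_Ioi] with x hx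
    simp [dExpr]
    ring
  · refine (hp 1).congr_ae ?_
    filter_upwards [ae_restrict_mem measurableSet_Ioi] with x hx
    simp [dExpr]
    ring
  · intro i
    filter_upwards [(testSpace_memLp φ).coeFn_toLp] with x hx
    exact congrArg (fun v : EuclideanSpace ℂ (Fin 2) => v i) hx
  · intro i
    filter_upwards [(testSpace_dExpr_memLp ν l φ).coeFn_toLp] with x hx
    exact congrArg (fun v : EuclideanSpace ℂ (Fin 2) => v i) hx

end RadialDirac

namespace RadialDirac

open MeasureTheory Set Filter Topology
open scoped ContDiff InnerProductSpace ENNReal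

/-! ### `H¹₀` is contained in the domain of the closure -/

theorem norm_dExpr_le (ν l : ℝ) (φ : ℝ → EuclideanSpace ℂ (Fin 2)) (r : ℝ) :
    ‖dExpr ν l φ r‖ ≤ ‖deriv φ r‖ + (|ν| + |l|) * ‖(r⁻¹ : ℝ) • φ r‖ := by
  have e : dExpr ν l φ r = !₂[-deriv φ r 1, deriv φ r 0] +
      ((ν : ℂ) • ((r⁻¹ : ℝ) • φ r) + (l : ℂ) • !₂[-((r⁻¹ : ℝ) • φ r) 1, -((r⁻¹ : ℝ) • φ r) 0]) := by
    ext i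
    fin_cases i <;> simp [dExpr] <;> ring
  have h1 : ‖!₂[-deriv φ r 1, deriv φ r 0]‖ = ‖deriv φ r‖ := by
    simp [EuclideanSpace.norm_eq, Fin.sum_univ_two, add_comm]
  have h2 : ‖!₂[-((r⁻¹ : ℝ) • φ r) 1, -((r⁻¹ : ℝ) • φ r) 0]‖ = ‖(r⁻¹ : ℝ) • φ r‖ := by
    simp only [EuclideanSpace.norm_eq, Fin.sum_univ_two]
    simp [add_comm]
  rw [e]
  calc _ ≤ ‖!₂[-deriv φ r 1, deriv φ r 0]‖ + (‖(ν : ℂ) • ((r⁻¹ : ℝ) • φ r)‖ +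
        ‖(l : ℂ) • !₂[-((r⁻¹ : ℝ) • φ r) 1, -((r⁻¹ : ℝ) • φ r) 0]‖) :=
        (norm_add_le _ _).trans (by gcongr; exact norm_add_le _ _)
    _ = _ := by
        rw [norm_smul (ν : ℂ), norm_smul (l : ℂ), h1, h2, Complex.norm_real, Complex.norm_real,
          Real.norm_eq_abs, Real.norm_eq_abs]
        ring

theorem eLpNorm_two_eq {E : Type*} [NormedAddCommGroup E] (v : ℝ → E) (μ : Measure ℝ) :
    eLpNorm v 2 μ = (∫⁻ x, ‖v x‖ₑ ^ 2 ∂μ) ^ (1 / 2 : ℝ) := by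
  rw [eLpNorm_eq_lintegral_rpow_enorm_toReal (by norm_num) (by norm_num)]
  simp

/-- Hardy's inequality for test functions. -/
theorem eLpNorm_inv_smul_le (φ : testSpace) :
    eLpNorm (fun r : ℝ => (r⁻¹ : ℝ) • φ.1 r) 2 (volume.restrict (Ioi 0)) ≤
      2 * eLpNorm (deriv φ.1) 2 (volume.restrict (Ioi 0)) := by
  have hd : Continuous (deriv φ.1) := φ.2.1.continuous_deriv (by simp)
  have hφ0 : φ.1 0 = 0 := image_eq_zero_of_notMem_tsupport fun h =>
    lt_irrefl (0 : ℝ) (φ.2.2.2 h)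
  have hpt : ∀ r ∈ Ioi (0 : ℝ), ‖(r⁻¹ : ℝ) • φ.1 r‖ₑ ≤
      ∫⁻ ρ in Ioi 0, hardyKernel 0 r ρ * ‖deriv φ.1 ρ‖ₑ := by
    intro r hr
    have hr0 : 0 < r := hr
    have h1 : φ.1 r = ∫ t in Ioc 0 r, deriv φ.1 t := by
      rw [← intervalIntegral.integral_of_le hr0.le, intervalIntegral.integral_deriv_eq_sub
        (fun x _ => testSpace_differentiable φ x) (hd.intervalIntegrable _ _), hφ0, sub_zero]
    calc ‖(r⁻¹ : ℝ) • φ.1 r‖ₑ ≤ ENNReal.ofReal r⁻¹ * ∫⁻ t in Ioc 0 r, ‖deriv φ.1 t‖ₑ := by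
          rw [enorm_smul, Real.enorm_eq_ofReal (by positivity)]
          gcongr
          rw [h1]
          exact enorm_integral_le_lintegral_enorm _
      _ = ∫⁻ t in Ioc 0 r, ENNReal.ofReal r⁻¹ * ‖deriv φ.1 t‖ₑ :=
          (lintegral_const_mul' _ _ ENNReal.ofReal_ne_top).symm
      _ = ∫⁻ t in Ioc 0 r, hardyKernel 0 r t * ‖deriv φ.1 t‖ₑ := by
          refine setLIntegral_congr_fun measurableSet_Ioc fun t ht => ?_
          simp only [hardyKernel, if_pos ht.2]
          congr 2
          rw [neg_zero, Real.rpow_zero, mul_one, zero_sub, Real.rpow_neg_one]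
      _ ≤ _ := lintegral_mono_set Ioc_subset_Ioi_self
  have h2 := lintegral_sq_lintegral_le (μ := volume.restrict (Ioi 0)) (measurable_hardyKernel 0)
    (p := fun r => ENNReal.ofReal (r ^ (-(1 / 2) : ℝ))) (A := 2)
    (by fun_prop) (ae_rpow_ne_zero_and_ne_top (-(1 / 2)))
    (by filter_upwards [ae_restrict_mem measurableSet_Ioi] with r hr
        simpa using lintegral_hardyKernel_left (b := 0) (by norm_num) hr)
    (by filter_upwards [ae_restrict_mem measurableSet_Ioi] with r hr
        simpa using lintegral_hardyKernel_right (b := 0) (by norm_num) hr)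
    (G := fun ρ => ‖deriv φ.1 ρ‖ₑ) hd.aestronglyMeasurable.enorm
  have h3 : ∫⁻ r in Ioi 0, ‖(r⁻¹ : ℝ) • φ.1 r‖ₑ ^ 2 ≤
      2 ^ 2 * ∫⁻ ρ in Ioi 0, ‖deriv φ.1 ρ‖ₑ ^ 2 := by
    refine le_trans (setLIntegral_mono' measurableSet_Ioi fun r hr => ?_) h2
    gcongr
    exact hpt r hr
  rw [eLpNorm_two_eq, eLpNorm_two_eq]
  calc _ ≤ (2 ^ 2 * ∫⁻ ρ in Ioi 0, ‖deriv φ.1 ρ‖ₑ ^ 2) ^ (1 / 2 : ℝ) := by gcongr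
    _ = _ := by
        rw [ENNReal.mul_rpow_of_nonneg _ _ (by norm_num), ← ENNReal.rpow_two, ← ENNReal.rpow_mul]
        norm_num

theorem norm_dToL2_le (ν l : ℝ) (φ : testSpace) :
    ‖dToL2 ν l φ‖ ≤ (1 + (|ν| + |l|) * 2) * ‖derivToL2 φ‖ := by
  have hc : Continuous φ.1 := φ.2.1.continuous
  have hd : Continuous (deriv φ.1) := φ.2.1.continuous_deriv (by simp)
  have e1 : ‖dToL2 ν l φ‖ₑ = eLpNorm (dExpr ν l φ.1) 2 (volume.restrict (Ioi 0)) :=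
    Lp.enorm_toLp (testSpace_dExpr_memLp ν l φ)
  have e2 : ‖derivToL2 φ‖ₑ = eLpNorm (deriv φ.1) 2 (volume.restrict (Ioi 0)) :=
    Lp.enorm_toLp (testSpace_deriv_memLp φ)
  have hk : 0 ≤ |ν| + |l| := by positivity
  have h : ‖dToL2 ν l φ‖ₑ ≤ ENNReal.ofReal (1 + (|ν| + |l|) * 2) * ‖derivToL2 φ‖ₑ := by
    rw [e1, e2]
    calc _ ≤ eLpNorm ((fun r => ‖deriv φ.1 r‖) + (|ν| + |l|) • fun r => ‖(r⁻¹ : ℝ) • φ.1 r‖) 2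
          (volume.restrict (Ioi 0)) := by
          refine eLpNorm_mono_ae_real ?_
          exact Eventually.of_forall (norm_dExpr_le ν l φ.1)
      _ ≤ eLpNorm (fun r => ‖deriv φ.1 r‖) 2 (volume.restrict (Ioi 0)) +
          eLpNorm ((|ν| + |l|) • fun r => ‖(r⁻¹ : ℝ) • φ.1 r‖) 2 (volume.restrict (Ioi 0)) :=
          eLpNorm_add_le hd.norm.aestronglyMeasurable
            ((measurable_inv.smul hc.measurable).norm.aestronglyMeasurable.const_smul _)
            (by norm_num)
      _ = eLpNorm (deriv φ.1) 2 (volume.restrict (Ioi 0)) + ENNReal.ofReal (|ν| + |l|) *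
          eLpNorm (fun r : ℝ => (r⁻¹ : ℝ) • φ.1 r) 2 (volume.restrict (Ioi 0)) := by
          rw [eLpNorm_const_smul, eLpNorm_norm, eLpNorm_norm, Real.enorm_eq_ofReal hk]
      _ ≤ eLpNorm (deriv φ.1) 2 (volume.restrict (Ioi 0)) + ENNReal.ofReal (|ν| + |l|) *
          (2 * eLpNorm (deriv φ.1) 2 (volume.restrict (Ioi 0))) := by
          gcongr
          exact eLpNorm_inv_smul_le φ
      _ = _ := by
          rw [ENNReal.ofReal_add zero_le_one (by positivity), ENNReal.ofReal_mul hk]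
          simp
          ring
  rw [← ofReal_norm, ← ofReal_norm, ← ENNReal.ofReal_mul (by positivity)] at h
  exact (ENNReal.ofReal_le_ofReal_iff (by positivity)).1 h

/-- Hardy's inequality bounds `d φ` by `φ'`, so convergence in the `H¹` norm implies convergence in
the graph norm. -/
theorem exists_mem_closure_graph_of_mem_H10 (ν l : ℝ) {u : L2} (hu : u ∈ H10) :
    ∃ f, (u, f) ∈ (radialOp ν l).graph.topologicalClosure := by
  obtain ⟨⟨u, v⟩, h, rfl⟩ := hu
  obtain ⟨z, hz, hlim⟩ := mem_closure_iff_seq_limit.1 h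
  choose φ hφ using hz
  have h1 : Tendsto (fun n => testToL2 (φ n)) atTop (𝓝 u) := by
    refine ((continuous_fst.tendsto _).comp hlim).congr fun n => ?_
    rw [Function.comp_apply, ← hφ n]
    rfl
  have h2 : Tendsto (fun n => derivToL2 (φ n)) atTop (𝓝 v) := by
    refine ((continuous_snd.tendsto _).comp hlim).congr fun n => ?_
    rw [Function.comp_apply, ← hφ n]
    rfl
  have h3 : CauchySeq fun n => dToL2 ν l (φ n) := by
    have hC : (0 : ℝ) < 1 + (|ν| + |l|) * 2 := by positivity
    rw [Metric.cauchySeq_iff]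
    intro ε hε
    obtain ⟨n₀, hn₀⟩ := Metric.cauchySeq_iff.1 h2.cauchySeq _ (div_pos hε hC)
    refine ⟨n₀, fun m hm n hn => ?_⟩
    have := hn₀ m hm n hn
    rw [dist_eq_norm, ← map_sub] at this ⊢
    calc _ ≤ _ := norm_dToL2_le ν l _
      _ < (1 + (|ν| + |l|) * 2) * (ε / (1 + (|ν| + |l|) * 2)) := by gcongr
      _ = ε := by field_simp
  obtain ⟨f, hf⟩ := cauchySeq_tendsto_of_complete h3
  refine ⟨f, mem_closure_of_tendsto (h1.prodMk_nhds hf) (Eventually.of_forall fun n => ?_)⟩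
  exact LinearPMap.mem_graph_iff _ |>.2
    ⟨⟨testToL2 (φ n), LinearMap.mem_range_self testToL2 (φ n)⟩, rfl, radialOp_apply ν l (φ n)⟩

end RadialDirac

namespace RadialDirac

open Set Filter Topology
open scoped InnerProductSpace

/-! ### Extensions of symmetric operators -/

section Abstract

variable {H : Type*} [NormedAddCommGroup H] [InnerProductSpace ℂ H] {T S : H →ₗ.[ℂ] H}

theorem dense_of_le (hT : Dense (T.domain : Set H)) (h : T ≤ S) : Dense (S.domain : Set H) :=
  hT.mono h.1

theorem graph_functional {u f g : H} (hf : (u, f) ∈ T.graph) (hg : (u, g) ∈ T.graph) : f = g := by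
  obtain ⟨a, rfl, rfl⟩ := (LinearPMap.mem_graph_iff _).1 hf
  obtain ⟨b, hb, rfl⟩ := (LinearPMap.mem_graph_iff _).1 hg
  rw [Subtype.ext hb]

theorem mem_domain_iff_exists_graph {u : H} : u ∈ T.domain ↔ ∃ f, (u, f) ∈ T.graph :=
  LinearPMap.mem_domain_iff

variable [CompleteSpace H]

theorem mem_adjoint_graph (hT : Dense (T.domain : Set H)) {u f : H} :
    (u, f) ∈ T.adjoint.graph ↔ ∀ a b, (a, b) ∈ T.graph → ⟪b, u⟫_ℂ = ⟪a, f⟫_ℂ := by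
  rw [LinearPMap.adjoint_graph_eq_graph_adjoint hT, Submodule.mem_adjoint_iff]
  simp only [sub_eq_zero]

/-- Self-adjointness in terms of the graph. -/
theorem isSelfAdjoint_iff_graph (hT : Dense (T.domain : Set H)) :
    IsSelfAdjoint T ↔
      ∀ u f, (u, f) ∈ T.graph ↔ ∀ a b, (a, b) ∈ T.graph → ⟪b, u⟫_ℂ = ⟪a, f⟫_ℂ := by
  rw [LinearPMap.isSelfAdjoint_def]
  constructor
  · intro h u f
    rw [← mem_adjoint_graph hT, h]
  · intro h
    refine LinearPMap.eq_of_eq_graph ?_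
    ext ⟨u, f⟩
    rw [mem_adjoint_graph hT, h]

/-- The boundary form vanishes when one argument is in the closure of the operator. -/
theorem inner_eq_of_mem_closure_graph (hT : Dense (T.domain : Set H)) {u f v g : H}
    (hu : (u, f) ∈ T.graph.topologicalClosure) (hv : (v, g) ∈ T.adjoint.graph) :
    ⟪f, v⟫_ℂ = ⟪u, g⟫_ℂ := by
  have hcl : IsClosed {z : H × H | ⟪z.2, v⟫_ℂ = ⟪z.1, g⟫_ℂ} :=
    isClosed_eq (by fun_prop) (by fun_prop)
  exact closure_minimal (s := (T.graph : Set (H × H)))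
    (fun z hz => (mem_adjoint_graph hT).1 hv z.1 z.2 hz) hcl hu

theorem closure_graph_le_adjoint_graph (hT : Dense (T.domain : Set H)) (hsymm : T ≤ T.adjoint) :
    T.graph.topologicalClosure ≤ T.adjoint.graph :=
  Submodule.topologicalClosure_minimal _ (LinearPMap.le_graph_of_le hsymm)
    (LinearPMap.adjoint_isClosed hT)

theorem isClosable_of_le_adjoint (hT : Dense (T.domain : Set H)) (hsymm : T ≤ T.adjoint) :
    T.IsClosable :=
  (LinearPMap.adjoint_isClosed hT).isClosable.leIsClosable hsymm

/-- A symmetric operator with vanishing boundary form is essentially self-adjoint. -/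
theorem isSelfAdjoint_closure (hT : Dense (T.domain : Set H)) (hsymm : T ≤ T.adjoint)
    (hB : ∀ u f v g, (u, f) ∈ T.adjoint.graph → (v, g) ∈ T.adjoint.graph → ⟪f, v⟫_ℂ = ⟪u, g⟫_ℂ) :
    T.closure = T.adjoint ∧ IsSelfAdjoint T.closure := by
  have hcl := isClosable_of_le_adjoint hT hsymm
  have heq : T.closure = T.adjoint := by
    refine LinearPMap.eq_of_eq_graph ?_
    rw [← hcl.graph_closure_eq_closure_graph]
    refine le_antisymm (closure_graph_le_adjoint_graph hT hsymm) ?_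
    rintro ⟨u, f⟩ hu
    refine mem_topologicalClosure_of_forall_inner _ _ fun a b hab => ?_
    have h1 : (b, -a) ∈ T.adjoint.graph := by
      rw [mem_adjoint_graph hT]
      intro c d hcd
      have h2 := hab _ hcd
      rw [← inner_conj_symm, ← inner_conj_symm c, inner_neg_left]
      congr 1
      linear_combination h2
    have h3 := hB _ _ _ _ h1 hu
    rw [inner_neg_left] at h3
    simp only
    linear_combination -h3
  refine ⟨heq, ?_⟩
  rw [heq, isSelfAdjoint_iff_graph (dense_of_le hT hsymm)]
  refine fun u f => ⟨fun h a b hab => hB _ _ _ _ hab h, fun h => ?_⟩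
  rw [mem_adjoint_graph hT]
  exact fun a b hab => h a b (LinearPMap.le_graph_of_le hsymm hab)

/-- Boundary data for a symmetric operator `T`: a linear map `e` into the domain of the adjoint
whose range spans that domain modulo a subspace `N` of the domain of the closure, and the
boundary form `Ω` of the adjoint on the range of `e`. -/
structure BoundaryData (T : H →ₗ.[ℂ] H) (N : Submodule ℂ H) {V : Type*} [AddCommGroup V]
    [Module ℂ V] (e : V →ₗ[ℂ] H) (Ω : V → V → ℂ) : Prop where
  dense : Dense (T.domain : Set H)
  symm : T ≤ T.adjoint
  domain_le : T.domain ≤ N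
  le_closure : ∀ u ∈ N, ∃ f, (u, f) ∈ T.graph.topologicalClosure
  mem_adjoint : ∀ w, ∃ f, (e w, f) ∈ T.adjoint.graph
  form : ∀ w z f g, (e w, f) ∈ T.adjoint.graph → (e z, g) ∈ T.adjoint.graph →
    ⟪f, e z⟫_ℂ - ⟪e w, g⟫_ℂ = Ω w z
  decomp : ∀ u f, (u, f) ∈ T.adjoint.graph → ∃ w, u - e w ∈ N

namespace BoundaryData

variable {N : Submodule ℂ H} {V : Type*} [AddCommGroup V] [Module ℂ V] {e : V →ₗ[ℂ] H}
  {Ω : V → V → ℂ}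

theorem mem_adjoint_of_mem (D : BoundaryData T N e Ω) {u : H} (hu : u ∈ N) :
    ∃ f, (u, f) ∈ T.adjoint.graph := by
  obtain ⟨f, hf⟩ := D.le_closure u hu
  exact ⟨f, closure_graph_le_adjoint_graph D.dense D.symm hf⟩

theorem inner_eq_of_mem (D : BoundaryData T N e Ω) {u f v g : H} (hu : u ∈ N)
    (hf : (u, f) ∈ T.adjoint.graph) (hg : (v, g) ∈ T.adjoint.graph) : ⟪f, v⟫_ℂ = ⟪u, g⟫_ℂ := by
  obtain ⟨f', hf'⟩ := D.le_closure u hu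
  have h := closure_graph_le_adjoint_graph D.dense D.symm hf'
  rw [graph_functional hf h]
  exact inner_eq_of_mem_closure_graph D.dense hf' hg

theorem inner_eq_of_mem_right (D : BoundaryData T N e Ω) {u f v g : H} (hu : u ∈ N)
    (hf : (u, f) ∈ T.adjoint.graph) (hg : (v, g) ∈ T.adjoint.graph) : ⟪g, u⟫_ℂ = ⟪v, f⟫_ℂ := by
  rw [← inner_conj_symm, ← inner_conj_symm v, D.inner_eq_of_mem hu hf hg]

/-- The boundary form only depends on the components along `e`. -/
theorem inner_sub_inner (D : BoundaryData T N e Ω) {u f v g : H} {w z : V}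
    (hf : (u, f) ∈ T.adjoint.graph) (hg : (v, g) ∈ T.adjoint.graph) (hu : u - e w ∈ N)
    (hv : v - e z ∈ N) : ⟪f, v⟫_ℂ - ⟪u, g⟫_ℂ = Ω w z := by
  obtain ⟨p, hp⟩ := D.mem_adjoint w
  obtain ⟨q, hq⟩ := D.mem_adjoint z
  have h1 : (u - e w, f - p) ∈ T.adjoint.graph := T.adjoint.graph.sub_mem hf hp
  have h2 : (v - e z, g - q) ∈ T.adjoint.graph := T.adjoint.graph.sub_mem hg hq
  have h3 := D.inner_eq_of_mem hu h1 hg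
  have h4 := D.inner_eq_of_mem_right hv h2 hp
  have h5 := D.form w z p q hp hq
  rw [inner_sub_left, inner_sub_left] at h3
  rw [inner_sub_right, inner_sub_right] at h4
  linear_combination h3 + h4 + h5

theorem not_isSelfAdjoint_closure (D : BoundaryData T N e Ω) (hΩ : ∃ w z, Ω w z ≠ 0) :
    ¬ IsSelfAdjoint T.closure := by
  intro h
  have hcl := isClosable_of_le_adjoint D.dense D.symm
  rw [isSelfAdjoint_iff_graph (dense_of_le D.dense T.le_closure)] at h
  have hg : ∀ u f, (u, f) ∈ T.adjoint.graph → (u, f) ∈ T.closure.graph := fun u f hu => by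
    rw [h]
    intro a b hab
    rw [← hcl.graph_closure_eq_closure_graph] at hab
    exact inner_eq_of_mem_closure_graph D.dense hab hu
  obtain ⟨w, z, hwz⟩ := hΩ
  obtain ⟨p, hp⟩ := D.mem_adjoint w
  obtain ⟨q, hq⟩ := D.mem_adjoint z
  apply hwz
  rw [← D.form w z p q hp hq, sub_eq_zero]
  exact (h _ _).1 (hg _ _ hq) _ _ (hg _ _ hp)

/-- If the isotropic vectors of the boundary form fill a family of lines, each of which is its own
annihilator, then the self-adjoint extensions correspond to these lines. -/
theorem exists_extensions (D : BoundaryData T N e Ω) (hΩ : ∃ w z, Ω w z ≠ 0) {ι : Type*}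
    (ω : ι → V) (h1 : ∀ α, ∀ w ∈ Submodule.span ℂ {ω α}, ∀ z ∈ Submodule.span ℂ {ω α}, Ω w z = 0)
    (h2 : ∀ α z, Ω (ω α) z = 0 → z ∈ Submodule.span ℂ {ω α})
    (h3 : ∀ w, w ≠ 0 → Ω w w = 0 → ∃ α, w ∈ Submodule.span ℂ {ω α})
    (h4 : ∀ α β, ω β ∈ Submodule.span ℂ {ω α} → α = β) :
    ∃ t : ι → (H →ₗ.[ℂ] H),
      (∀ α, T ≤ t α ∧ IsSelfAdjoint (t α) ∧
        (t α).domain = Submodule.span ℂ {e (ω α)} ⊔ N) ∧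
      Function.Injective t ∧
      ∀ S : H →ₗ.[ℂ] H, T ≤ S → IsSelfAdjoint S → ∃ α, S = t α := by
  have hmem : ∀ α u, u ∈ Submodule.span ℂ {e (ω α)} ⊔ N ↔
      ∃ z ∈ Submodule.span ℂ {ω α}, u - e z ∈ N := by
    intro α u
    rw [Submodule.mem_sup]
    constructor
    · rintro ⟨y, hy, n, hn, rfl⟩
      obtain ⟨c, rfl⟩ := Submodule.mem_span_singleton.1 hy
      refine ⟨c • ω α, Submodule.mem_span_singleton.2 ⟨c, rfl⟩, ?_⟩
      rwa [map_smul, add_sub_cancel_left]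
    · rintro ⟨z, hz, hn⟩
      obtain ⟨c, rfl⟩ := Submodule.mem_span_singleton.1 hz
      exact ⟨e (c • ω α), Submodule.mem_span_singleton.2 ⟨c, by rw [map_smul]⟩, _, hn, by abel⟩
  have hle : ∀ α, Submodule.span ℂ {e (ω α)} ⊔ N ≤ T.adjoint.domain := by
    intro α u hu
    obtain ⟨z, -, hn⟩ := (hmem α u).1 hu
    have ha : u - e z ∈ T.adjoint.domain := mem_domain_iff_exists_graph.2 (D.mem_adjoint_of_mem hn)
    have hb : e z ∈ T.adjoint.domain := mem_domain_iff_exists_graph.2 (D.mem_adjoint z)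
    simpa using T.adjoint.domain.add_mem ha hb
  set t : ι → (H →ₗ.[ℂ] H) := fun α =>
    T.adjoint.domRestrict (Submodule.span ℂ {e (ω α)} ⊔ N) with ht
  have hdom : ∀ α, (t α).domain = Submodule.span ℂ {e (ω α)} ⊔ N := fun α =>
    inf_eq_left.2 (hle α)
  have hgraph : ∀ α u f, (u, f) ∈ (t α).graph ↔ (u, f) ∈ T.adjoint.graph ∧
      ∃ z ∈ Submodule.span ℂ {ω α}, u - e z ∈ N := by
    intro α u f
    constructor
    · intro h
      refine ⟨LinearPMap.le_graph_of_le LinearPMap.domRestrict_le h, ?_⟩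
      rw [← hmem, ← hdom]
      exact mem_domain_iff_exists_graph.2 ⟨f, h⟩
    · rintro ⟨h, hz⟩
      rw [← hmem, ← hdom] at hz
      obtain ⟨f', hf'⟩ := mem_domain_iff_exists_graph.1 hz
      rwa [graph_functional h (LinearPMap.le_graph_of_le LinearPMap.domRestrict_le hf')]
  have hTt : ∀ α, T ≤ t α := by
    intro α
    refine LinearPMap.le_of_le_graph ?_
    rintro ⟨u, f⟩ h
    rw [hgraph]
    refine ⟨LinearPMap.le_graph_of_le D.symm h, 0, Submodule.zero_mem _, ?_⟩
    rw [map_zero, sub_zero]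
    exact D.domain_le (mem_domain_iff_exists_graph.2 ⟨f, h⟩)
  have hωt : ∀ α f, (e (ω α), f) ∈ T.adjoint.graph → (e (ω α), f) ∈ (t α).graph := fun α f h =>
    (hgraph α _ _).2 ⟨h, ω α, Submodule.mem_span_singleton_self _, by simp⟩
  have hsa : ∀ α, IsSelfAdjoint (t α) := by
    intro α
    rw [isSelfAdjoint_iff_graph (dense_of_le D.dense (hTt α))]
    intro u f
    constructor
    · rintro hu a b hab
      obtain ⟨hu1, z, hz, hu2⟩ := (hgraph α _ _).1 hu
      obtain ⟨ha1, w, hw, ha2⟩ := (hgraph α _ _).1 hab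
      rw [← sub_eq_zero, D.inner_sub_inner ha1 hu1 ha2 hu2]
      exact h1 α w hw z hz
    · intro h
      have hu : (u, f) ∈ T.adjoint.graph := by
        rw [mem_adjoint_graph D.dense]
        exact fun a b hab => h a b (LinearPMap.le_graph_of_le (hTt α) hab)
      obtain ⟨z, hz⟩ := D.decomp u f hu
      obtain ⟨p, hp⟩ := D.mem_adjoint (ω α)
      refine (hgraph α _ _).2 ⟨hu, z, h2 α z ?_, hz⟩
      rw [← D.inner_sub_inner hp hu (by simp) hz, sub_eq_zero]
      exact h _ _ (hωt α p hp)
  refine ⟨t, fun α => ⟨hTt α, hsa α, hdom α⟩, ?_, ?_⟩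
  · intro α β hαβ
    obtain ⟨p, hp⟩ := D.mem_adjoint (ω α)
    obtain ⟨q, hq⟩ := D.mem_adjoint (ω β)
    refine h4 α β (h2 α _ ?_)
    have h5 := hωt β q hq
    rw [← hαβ] at h5
    rw [← D.form _ _ p q hp hq, sub_eq_zero]
    exact ((isSelfAdjoint_iff_graph (dense_of_le D.dense (hTt α))).1 (hsa α) _ _).1 h5 _ _
      (hωt α p hp)
  · intro S hTS hS
    rw [isSelfAdjoint_iff_graph (dense_of_le D.dense hTS)] at hS
    have hSG : ∀ u f, (u, f) ∈ S.graph → (u, f) ∈ T.adjoint.graph := fun u f hu => by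
      rw [mem_adjoint_graph D.dense]
      exact fun a b hab => (hS u f).1 hu a b (LinearPMap.le_graph_of_le hTS hab)
    have hNS : ∀ u ∈ N, u ∈ S.domain := by
      intro u hu
      obtain ⟨f, hf⟩ := D.mem_adjoint_of_mem hu
      refine mem_domain_iff_exists_graph.2 ⟨f, (hS u f).2 fun a b hab => ?_⟩
      exact D.inner_eq_of_mem_right hu hf (hSG _ _ hab)
    have hS0 : ∀ w z, e w ∈ S.domain → e z ∈ S.domain → Ω w z = 0 := by
      intro w z hw hz
      obtain ⟨p, hp⟩ := mem_domain_iff_exists_graph.1 hw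
      obtain ⟨q, hq⟩ := mem_domain_iff_exists_graph.1 hz
      rw [← D.form w z p q (hSG _ _ hp) (hSG _ _ hq), sub_eq_zero]
      exact (hS _ _).1 hq _ _ hp
    by_cases hex : ∃ w, w ≠ 0 ∧ e w ∈ S.domain
    · obtain ⟨w, hw0, hw⟩ := hex
      obtain ⟨α, hα⟩ := h3 w hw0 (hS0 w w hw hw)
      have hωS : e (ω α) ∈ S.domain := by
        obtain ⟨c, rfl⟩ := Submodule.mem_span_singleton.1 hα
        have hc : c ≠ 0 := fun hc => hw0 (by rw [hc, zero_smul])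
        rw [map_smul] at hw
        simpa [smul_smul, hc] using S.domain.smul_mem c⁻¹ hw
      obtain ⟨p, hp⟩ := mem_domain_iff_exists_graph.1 hωS
      refine ⟨α, LinearPMap.eq_of_eq_graph (le_antisymm ?_ ?_)⟩
      · rintro ⟨u, f⟩ hu
        obtain ⟨z, hz⟩ := D.decomp u f (hSG _ _ hu)
        refine (hgraph α _ _).2 ⟨hSG _ _ hu, z, h2 α z ?_, hz⟩
        rw [← D.inner_sub_inner (hSG _ _ hp) (hSG _ _ hu) (by simp) hz, sub_eq_zero]
        exact (hS _ _).1 hu _ _ hp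
      · rintro ⟨u, f⟩ hu
        obtain ⟨hu1, z, hz, hn⟩ := (hgraph α _ _).1 hu
        obtain ⟨c, rfl⟩ := Submodule.mem_span_singleton.1 hz
        have hud : u ∈ S.domain := by
          have := S.domain.add_mem (hNS _ hn) (S.domain.smul_mem c hωS)
          rwa [map_smul, sub_add_cancel] at this
        obtain ⟨f', hf'⟩ := mem_domain_iff_exists_graph.1 hud
        rwa [graph_functional hu1 (hSG _ _ hf')]
    · -- otherwise `S` would be the restriction to `N`, whose adjoint is everything
      exfalso
      push Not at hex
      have hall : ∀ v g, (v, g) ∈ T.adjoint.graph → v ∈ S.domain := by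
        intro v g hv
        refine mem_domain_iff_exists_graph.2 ⟨g, (hS v g).2 fun a b hab => ?_⟩
        obtain ⟨z, hz⟩ := D.decomp a b (hSG _ _ hab)
        have hez : e z ∈ S.domain := by
          have := S.domain.sub_mem (mem_domain_iff_exists_graph.2 ⟨b, hab⟩) (hNS _ hz)
          rwa [sub_sub_cancel] at this
        have hz0 : z = 0 := by
          by_contra h0
          exact hex z h0 hez
        rw [hz0, map_zero, sub_zero] at hz
        exact D.inner_eq_of_mem hz (hSG _ _ hab) hv
      obtain ⟨w, z, hwz⟩ := hΩ
      obtain ⟨p, hp⟩ := D.mem_adjoint w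
      obtain ⟨q, hq⟩ := D.mem_adjoint z
      exact hwz (hS0 w z (hall _ _ hp) (hall _ _ hq))

end BoundaryData

end Abstract

end RadialDirac

namespace RadialDirac

open MeasureTheory Set Filter Topology
open scoped ContDiff InnerProductSpace ComplexConjugate

/-! ### Cut-off solutions of the homogeneous equation -/

theorem memLp_of_apply {f : ℝ → EuclideanSpace ℂ (Fin 2)} {μ : Measure ℝ}
    (h : ∀ i, MemLp (fun r => f r i) 2 μ) : MemLp f 2 μ := by
  have key : ∀ i, MemLp (fun r => f r i • EuclideanSpace.single i (1 : ℂ)) 2 μ := fun i =>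
    (ContinuousLinearMap.toSpanSingleton ℂ (EuclideanSpace.single i (1 : ℂ))).comp_memLp' (h i)
  refine ((key 0).add (key 1)).ae_eq (Eventually.of_forall fun r => ?_)
  ext i
  fin_cases i <;> simp

/-- An element of `L²((0,+∞); ℂ²)` given by its two components. -/
noncomputable def vecToL2 {U : Fin 2 → ℝ → ℂ} (hU : ∀ i, MemLp (U i) 2 (volume.restrict (Ioi 0))) :
    L2 :=
  (memLp_of_apply (f := fun r => WithLp.toLp 2 fun i => U i r) hU).toLp _

theorem vecToL2_apply {U : Fin 2 → ℝ → ℂ} (hU : ∀ i, MemLp (U i) 2 (volume.restrict (Ioi 0)))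
    (i : Fin 2) : (fun r => vecToL2 hU r i) =ᵐ[volume.restrict (Ioi 0)] U i := by
  filter_upwards [(memLp_of_apply (f := fun r => WithLp.toLp 2 fun i => U i r) hU).coeFn_toLp]
    with r hr
  exact congrArg (fun v : EuclideanSpace ℂ (Fin 2) => v i) hr

theorem L2_ext {u v : L2}
    (h : ∀ i, (fun r => u r i) =ᵐ[volume.restrict (Ioi 0)] fun r => v r i) : u = v := by
  refine Lp.ext ?_
  filter_upwards [h 0, h 1] with r h0 h1
  ext i
  fin_cases i
  · exact h0
  · exact h1

theorem IsPrimitive.hasWeakDeriv {f g : ℝ → ℂ} (h : IsPrimitive f g) : HasWeakDeriv f g := by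
  intro θ hθ
  obtain ⟨a, b, ha, hab, hz⟩ :=
    exists_Icc_of_tsupport_subset hθ.hasCompactSupport hθ.tsupport_subset
  have h1 := (hθ.isPrimitive.mul h).integral_eq_zero_of_eq_zero ha hab
    (fun x hx => by simp [(hz x hx).1]) (fun x hx => by simp [(hz x hx).1, (hz x hx).2])
  rw [integral_add (hθ.deriv.integrableOn_mul
    (h.continuousOn.locallyIntegrableOn measurableSet_Ioi))
    (hθ.integrableOn_mul h.locallyIntegrableOn)] at h1
  exact eq_neg_of_add_eq_zero_left h1

theorem HasWeakDeriv.congr {u v u' v' : ℝ → ℂ} (h : HasWeakDeriv u v)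
    (hu : u =ᵐ[volume.restrict (Ioi 0)] u') (hv : v =ᵐ[volume.restrict (Ioi 0)] v') :
    HasWeakDeriv u' v' := by
  intro θ hθ
  have e1 : ∫ x in Ioi 0, ((deriv θ x : ℝ) : ℂ) * u' x =
      ∫ x in Ioi 0, ((deriv θ x : ℝ) : ℂ) * u x :=
    integral_congr_ae (by filter_upwards [hu] with x hx; rw [hx])
  have e2 : ∫ x in Ioi 0, (θ x : ℂ) * v' x = ∫ x in Ioi 0, (θ x : ℂ) * v x :=
    integral_congr_ae (by filter_upwards [hv] with x hx; rw [hx])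
  rw [e1, e2, h θ hθ]

theorem IsPrimitive.ae_eq_zero {f g : ℝ → ℂ} (h : IsPrimitive f g)
    (hf : f =ᵐ[volume.restrict (Ioi 0)] 0) : g =ᵐ[volume.restrict (Ioi 0)] 0 := by
  rw [EventuallyEq, ae_restrict_iff' measurableSet_Ioi]
  refine isOpen_Ioi.ae_eq_zero_of_integral_contDiff_smul_eq_zero h.locallyIntegrableOn
    fun θ h1 h2 h3 => ?_
  have h4 := (h.hasWeakDeriv.congr hf EventuallyEq.rfl) θ ⟨h1, h2, h3⟩
  simp only [Pi.zero_apply, mul_zero, integral_zero] at h4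
  rw [← setIntegral_eq_integral_of_forall_compl_eq_zero (s := Ioi 0)]
  · exact (neg_eq_zero.1 h4.symm)
  · exact fun x hx => by rw [image_eq_zero_of_notMem_tsupport fun h => hx (h3 h), zero_smul]

theorem memLp_div_Ioi {Y : ℝ → ℂ} (hY : MemLp Y 2 (volume.restrict (Ioi 0)))
    (h : MemLp (fun r : ℝ => Y r / r) 2 (volume.restrict (Ioc 0 1))) :
    MemLp (fun r : ℝ => Y r / r) 2 (volume.restrict (Ioi 0)) := by
  have hm : AEStronglyMeasurable (fun r : ℝ => Y r / r) (volume.restrict (Ioi 0)) := by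
    simp_rw [div_eq_mul_inv]
    exact hY.1.mul (Complex.measurable_ofReal.inv).aestronglyMeasurable
  have h1 : MemLp (fun r : ℝ => Y r / r) 2 (volume.restrict (Ioi 1)) := by
    have hle : volume.restrict (Ioi (1 : ℝ)) ≤ volume.restrict (Ioi 0) :=
      Measure.restrict_mono (Ioi_subset_Ioi zero_le_one) le_rfl
    refine (hY.mono_measure hle).mono (hm.mono_measure hle) ?_
    filter_upwards [ae_restrict_mem measurableSet_Ioi] with r hr
    have hr1 : (1 : ℝ) < r := hr
    rw [norm_div, Complex.norm_real, Real.norm_of_nonneg (by linarith)]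
    exact div_le_self (norm_nonneg _) hr1.le
  refine memLp_two_of_lintegral hm ?_
  rw [← Ioc_union_Ioi_eq_Ioi zero_le_one, lintegral_union measurableSet_Ioi
    (Ioc_disjoint_Ioi le_rfl)]
  exact ENNReal.add_lt_top.2
    ⟨lintegral_lt_top_of_memLp_two h, lintegral_lt_top_of_memLp_two h1⟩

/-- A multiple of a function that is square-integrable near zero by a continuous function
vanishing for `r > 2` is square-integrable. -/
theorem memLp_cutoff_mul {κ : ℝ → ℝ} (hκ : Continuous κ) (h0 : ∀ r > 2, κ r = 0) {p : ℝ → ℂ}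
    (hp : MemLp p 2 (volume.restrict (Ioc 0 2))) :
    MemLp (fun r => (κ r : ℂ) * p r) 2 (volume.restrict (Ioi 0)) := by
  obtain ⟨C, hC⟩ := (isCompact_Icc (a := (0 : ℝ)) (b := 2)).exists_bound_of_continuousOn
    hκ.continuousOn
  have h1 : MemLp (fun r => (κ r : ℂ) * p r) 2 (volume.restrict (Ioc 0 2)) := by
    refine hp.of_le_mul (c := C)
      ((Complex.continuous_ofReal.comp hκ).aestronglyMeasurable.mul hp.1) ?_
    filter_upwards [ae_restrict_mem measurableSet_Ioc] with r hr
    rw [norm_mul, Complex.norm_real]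
    gcongr
    exact hC r ⟨hr.1.le, hr.2⟩
  have h2 : MemLp ((Ioc 0 2).indicator fun r => (κ r : ℂ) * p r) 2 (volume.restrict (Ioi 0)) := by
    rw [memLp_indicator_iff_restrict measurableSet_Ioc, Measure.restrict_restrict measurableSet_Ioc,
      inter_eq_left.2 Ioc_subset_Ioi_self]
    exact h1
  refine h2.ae_eq ?_
  filter_upwards [ae_restrict_mem measurableSet_Ioi] with r hr
  by_cases h : r ≤ 2
  · rw [indicator_of_mem (show r ∈ Ioc 0 2 from ⟨hr, h⟩)]
  · rw [indicator_of_notMem (fun h' => h h'.2), h0 r (not_le.1 h)]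
    simp

/-- `ψ` solves the homogeneous equation `r ψ' = Q ψ` on `(0,+∞)` and is square-integrable near
zero. -/
structure IsHomSolution (ν l : ℝ) (ψ : Fin 2 → ℝ → ℂ) : Prop where
  fst : ∀ x : ℝ, 0 < x → HasDerivAt (ψ 0) ((l * ψ 0 x - ν * ψ 1 x) / x) x
  snd : ∀ x : ℝ, 0 < x → HasDerivAt (ψ 1) ((ν * ψ 0 x - l * ψ 1 x) / x) x
  memLp : ∀ i, MemLp (ψ i) 2 (volume.restrict (Ioc 0 2))

namespace IsCutoff

variable {χ : ℝ → ℝ}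

theorem deriv_eq_zero_of_lt (hχ : IsCutoff χ) {r : ℝ} (h0 : 0 < r) (h1 : r < 1) :
    deriv χ r = 0 := by
  have h : χ =ᶠ[𝓝 r] fun _ => 1 := by
    filter_upwards [Ioo_mem_nhds h0 h1] with x hx
    exact hχ.eq_one x hx.1 hx.2.le
  rw [h.deriv_eq, deriv_const]

theorem deriv_eq_zero_of_gt (hχ : IsCutoff χ) {r : ℝ} (h2 : 2 < r) : deriv χ r = 0 := by
  have h : χ =ᶠ[𝓝 r] fun _ => 0 := by
    filter_upwards [Ioi_mem_nhds h2] with x hx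
    exact hχ.eq_zero x (le_of_lt hx)
  rw [h.deriv_eq, deriv_const]

theorem continuous_deriv (hχ : IsCutoff χ) : Continuous (deriv χ) :=
  hχ.smooth.continuous_deriv (by simp)

theorem hasDerivAt (hχ : IsCutoff χ) (r : ℝ) :
    HasDerivAt (fun r => (χ r : ℂ)) ((deriv χ r : ℝ) : ℂ) r :=
  (hχ.smooth.differentiable (by simp) r).hasDerivAt.ofReal_comp

theorem isPrimitive (hχ : IsCutoff χ) :
    IsPrimitive (fun r => (χ r : ℂ)) (fun r => ((deriv χ r : ℝ) : ℂ)) :=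
  IsPrimitive.of_hasDerivAt (fun r _ => hχ.hasDerivAt r)
    (Complex.continuous_ofReal.comp hχ.continuous_deriv).continuousOn

/-- `∫ (χ²)' = -1`. -/
theorem integral_deriv_sq (hχ : IsCutoff χ) :
    ∫ r in Ioi 0, 2 * ((χ r : ℂ) * ((deriv χ r : ℝ) : ℂ)) = -1 := by
  have hp := hχ.isPrimitive.mul hχ.isPrimitive
  have hs : Ioc (1 / 2 : ℝ) 3 ⊆ Ioi 0 := fun x hx => lt_trans (by norm_num) hx.1
  rw [setIntegral_eq_of_subset_of_forall_sdiff_eq_zero measurableSet_Ioi hs]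
  · rw [← intervalIntegral.integral_of_le (by norm_num)]
    have h1 := hp.integral_eq (x := 1 / 2) (y := 3) (by norm_num) (by norm_num)
    rw [hχ.eq_zero 3 (by norm_num), hχ.eq_one (1 / 2) (by norm_num) (by norm_num)] at h1
    simp only [Complex.ofReal_zero, Complex.ofReal_one, mul_zero, mul_one, zero_sub] at h1
    rw [← h1]
    congr 1
    funext r
    ring
  · intro r hr
    have h0 : 0 < r := hr.1
    rcases le_or_gt r (1 / 2) with h | h
    · rw [hχ.deriv_eq_zero_of_lt h0 (by linarith)]
      simp
    · have h3 : 3 < r := by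
        by_contra h'
        exact hr.2 ⟨h, not_lt.1 h'⟩
      rw [hχ.deriv_eq_zero_of_gt (by linarith)]
      simp

end IsCutoff

namespace IsHomSolution

variable {ν l : ℝ} {ψ φ : Fin 2 → ℝ → ℂ} {χ : ℝ → ℝ}

theorem continuousOn (h : IsHomSolution ν l ψ) (i : Fin 2) : ContinuousOn (ψ i) (Ioi 0) := by
  intro x hx
  fin_cases i
  · exact (h.fst x hx).continuousAt.continuousWithinAt
  · exact (h.snd x hx).continuousAt.continuousWithinAt

theorem isPrimitive_fst (h : IsHomSolution ν l ψ) :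
    IsPrimitive (ψ 0) fun x => (l * ψ 0 x - ν * ψ 1 x) / x :=
  IsPrimitive.of_hasDerivAt h.fst
    (((continuousOn_const.mul (h.continuousOn 0)).sub
      (continuousOn_const.mul (h.continuousOn 1))).div Complex.continuous_ofReal.continuousOn
      fun x hx => by exact_mod_cast (ne_of_gt hx))

theorem isPrimitive_snd (h : IsHomSolution ν l ψ) :
    IsPrimitive (ψ 1) fun x => (ν * ψ 0 x - l * ψ 1 x) / x :=
  IsPrimitive.of_hasDerivAt h.snd
    (((continuousOn_const.mul (h.continuousOn 0)).sub
      (continuousOn_const.mul (h.continuousOn 1))).div Complex.continuous_ofReal.continuousOn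
      fun x hx => by exact_mod_cast (ne_of_gt hx))

theorem linearComb (h : IsHomSolution ν l ψ) (h' : IsHomSolution ν l φ) (a b : ℂ) :
    IsHomSolution ν l fun i r => a * ψ i r + b * φ i r where
  fst x hx := by
    convert! ((h.fst x hx).const_mul a).add ((h'.fst x hx).const_mul b) using 1
    ring
  snd x hx := by
    convert! ((h.snd x hx).const_mul a).add ((h'.snd x hx).const_mul b) using 1
    ring
  memLp i := ((h.memLp i).const_mul a).add ((h'.memLp i).const_mul b)

theorem radialODE_cutoff (h : IsHomSolution ν l ψ) (hχ : IsCutoff χ) :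
    RadialODE ν l (fun i r => (χ r : ℂ) * ψ i r)
      ![fun r => -(((deriv χ r : ℝ) : ℂ) * ψ 1 r), fun r => ((deriv χ r : ℝ) : ℂ) * ψ 0 r] where
  fst := by
    refine (hχ.isPrimitive.mul h.isPrimitive_fst).congr_ae (Eventually.of_forall fun r => ?_)
    simp only [Matrix.cons_val_one, Matrix.cons_val_fin_one]
    ring
  snd := by
    refine (hχ.isPrimitive.mul h.isPrimitive_snd).congr_ae (Eventually.of_forall fun r => ?_)
    simp only [Matrix.cons_val_zero]
    ring

theorem memLp_cutoff (h : IsHomSolution ν l ψ) (hχ : IsCutoff χ) (i : Fin 2) :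
    MemLp (fun r => (χ r : ℂ) * ψ i r) 2 (volume.restrict (Ioi 0)) :=
  memLp_cutoff_mul hχ.smooth.continuous (fun r hr => hχ.eq_zero r (le_of_lt hr)) (h.memLp i)

theorem memLp_deriv_cutoff (h : IsHomSolution ν l ψ) (hχ : IsCutoff χ) (i : Fin 2) :
    MemLp ((![fun r => -(((deriv χ r : ℝ) : ℂ) * ψ 1 r),
      fun r => ((deriv χ r : ℝ) : ℂ) * ψ 0 r] : Fin 2 → ℝ → ℂ) i) 2 (volume.restrict (Ioi 0)) := by
  have key := fun i => memLp_cutoff_mul hχ.continuous_deriv (fun r hr => hχ.deriv_eq_zero_of_gt hr)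
    (h.memLp i)
  fin_cases i
  · exact (key 1).neg
  · exact key 0

/-- The function `χ ψ` lies in the domain of the adjoint. -/
theorem mem_adjoint_graph (h : IsHomSolution ν l ψ) (hχ : IsCutoff χ) :
    (vecToL2 (h.memLp_cutoff hχ), vecToL2 (h.memLp_deriv_cutoff hχ)) ∈
      (radialOp ν l).adjoint.graph :=
  (h.radialODE_cutoff hχ).mem_adjoint_graph (vecToL2_apply _) (vecToL2_apply _)

/-- The sesquilinear Wronskian of two solutions is constant, because `Q` is real and traceless. -/
theorem conj_wronskian_eq (h : IsHomSolution ν l ψ) (h' : IsHomSolution ν l φ) {r : ℝ} (hr : 0 < r) :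
    conj (ψ 0 r) * φ 1 r - conj (ψ 1 r) * φ 0 r =
      conj (ψ 0 1) * φ 1 1 - conj (ψ 1 1) * φ 0 1 := by
  have hp := (h.isPrimitive_fst.conj.mul h'.isPrimitive_snd).sub
    (h.isPrimitive_snd.conj.mul h'.isPrimitive_fst)
  have h0 := hp.integral_eq one_pos hr
  rw [intervalIntegral.integral_congr (g := fun _ => 0), intervalIntegral.integral_zero] at h0
  · exact (sub_eq_zero.1 h0.symm)
  · intro x _
    simp only [map_div₀, map_sub, map_mul, Complex.conj_ofReal]
    ring

/-- The bilinear Wronskian of two solutions is constant. -/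
theorem wronskian_eq (h : IsHomSolution ν l ψ) (h' : IsHomSolution ν l φ) {r : ℝ} (hr : 0 < r) :
    ψ 0 r * φ 1 r - ψ 1 r * φ 0 r = ψ 0 1 * φ 1 1 - ψ 1 1 * φ 0 1 := by
  have hp := (h.isPrimitive_fst.mul h'.isPrimitive_snd).sub
    (h.isPrimitive_snd.mul h'.isPrimitive_fst)
  have h0 := hp.integral_eq one_pos hr
  rw [intervalIntegral.integral_congr (g := fun _ => 0), intervalIntegral.integral_zero] at h0
  · exact (sub_eq_zero.1 h0.symm)
  · intro x _
    simp only
    ring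

/-- The boundary form of two cut-off solutions is a Wronskian. -/
theorem inner_sub_inner_cutoff (h : IsHomSolution ν l ψ) (h' : IsHomSolution ν l φ)
    (hχ : IsCutoff χ) :
    ⟪vecToL2 (h.memLp_deriv_cutoff hχ), vecToL2 (h'.memLp_cutoff hχ)⟫_ℂ -
      ⟪vecToL2 (h.memLp_cutoff hχ), vecToL2 (h'.memLp_deriv_cutoff hχ)⟫_ℂ =
      conj (ψ 1 1) * φ 0 1 - conj (ψ 0 1) * φ 1 1 := by
  rw [inner_eq_integral, inner_eq_integral, ← integral_sub (integrable_inner _ _)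
    (integrable_inner _ _)]
  calc _ = ∫ r in Ioi 0, (conj (ψ 0 1) * φ 1 1 - conj (ψ 1 1) * φ 0 1) *
        (2 * ((χ r : ℂ) * ((deriv χ r : ℝ) : ℂ))) := by
        refine integral_congr_ae ?_
        filter_upwards [ae_restrict_mem measurableSet_Ioi,
          vecToL2_apply (h.memLp_deriv_cutoff hχ) 0, vecToL2_apply (h.memLp_deriv_cutoff hχ) 1,
          vecToL2_apply (h'.memLp_deriv_cutoff hχ) 0, vecToL2_apply (h'.memLp_deriv_cutoff hχ) 1,
          vecToL2_apply (h.memLp_cutoff hχ) 0, vecToL2_apply (h.memLp_cutoff hχ) 1,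
          vecToL2_apply (h'.memLp_cutoff hχ) 0, vecToL2_apply (h'.memLp_cutoff hχ) 1]
          with r hr e1 e2 e3 e4 e5 e6 e7 e8
        rw [e1, e2, e3, e4, e5, e6, e7, e8, ← h.conj_wronskian_eq h' hr]
        simp only [Matrix.cons_val_zero, Matrix.cons_val_one, map_neg, map_mul, Complex.conj_ofReal]
        ring
    _ = _ := by
        rw [integral_const_mul, hχ.integral_deriv_sq]
        ring

/-- The Wronskian of a solution of the inhomogeneous equation with one of the homogeneous
equation. -/
theorem isPrimitive_wronskian (h : IsHomSolution ν l ψ) {U F : Fin 2 → ℝ → ℂ}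
    (hU : RadialODE ν l U F) :
    IsPrimitive (fun r => U 0 r * ψ 1 r - U 1 r * ψ 0 r)
      (fun r => F 0 r * ψ 0 r + F 1 r * ψ 1 r) := by
  refine ((hU.fst.mul h.isPrimitive_snd).sub (hU.snd.mul h.isPrimitive_fst)).congr_ae
    (Eventually.of_forall fun r => ?_)
  simp only
  ring

end IsHomSolution

theorem RadialODE.sub {ν l : ℝ} {U F V G : Fin 2 → ℝ → ℂ} (h : RadialODE ν l U F)
    (h' : RadialODE ν l V G) :
    RadialODE ν l (fun i r => U i r - V i r) (fun i r => F i r - G i r) where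
  fst := (h.fst.sub h'.fst).congr_ae (Eventually.of_forall fun r => by simp only; ring)
  snd := (h.snd.sub h'.snd).congr_ae (Eventually.of_forall fun r => by simp only; ring)

/-- Functions with square-integrable derivative for which `u / r` is square-integrable near zero
lie in `H¹₀`. -/
theorem mem_H10_of_memLp_div {U V : Fin 2 → ℝ → ℂ}
    (h : ∀ i, IsPrimitive (U i) (V i)) (hV : ∀ i, MemLp (V i) 2 (volume.restrict (Ioi 0))) {u : L2}
    (hu : ∀ i, (fun r => u r i) =ᵐ[volume.restrict (Ioi 0)] U i)
    (hdiv : ∀ i, MemLp (fun r => U i r / r) 2 (volume.restrict (Ioc 0 1))) : u ∈ H10 := by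
  refine ⟨(u, vecToL2 hV), mem_closure_of_hasWeakDeriv (fun i => ?_) (fun i => ?_), rfl⟩
  · exact (h i).hasWeakDeriv.congr (hu i).symm (vecToL2_apply hV i).symm
  · refine (hdiv i).ae_eq ?_
    filter_upwards [ae_mono (Measure.restrict_mono Ioc_subset_Ioi_self le_rfl) (hu i)] with r hr
    rw [hr]

theorem RadialODE.mem_H10 {ν l : ℝ} {U F : Fin 2 → ℝ → ℂ} (h : RadialODE ν l U F)
    (hF : ∀ i, MemLp (F i) 2 (volume.restrict (Ioi 0))) {u : L2}
    (hu : ∀ i, (fun r => u r i) =ᵐ[volume.restrict (Ioi 0)] U i)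
    (hdiv : ∀ i, MemLp (fun r => U i r / r) 2 (volume.restrict (Ioc 0 1))) : u ∈ H10 := by
  have hU : ∀ i, MemLp (U i) 2 (volume.restrict (Ioi 0)) := fun i => (memLp_apply u i).ae_eq (hu i)
  have hd := fun i => memLp_div_Ioi (hU i) (hdiv i)
  refine mem_H10_of_memLp_div (U := U) (V := ![fun r => (l * U 0 r - ν * U 1 r) / r + F 1 r,
    fun r => (ν * U 0 r - l * U 1 r) / r - F 0 r]) (fun i => ?_) (fun i => ?_) hu hdiv
  · fin_cases i
    · exact h.fst
    · exact h.snd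
  · fin_cases i
    · refine ((((hd 0).const_mul (l : ℂ)).sub ((hd 1).const_mul (ν : ℂ))).add (hF 1)).ae_eq
        (Eventually.of_forall fun r => ?_)
      simp only [Pi.add_apply, Pi.sub_apply, Fin.zero_eta, Matrix.cons_val_zero]
      ring
    · refine ((((hd 0).const_mul (ν : ℂ)).sub ((hd 1).const_mul (l : ℂ))).sub (hF 0)).ae_eq
        (Eventually.of_forall fun r => ?_)
      simp only [Pi.sub_apply, Fin.mk_one, Matrix.cons_val_one, Matrix.cons_val_fin_one]
      ring

/-! ### Boundary data of the radial operator -/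

/-- A basis `ψ 0`, `ψ 1` of solutions of the homogeneous equation, square-integrable near zero,
such that solutions of the inhomogeneous equation whose Wronskians with the basis vanish at zero
are square-integrable near zero after division by `r`. -/
structure IsRegularBasis (ν l : ℝ) (ψ : Fin 2 → Fin 2 → ℝ → ℂ) : Prop where
  sol : ∀ j, IsHomSolution ν l (ψ j)
  wronskian_ne : ψ 0 0 1 * ψ 1 1 1 - ψ 0 1 1 * ψ 1 0 1 ≠ 0
  memLp_div : ∀ U F : Fin 2 → ℝ → ℂ, RadialODE ν l U F →
    (∀ i, MemLp (U i) 2 (volume.restrict (Ioi 0))) →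
    (∀ i, MemLp (F i) 2 (volume.restrict (Ioi 0))) →
    (∀ j, Tendsto (fun r => U 0 r * ψ j 1 r - U 1 r * ψ j 0 r) (𝓝[>] 0) (𝓝 0)) →
    ∀ i, MemLp (fun r => U i r / r) 2 (volume.restrict (Ioc 0 1))

namespace IsRegularBasis

variable {ν l : ℝ} {ψ : Fin 2 → Fin 2 → ℝ → ℂ} {χ : ℝ → ℝ}

theorem sol_comb (h : IsRegularBasis ν l ψ) (w : Fin 2 → ℂ) :
    IsHomSolution ν l fun i r => w 0 * ψ 0 i r + w 1 * ψ 1 i r :=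
  (h.sol 0).linearComb (h.sol 1) (w 0) (w 1)

/-- The map `w ↦ χ (w₀ ψ₀ + w₁ ψ₁)`. -/
noncomputable def boundaryMap (h : IsRegularBasis ν l ψ) (hχ : IsCutoff χ) :
    (Fin 2 → ℂ) →ₗ[ℂ] L2 :=
  Fintype.linearCombination ℂ fun j => vecToL2 ((h.sol j).memLp_cutoff hχ)

theorem boundaryMap_apply (h : IsRegularBasis ν l ψ) (hχ : IsCutoff χ) (w : Fin 2 → ℂ) :
    h.boundaryMap hχ w = vecToL2 ((h.sol_comb w).memLp_cutoff hχ) := by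
  rw [boundaryMap, Fintype.linearCombination_apply, Fin.sum_univ_two]
  refine L2_ext fun i => ?_
  filter_upwards [vecToL2_apply ((h.sol_comb w).memLp_cutoff hχ) i,
    vecToL2_apply ((h.sol 0).memLp_cutoff hχ) i, vecToL2_apply ((h.sol 1).memLp_cutoff hχ) i,
    Lp.coeFn_add (w 0 • vecToL2 ((h.sol 0).memLp_cutoff hχ))
      (w 1 • vecToL2 ((h.sol 1).memLp_cutoff hχ)),
    Lp.coeFn_smul (w 0) (vecToL2 ((h.sol 0).memLp_cutoff hχ)),
    Lp.coeFn_smul (w 1) (vecToL2 ((h.sol 1).memLp_cutoff hχ))] with r e1 e2 e3 e4 e5 e6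
  rw [e1, e4, Pi.add_apply, e5, e6]
  simp only [Pi.smul_apply, PiLp.add_apply, PiLp.smul_apply, smul_eq_mul]
  rw [e2, e3]
  ring

/-- The boundary form in the coordinates of the basis: the sesquilinear Wronskian of the solutions
with coordinates `w` and `z`, up to sign. It is constant on `(0,+∞)`, and evaluated at `1`. -/
noncomputable def boundaryForm (ψ : Fin 2 → Fin 2 → ℝ → ℂ) (w z : Fin 2 → ℂ) : ℂ :=
  conj (w 0 * ψ 0 1 1 + w 1 * ψ 1 1 1) * (z 0 * ψ 0 0 1 + z 1 * ψ 1 0 1) -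
    conj (w 0 * ψ 0 0 1 + w 1 * ψ 1 0 1) * (z 0 * ψ 0 1 1 + z 1 * ψ 1 1 1)

theorem exists_sub_mem_H10 (h : IsRegularBasis ν l ψ) (hχ : IsCutoff χ) {u f : L2}
    (hu : (u, f) ∈ (radialOp ν l).adjoint.graph) : ∃ w, u - h.boundaryMap hχ w ∈ H10 := by
  obtain ⟨U, hU, hUu⟩ := exists_radialODE hu
  have hUL : ∀ i, MemLp (U i) 2 (volume.restrict (Ioi 0)) := fun i =>
    (memLp_apply u i).ae_eq (hUu i)
  -- the Wronskians with the basis have limits at zero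
  have hlim : ∀ j, ∃ L, Tendsto (fun r => U 0 r * ψ j 1 r - U 1 r * ψ j 0 r) (𝓝[>] 0) (𝓝 L) := by
    intro j
    refine ⟨_, ((h.sol j).isPrimitive_wronskian hU).tendsto_nhdsGT_zero ?_⟩
    have hψ : ∀ i, MemLp (ψ j i) 2 (volume.restrict (Ioc 0 1)) := fun i =>
      ((h.sol j).memLp i).mono_measure
        (Measure.restrict_mono (Ioc_subset_Ioc_right one_le_two) le_rfl)
    exact ((MemLp.mono_Ioc (memLp_apply f 0) 1).integrable_mul (hψ 0)).add
      ((MemLp.mono_Ioc (memLp_apply f 1) 1).integrable_mul (hψ 1))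
  choose L hL using hlim
  set κ : ℂ := ψ 0 0 1 * ψ 1 1 1 - ψ 0 1 1 * ψ 1 0 1 with hκ
  have hκ0 : κ ≠ 0 := h.wronskian_ne
  set w : Fin 2 → ℂ := ![L 1 / κ, -(L 0 / κ)] with hw
  refine ⟨w, ?_⟩
  have hode := hU.sub ((h.sol_comb w).radialODE_cutoff hχ)
  have hFL : ∀ i, MemLp (fun r => f r i - (![fun r => -(((deriv χ r : ℝ) : ℂ) *
      (w 0 * ψ 0 1 r + w 1 * ψ 1 1 r)), fun r => ((deriv χ r : ℝ) : ℂ) *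
      (w 0 * ψ 0 0 r + w 1 * ψ 1 0 r)] : Fin 2 → ℝ → ℂ) i r) 2 (volume.restrict (Ioi 0)) := fun i =>
    (memLp_apply f i).sub ((h.sol_comb w).memLp_deriv_cutoff hχ i)
  refine hode.mem_H10 hFL (fun i => ?_) (h.memLp_div _ _ hode
    (fun i => (hUL i).sub ((h.sol_comb w).memLp_cutoff hχ i)) hFL fun j => ?_)
  · rw [boundaryMap_apply]
    filter_upwards [hUu i, vecToL2_apply ((h.sol_comb w).memLp_cutoff hχ) i,
      Lp.coeFn_sub u (vecToL2 ((h.sol_comb w).memLp_cutoff hχ))] with r e1 e2 e3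
    rw [e3, Pi.sub_apply, PiLp.sub_apply, e1, e2]
  · have h0 := (hL j).sub_const (L j)
    rw [sub_self] at h0
    refine h0.congr' ?_
    filter_upwards [Ioo_mem_nhdsGT one_pos] with r hr
    rw [hχ.eq_one r hr.1 hr.2.le]
    have hwr := (h.sol 0).wronskian_eq (h.sol 1) hr.1
    rw [← hκ] at hwr
    have hj : L j = (w 0 * ψ 0 0 r + w 1 * ψ 1 0 r) * ψ j 1 r -
        (w 0 * ψ 0 1 r + w 1 * ψ 1 1 r) * ψ j 0 r := by
      fin_cases j
      · simp only [hw, Fin.zero_eta, Matrix.cons_val_zero, Matrix.cons_val_one]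
        field_simp
        linear_combination -L 0 * hwr
      · simp only [hw, Fin.mk_one, Matrix.cons_val_zero, Matrix.cons_val_one]
        field_simp
        linear_combination -L 1 * hwr
    rw [hj]
    push_cast
    ring

theorem boundaryData (h : IsRegularBasis ν l ψ) (hχ : IsCutoff χ) :
    BoundaryData (radialOp ν l) H10 (h.boundaryMap hχ) (boundaryForm ψ) where
  dense := radialOp_dense ν l
  symm := radialOp_le_adjoint ν l
  domain_le := by
    rintro _ ⟨φ, rfl⟩
    exact ⟨(testToL2 φ, derivToL2 φ), Submodule.le_topologicalClosure _ ⟨φ, rfl⟩, rfl⟩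
  le_closure u hu := exists_mem_closure_graph_of_mem_H10 ν l hu
  mem_adjoint w := by
    rw [boundaryMap_apply]
    exact ⟨_, (h.sol_comb w).mem_adjoint_graph hχ⟩
  form w z f g hf hg := by
    rw [boundaryMap_apply] at hf hg ⊢
    rw [boundaryMap_apply]
    rw [graph_functional hf ((h.sol_comb w).mem_adjoint_graph hχ),
      graph_functional hg ((h.sol_comb z).mem_adjoint_graph hχ),
      (h.sol_comb w).inner_sub_inner_cutoff (h.sol_comb z) hχ]
    rfl
  decomp u f hu := h.exists_sub_mem_H10 hχ hu

end IsRegularBasis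

end RadialDirac

namespace RadialDirac

open MeasureTheory Set Filter Topology
open scoped ComplexConjugate

/-! ### Explicit solution bases -/

theorem isHomSolution_cpow {ν l : ℝ} {p : Fin 2 → ℂ} {q : ℂ} (h0 : l * p 0 - ν * p 1 = q * p 0)
    (h1 : ν * p 0 - l * p 1 = q * p 1) (hq : -(1 / 2) < q.re) :
    IsHomSolution ν l fun i r => p i * (r : ℂ) ^ q where
  fst x hx := by
    convert! (hasDerivAt_cpow (c := q) hx).const_mul (p 0) using 1
    linear_combination (x : ℂ) ^ q / x * h0
  snd x hx := by
    convert! (hasDerivAt_cpow (c := q) hx).const_mul (p 1) using 1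
    linear_combination (x : ℂ) ^ q / x * h1
  memLp i := ((memLp_cpow_iff two_pos).2 hq).const_mul _

/-- The Wronskian with an eigenvector of `Q` solves a scalar equation. -/
theorem RadialODE.isPrimitive_eigenvector {ν l : ℝ} {U F : Fin 2 → ℝ → ℂ} (h : RadialODE ν l U F)
    {p : Fin 2 → ℂ} {q : ℂ} (h0 : l * p 0 - ν * p 1 = q * p 0)
    (h1 : ν * p 0 - l * p 1 = q * p 1) :
    IsPrimitive (fun r => U 0 r * p 1 - U 1 r * p 0)
      (fun r => -q * (U 0 r * p 1 - U 1 r * p 0) / r + (F 0 r * p 0 + F 1 r * p 1)) := by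
  have h2 := ((h.fst.const_mul (p 1)).sub (h.snd.const_mul (p 0))).congr_ae
    (g' := fun r => -q * (U 0 r * p 1 - U 1 r * p 0) / r + (F 0 r * p 0 + F 1 r * p 1))
    (Eventually.of_forall fun r => by
      simp only
      linear_combination -(U 0 r / r) * h1 + (U 1 r / r) * h0)
  convert! h2 using 2
  ring

theorem memLp_div_of_memLp_wronskian {U : Fin 2 → ℝ → ℂ} {p : Fin 2 → Fin 2 → ℂ}
    (hdet : p 0 0 * p 1 1 - p 0 1 * p 1 0 ≠ 0)
    (h : ∀ j, MemLp (fun r : ℝ => (U 0 r * p j 1 - U 1 r * p j 0) / r) 2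
      (volume.restrict (Ioc 0 1))) (i : Fin 2) :
    MemLp (fun r : ℝ => U i r / r) 2 (volume.restrict (Ioc 0 1)) := by
  set D := p 0 0 * p 1 1 - p 0 1 * p 1 0
  refine ((((h 1).const_mul (p 0 i)).sub ((h 0).const_mul (p 1 i))).const_mul D⁻¹).ae_eq
    (Eventually.of_forall fun r => ?_)
  simp only [Pi.sub_apply]
  rw [inv_mul_eq_iff_eq_mul₀ hdet]
  fin_cases i
  · simp only [Fin.zero_eta, D]
    ring
  · simp only [Fin.mk_one, D]
    ring

/-- If `Q` has a basis of eigenvectors for exponents in the strip `|Re q| < 1/2`, each Wronskian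
divided by the power `r^q` falls under the Hardy inequality with exponent `-q`. -/
theorem isRegularBasis_cpow {ν l : ℝ} {p : Fin 2 → Fin 2 → ℂ} {q : Fin 2 → ℂ}
    (h0 : ∀ j, l * p j 0 - ν * p j 1 = q j * p j 0)
    (h1 : ∀ j, ν * p j 0 - l * p j 1 = q j * p j 1)
    (hq : ∀ j, |(q j).re| < 1 / 2) (hdet : p 0 0 * p 1 1 - p 0 1 * p 1 0 ≠ 0) :
    IsRegularBasis ν l fun j i r => p j i * (r : ℂ) ^ (q j) where
  sol j := isHomSolution_cpow (h0 j) (h1 j) (abs_lt.1 (hq j)).1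
  wronskian_ne := by simpa using hdet
  memLp_div U F hU hUL hFL hlim := by
    refine memLp_div_of_memLp_wronskian hdet fun j => ?_
    refine memLp_div_of_tendsto (a := -q j) (by
      have := (abs_lt.1 (hq j)).1
      rw [Complex.neg_re]
      linarith) (hU.isPrimitive_eigenvector (h0 j) (h1 j))
      (((hFL 0).mul_const (p j 0)).add ((hFL 1).mul_const (p j 1))) ?_
    refine (hlim j).congr fun r => ?_
    rw [neg_neg]
    ring

theorem memLp_log : MemLp (fun r : ℝ => (Real.log r : ℂ)) 2 (volume.restrict (Ioc 0 2)) := by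
  have h := (memLp_cpow_iff (c := ((-(1 / 4) : ℝ) : ℂ)) two_pos).2 (by
    rw [Complex.ofReal_re]; norm_num)
  refine h.of_le_mul (c := 4)
    (Complex.measurable_ofReal.comp Real.measurable_log).aestronglyMeasurable ?_
  filter_upwards [ae_restrict_mem measurableSet_Ioc] with r hr
  have hr0 : 0 < r := hr.1
  rw [Complex.norm_cpow_eq_rpow_re_of_pos hr0, Complex.norm_real, Complex.ofReal_re,
    Real.norm_eq_abs, Real.rpow_neg hr0.le, ← div_eq_mul_inv, le_div_iff₀ (by positivity)]
  rcases le_total r 1 with h1 | h1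
  · have h2 := Real.abs_log_mul_self_rpow_lt r (1 / 4) hr0 h1 (by norm_num)
    rw [abs_mul, abs_of_pos (Real.rpow_pos_of_pos hr0 _)] at h2
    linarith
  · rw [abs_of_nonneg (Real.log_nonneg h1)]
    have h2 : Real.log r ≤ 1 := by linarith [Real.log_le_sub_one_of_pos hr0, hr.2]
    have h3 : r ^ (1 / 4 : ℝ) ≤ r ^ (1 : ℝ) := Real.rpow_le_rpow_of_exponent_le h1 (by norm_num)
    rw [Real.rpow_one] at h3
    have h4 : 0 < r ^ (1 / 4 : ℝ) := by positivity
    nlinarith [hr.2, Real.log_nonneg h1]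

/-- A primitive of a square-integrable function that vanishes at zero is `o(1 / log r)`. -/
theorem tendsto_log_mul {Y g : ℝ → ℂ} (h : IsPrimitive Y g)
    (hg : MemLp g 2 (volume.restrict (Ioi 0)))
    (hY : MemLp (fun r : ℝ => Y r / r) 2 (volume.restrict (Ioi 0))) :
    Tendsto (fun r : ℝ => (Real.log r : ℂ) * Y r) (𝓝[>] 0) (𝓝 0) := by
  -- view `Y` as a solution with exponent `1/4`
  have h1 : IsPrimitive Y fun r => (1 / 4 : ℂ) * Y r / r + (g r - (1 / 4 : ℂ) * (Y r / r)) :=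
    h.congr_ae (Eventually.of_forall fun r => by simp only; ring)
  have hre : (1 / 4 : ℂ).re < 1 / 2 := by
    rw [show (1 / 4 : ℂ) = ((1 / 4 : ℝ) : ℂ) by push_cast; ring, Complex.ofReal_re]
    norm_num
  have h2 := h1.cpow_mul.tendsto_nhdsGT_zero
    (integrableOn_cpow_mul one_pos hre (hg.sub (hY.const_mul _)))
  have h3 : Tendsto (fun r : ℝ => ((Real.log r * r ^ (1 / 4 : ℝ) : ℝ) : ℂ)) (𝓝[>] 0) (𝓝 0) := by
    have := (Complex.continuous_ofReal.tendsto 0).comp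
      (tendsto_log_mul_rpow_nhdsGT_zero (r := 1 / 4) (by norm_num))
    rw [Complex.ofReal_zero] at this
    exact this
  have h4 := h3.mul h2
  rw [zero_mul] at h4
  refine h4.congr' ?_
  filter_upwards [self_mem_nhdsWithin] with r hr
  have hr0 : 0 < r := hr
  have h5 := cpow_mul_cpow_neg (a := (1 / 4 : ℂ)) hr0 (Y r)
  rw [Complex.ofReal_mul, Complex.ofReal_cpow hr0.le]
  push_cast
  linear_combination (Real.log r : ℂ) * h5

/-- For `δ = 0` the columns of `1 + Q log r` form a regular basis: the Wronskian with the kernel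
vector of `Q` is controlled first, and enters the equations of the components as a source. -/
theorem isRegularBasis_log {ν l : ℝ} (hl : 0 < l) (h : l ^ 2 - ν ^ 2 = 0) :
    IsRegularBasis ν l ![![fun r => 1 + l * (Real.log r : ℂ), fun r => ν * (Real.log r : ℂ)],
      ![fun r => -ν * (Real.log r : ℂ), fun r => 1 - l * (Real.log r : ℂ)]] := by
  have hlc : (l : ℂ) ≠ 0 := by exact_mod_cast hl.ne'
  have hc : (l : ℂ) ^ 2 - (ν : ℂ) ^ 2 = 0 := by exact_mod_cast h
  have hlog : ∀ x : ℝ, 0 < x → HasDerivAt (fun r : ℝ => (Real.log r : ℂ)) ((x⁻¹ : ℝ) : ℂ) x :=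
    fun x hx => (Real.hasDerivAt_log hx.ne').ofReal_comp
  have h1L : ∀ c : ℂ, MemLp (fun _ : ℝ => c) 2 (volume.restrict (Ioc 0 2)) := fun c =>
    memLp_const c
  refine ⟨fun j => ?_, by simp, fun U F hU hUL hFL hlim => ?_⟩
  · fin_cases j
    · refine ⟨fun x hx => ?_, fun x hx => ?_, fun i => ?_⟩
      · convert! ((hlog x hx).const_mul (l : ℂ)).const_add 1 using 1
        simp only [Fin.zero_eta, Matrix.cons_val_zero, Matrix.cons_val_one, Matrix.cons_val_fin_one]
        push_cast
        linear_combination (Real.log x : ℂ) / x * hc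
      · convert! (hlog x hx).const_mul (ν : ℂ) using 1
        simp only [Fin.zero_eta, Matrix.cons_val_zero, Matrix.cons_val_one, Matrix.cons_val_fin_one]
        push_cast
        ring
      · fin_cases i
        · exact (h1L 1).add (memLp_log.const_mul _)
        · exact memLp_log.const_mul _
    · refine ⟨fun x hx => ?_, fun x hx => ?_, fun i => ?_⟩
      · convert! (hlog x hx).const_mul (-ν : ℂ) using 1
        simp only [Fin.mk_one, Matrix.cons_val_zero, Matrix.cons_val_one, Matrix.cons_val_fin_one]
        push_cast
        ring
      · convert! ((hlog x hx).const_mul (l : ℂ)).const_sub 1 using 1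
        simp only [Fin.mk_one, Matrix.cons_val_zero, Matrix.cons_val_one, Matrix.cons_val_fin_one]
        push_cast
        linear_combination (Real.log x : ℂ) / x * hc
      · fin_cases i
        · exact memLp_log.const_mul _
        · exact (h1L 1).sub (memLp_log.const_mul _)
  · have hl0 := hlim 0
    have hl1 := hlim 1
    simp only [Matrix.cons_val_zero, Matrix.cons_val_one, Matrix.cons_val_fin_one] at hl0 hl1
    -- the component of `U` transversal to the kernel of `Q`
    have hp := hU.isPrimitive_eigenvector (p := ![(l : ℂ), (ν : ℂ)]) (q := 0)
      (by simp only [Matrix.cons_val_zero, Matrix.cons_val_one, Matrix.cons_val_fin_one]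
          linear_combination hc)
      (by simp only [Matrix.cons_val_zero, Matrix.cons_val_one, Matrix.cons_val_fin_one]; ring)
    simp only [Matrix.cons_val_zero, Matrix.cons_val_one, Matrix.cons_val_fin_one] at hp
    have hGL : MemLp (fun r => F 0 r * l + F 1 r * ν) 2 (volume.restrict (Ioi 0)) :=
      ((hFL 0).mul_const _).add ((hFL 1).mul_const _)
    have hYL : MemLp (fun r => U 0 r * ν - U 1 r * l) 2 (volume.restrict (Ioi 0)) :=
      ((hUL 0).mul_const _).sub ((hUL 1).mul_const _)
    have hY1 := memLp_div_of_tendsto (a := -0) (by simp) hp hGL (by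
      have h2 := (hl0.const_mul (l : ℂ)).add (hl1.const_mul (ν : ℂ))
      simp only [mul_zero, add_zero] at h2
      refine h2.congr fun r => ?_
      rw [neg_neg, Complex.cpow_zero, one_mul]
      linear_combination (U 1 r * (-Real.log r)) * hc)
    have hYd := memLp_div_Ioi hYL hY1
    have hlogY := tendsto_log_mul (hp.congr_ae (g' := fun r => F 0 r * l + F 1 r * ν)
      (Eventually.of_forall fun r => by simp)) hGL hYd
    intro i
    fin_cases i
    · refine memLp_div_of_tendsto (a := 0) (Y := U 0)
        (g := fun r => ν / l * ((U 0 r * ν - U 1 r * l) / r) + F 1 r) (by simp) ?_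
        ((hYd.const_mul _).add (hFL 1)) ?_
      · refine hU.fst.congr_ae (Eventually.of_forall fun r => ?_)
        have hll : (l : ℂ) * (l : ℂ)⁻¹ = 1 := mul_inv_cancel₀ hlc
        simp only
        linear_combination (U 0 r / r * (l : ℂ)⁻¹) * hc + (U 1 r / r * ν - U 0 r / r * l) * hll
      · have h2 := hl1.add (hlogY.const_mul (ν / l : ℂ))
        simp only [mul_zero, add_zero] at h2
        refine h2.congr fun r => ?_
        rw [neg_zero, Complex.cpow_zero, one_mul]
        field_simp
        linear_combination -(Real.log r * U 0 r) * hc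
    · refine memLp_div_of_tendsto (a := 0) (Y := U 1)
        (g := fun r => (U 0 r * ν - U 1 r * l) / r - F 0 r) (by simp) ?_
        (hYd.sub (hFL 0)) ?_
      · refine hU.snd.congr_ae (Eventually.of_forall fun r => ?_)
        simp only
        ring
      · have h2 := hlogY.sub hl0
        simp only [sub_zero] at h2
        refine h2.congr fun r => ?_
        rw [neg_zero, Complex.cpow_zero, one_mul]
        ring

/-! ### Isotropic lines of the boundary form -/

/-- The lines spanned by the real unit vectors are the isotropic lines of the form
`w̄₀ z₁ - w̄₁ z₀`, and `[0,π)` parametrizes them. -/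
theorem isotropic_lines_real {κ : ℂ} (hκ : κ ≠ 0) {Ω : (Fin 2 → ℂ) → (Fin 2 → ℂ) → ℂ}
    (hΩ : ∀ w z, Ω w z = κ * (conj (w 0) * z 1 - conj (w 1) * z 0)) {ω : ℝ → Fin 2 → ℂ}
    (hω : ∀ α, ω α = ![(Real.cos α : ℂ), (Real.sin α : ℂ)]) :
    (∃ w z, Ω w z ≠ 0) ∧
    (∀ α, ∀ w ∈ Submodule.span ℂ {ω α}, ∀ z ∈ Submodule.span ℂ {ω α}, Ω w z = 0) ∧
    (∀ α z, Ω (ω α) z = 0 → z ∈ Submodule.span ℂ {ω α}) ∧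
    (∀ w, w ≠ 0 → Ω w w = 0 → ∃ α ∈ Ico 0 Real.pi, w ∈ Submodule.span ℂ {ω α}) ∧
    (∀ α ∈ Ico 0 Real.pi, ∀ β ∈ Ico 0 Real.pi, ω β ∈ Submodule.span ℂ {ω α} → α = β) := by
  have h1 : ∀ α, ∀ w ∈ Submodule.span ℂ {ω α}, ∀ z ∈ Submodule.span ℂ {ω α}, Ω w z = 0 := by
    intro α w hw z hz
    obtain ⟨a, rfl⟩ := Submodule.mem_span_singleton.1 hw
    obtain ⟨b, rfl⟩ := Submodule.mem_span_singleton.1 hz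
    rw [hΩ, hω]
    simp only [Pi.smul_apply, smul_eq_mul, Matrix.cons_val_zero, Matrix.cons_val_one,
      Matrix.cons_val_fin_one, map_mul, Complex.conj_ofReal]
    ring
  refine ⟨⟨![1, 0], ![0, 1], by simpa [hΩ] using hκ⟩, h1, ?_, ?_, ?_⟩
  · intro α z h
    rw [hΩ, hω, mul_eq_zero, or_iff_right hκ] at h
    simp only [Matrix.cons_val_zero, Matrix.cons_val_one, Matrix.cons_val_fin_one,
      Complex.conj_ofReal] at h
    have hcs : (Real.cos α : ℂ) ^ 2 + (Real.sin α : ℂ) ^ 2 = 1 := by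
      exact_mod_cast Real.cos_sq_add_sin_sq α
    refine Submodule.mem_span_singleton.2 ⟨z 0 * Real.cos α + z 1 * Real.sin α, ?_⟩
    rw [hω]
    ext i
    fin_cases i
    · simp only [Fin.zero_eta, Pi.smul_apply, smul_eq_mul, Matrix.cons_val_zero]
      linear_combination z 0 * hcs + (Real.sin α : ℂ) * h
    · simp only [Fin.mk_one, Pi.smul_apply, smul_eq_mul, Matrix.cons_val_one,
        Matrix.cons_val_fin_one]
      linear_combination z 1 * hcs - (Real.cos α : ℂ) * h
  · intro w hw h
    rw [hΩ, mul_eq_zero, or_iff_right hκ] at h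
    by_cases h0 : w 0 = 0
    · refine ⟨Real.pi / 2, ⟨by positivity, half_lt_self Real.pi_pos⟩,
        Submodule.mem_span_singleton.2 ⟨w 1, ?_⟩⟩
      rw [hω]
      ext i
      fin_cases i <;> simp [h0]
    · -- the ratio of the components is real
      have hc0 : conj (w 0) ≠ 0 := (map_ne_zero _).2 h0
      have hreal : conj (w 1 / w 0) = w 1 / w 0 := by
        rw [map_div₀, div_eq_div_iff hc0 h0]
        linear_combination -h
      obtain ⟨t, ht⟩ := Complex.conj_eq_iff_real.1 hreal
      have hw1 : w 1 = w 0 * t := by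
        rw [← ht]
        field_simp
      have hsq : (0 : ℝ) < √(1 + t ^ 2) := Real.sqrt_pos.2 (by positivity)
      have hsqc : ((√(1 + t ^ 2) : ℝ) : ℂ) ≠ 0 := by exact_mod_cast hsq.ne'
      have hb := Real.arctan_lt_pi_div_two t
      have hb' := Real.neg_pi_div_two_lt_arctan t
      rcases le_or_gt 0 (Real.arctan t) with hs | hs
      · refine ⟨Real.arctan t, ⟨hs, by linarith [Real.pi_pos]⟩,
          Submodule.mem_span_singleton.2 ⟨w 0 * √(1 + t ^ 2), ?_⟩⟩
        rw [hω, Real.cos_arctan, Real.sin_arctan]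
        ext i
        fin_cases i
        · simp only [Fin.zero_eta, Pi.smul_apply, smul_eq_mul, Matrix.cons_val_zero,
            Complex.ofReal_div, Complex.ofReal_one]
          field_simp
        · simp only [Fin.mk_one, Pi.smul_apply, smul_eq_mul, Matrix.cons_val_one,
            Matrix.cons_val_fin_one, Complex.ofReal_div, hw1]
          field_simp
      · refine ⟨Real.arctan t + Real.pi, ⟨by linarith [Real.pi_pos], by linarith⟩,
          Submodule.mem_span_singleton.2 ⟨-(w 0 * √(1 + t ^ 2)), ?_⟩⟩
        rw [hω, Real.cos_add_pi, Real.sin_add_pi, Real.cos_arctan, Real.sin_arctan]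
        ext i
        fin_cases i
        · simp only [Fin.zero_eta, Pi.smul_apply, smul_eq_mul, Matrix.cons_val_zero,
            Complex.ofReal_div, Complex.ofReal_one, Complex.ofReal_neg]
          field_simp
        · simp only [Fin.mk_one, Pi.smul_apply, smul_eq_mul, Matrix.cons_val_one,
            Matrix.cons_val_fin_one, Complex.ofReal_div, Complex.ofReal_neg, hw1]
          field_simp
  · intro α hα β hβ h
    have h2 := h1 α _ (Submodule.mem_span_singleton_self _) _ h
    rw [hΩ, hω, hω, mul_eq_zero, or_iff_right hκ] at h2
    simp only [Matrix.cons_val_zero, Matrix.cons_val_one, Matrix.cons_val_fin_one,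
      Complex.conj_ofReal] at h2
    have h3 : Real.sin (β - α) = 0 := by
      rw [Real.sin_sub]
      have : Real.cos α * Real.sin β - Real.sin α * Real.cos β = 0 := by exact_mod_cast h2
      linarith
    have h4 := (Real.sin_eq_zero_iff_of_lt_of_lt (by linarith [hα.2, hβ.1])
      (by linarith [hα.1, hβ.2])).1 h3
    linarith

/-- The isotropic vectors of the form `w̄₀ z₀ - w̄₁ z₁` are those with `|w₀| = |w₁|`. They fill
lines determined by the ratio `w₀ / w₁ = e^{2iα}`, so that `[0,π)` parametrizes them. -/
theorem isotropic_lines_exp {κ : ℂ} (hκ : κ ≠ 0) {Ω : (Fin 2 → ℂ) → (Fin 2 → ℂ) → ℂ}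
    (hΩ : ∀ w z, Ω w z = κ * (conj (w 0) * z 0 - conj (w 1) * z 1)) {ω : ℝ → Fin 2 → ℂ}
    (hω : ∀ α : ℝ, ω α = ![Complex.exp (Complex.I * α), Complex.exp (-(Complex.I * α))]) :
    (∃ w z, Ω w z ≠ 0) ∧
    (∀ α, ∀ w ∈ Submodule.span ℂ {ω α}, ∀ z ∈ Submodule.span ℂ {ω α}, Ω w z = 0) ∧
    (∀ α z, Ω (ω α) z = 0 → z ∈ Submodule.span ℂ {ω α}) ∧
    (∀ w, w ≠ 0 → Ω w w = 0 → ∃ α ∈ Ico 0 Real.pi, w ∈ Submodule.span ℂ {ω α}) ∧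
    (∀ α ∈ Ico 0 Real.pi, ∀ β ∈ Ico 0 Real.pi, ω β ∈ Submodule.span ℂ {ω α} → α = β) := by
  have hc1 : ∀ α : ℝ, conj (Complex.exp (Complex.I * α)) = Complex.exp (-(Complex.I * α)) :=
    fun α => by rw [← Complex.exp_conj]; simp
  have hc2 : ∀ α : ℝ, conj (Complex.exp (-(Complex.I * α))) = Complex.exp (Complex.I * α) :=
    fun α => by rw [← Complex.exp_conj]; simp
  have hee : ∀ α : ℝ, Complex.exp (Complex.I * α) * Complex.exp (-(Complex.I * α)) = 1 :=
    fun α => by rw [← Complex.exp_add]; simp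
  have h1 : ∀ α, ∀ w ∈ Submodule.span ℂ {ω α}, ∀ z ∈ Submodule.span ℂ {ω α}, Ω w z = 0 := by
    intro α w hw z hz
    obtain ⟨a, rfl⟩ := Submodule.mem_span_singleton.1 hw
    obtain ⟨b, rfl⟩ := Submodule.mem_span_singleton.1 hz
    rw [hΩ, hω]
    simp only [Pi.smul_apply, smul_eq_mul, Matrix.cons_val_zero, Matrix.cons_val_one,
      Matrix.cons_val_fin_one, map_mul, hc1, hc2]
    ring
  have h2' : ∀ (α : ℝ) (z : Fin 2 → ℂ), Complex.exp (-(Complex.I * α)) * z 0 =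
      Complex.exp (Complex.I * α) * z 1 → z ∈ Submodule.span ℂ {ω α} := by
    intro α z h
    refine Submodule.mem_span_singleton.2 ⟨Complex.exp (-(Complex.I * α)) * z 0, ?_⟩
    rw [hω]
    ext i
    fin_cases i
    · simp only [Fin.zero_eta, Pi.smul_apply, smul_eq_mul, Matrix.cons_val_zero]
      linear_combination z 0 * hee α
    · simp only [Fin.mk_one, Pi.smul_apply, smul_eq_mul, Matrix.cons_val_one,
        Matrix.cons_val_fin_one]
      linear_combination z 1 * hee α + Complex.exp (-(Complex.I * α)) * h
  refine ⟨⟨![1, 0], ![1, 0], by simpa [hΩ] using hκ⟩, h1, ?_, ?_, ?_⟩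
  · intro α z h
    rw [hΩ, hω, mul_eq_zero, or_iff_right hκ] at h
    simp only [Matrix.cons_val_zero, Matrix.cons_val_one, Matrix.cons_val_fin_one, hc1, hc2] at h
    exact h2' α z (sub_eq_zero.1 h)
  · intro w hw h
    rw [hΩ, mul_eq_zero, or_iff_right hκ, sub_eq_zero, ← Complex.normSq_eq_conj_mul_self,
      ← Complex.normSq_eq_conj_mul_self] at h
    have hn : Complex.normSq (w 0) = Complex.normSq (w 1) := by exact_mod_cast h
    have hw1 : w 1 ≠ 0 := by
      intro h1
      apply hw
      rw [h1, map_zero, Complex.normSq_eq_zero] at hn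
      ext i
      fin_cases i
      · exact hn
      · exact h1
    have hz : ‖w 0 / w 1‖ = 1 := by
      rw [norm_div, div_eq_one_iff_eq (norm_ne_zero_iff.2 hw1)]
      have h3 : ‖w 0‖ ^ 2 = ‖w 1‖ ^ 2 := by rw [← Complex.normSq_eq_norm_sq, hn,
        Complex.normSq_eq_norm_sq]
      exact (sq_eq_sq₀ (norm_nonneg _) (norm_nonneg _)).1 h3
    have harg : Complex.exp (Complex.I * Complex.arg (w 0 / w 1)) * w 1 = w 0 := by
      have := Complex.norm_mul_exp_arg_mul_I (w 0 / w 1)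
      rw [hz, Complex.ofReal_one, one_mul, mul_comm _ Complex.I] at this
      rw [this]
      field_simp
    set a := Complex.arg (w 0 / w 1) with ha
    -- any `α` with `exp (2 i α) = w 0 / w 1` will do
    have key : ∀ α : ℝ, Complex.exp (Complex.I * α) * Complex.exp (Complex.I * α) =
        Complex.exp (Complex.I * a) → w ∈ Submodule.span ℂ {ω α} := by
      intro α hα
      refine h2' α w ?_
      rw [← harg, ← hα]
      linear_combination (Complex.exp (Complex.I * α) * w 1) * hee α
    have hb := Complex.neg_pi_lt_arg (w 0 / w 1)
    have hb' := Complex.arg_le_pi (w 0 / w 1)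
    rcases le_or_gt 0 a with hs | hs
    · refine ⟨a / 2, ⟨by linarith, by linarith [Real.pi_pos]⟩, key _ ?_⟩
      rw [← Complex.exp_add]
      congr 1
      push_cast
      ring
    · refine ⟨a / 2 + Real.pi, ⟨by linarith, by linarith⟩, key _ ?_⟩
      rw [← Complex.exp_add, ← Complex.exp_periodic.sub_eq]
      congr 1
      push_cast
      ring
  · intro α hα β hβ h
    have h2 := h1 α _ (Submodule.mem_span_singleton_self _) _ h
    rw [hΩ, hω, hω, mul_eq_zero, or_iff_right hκ] at h2
    simp only [Matrix.cons_val_zero, Matrix.cons_val_one, Matrix.cons_val_fin_one,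
      hc1, hc2, ← Complex.exp_add] at h2
    have h3 : Real.sin (β - α) = 0 := by
      have h5 : Complex.sin ((β - α : ℝ) : ℂ) = 0 := by
        rw [Complex.sin]
        rw [show -((β - α : ℝ) : ℂ) * Complex.I = Complex.I * α + -(Complex.I * β) by push_cast; ring,
          show ((β - α : ℝ) : ℂ) * Complex.I = -(Complex.I * α) + Complex.I * β by push_cast; ring]
        linear_combination -(Complex.I / 2) * h2
      exact_mod_cast h5
    have h4 := (Real.sin_eq_zero_iff_of_lt_of_lt (by linarith [hα.2, hβ.1])
      (by linarith [hα.1, hβ.2])).1 h3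
    linarith

end RadialDirac

namespace RadialDirac

open MeasureTheory Set Filter Topology
open scoped ComplexConjugate InnerProductSpace

/-! ### The limit-circle cases -/

/-- Given a regular basis, the self-adjoint extensions are parametrized by the isotropic lines of
the boundary form. -/
theorem IsRegularBasis.hasExtensionFamily {ν l : ℝ} {ψ : Fin 2 → Fin 2 → ℝ → ℂ} {χ : ℝ → ℝ}
    (h : IsRegularBasis ν l ψ) (hχ : IsCutoff χ) {ω : ℝ → Fin 2 → ℂ}
    {u : ℝ → ℝ → EuclideanSpace ℂ (Fin 2)}
    (hu : ∀ α r, 0 < r → ∀ i, u α r i = (χ r : ℂ) * (ω α 0 * ψ 0 i r + ω α 1 * ψ 1 i r))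
    (hΩ : (∃ w z, boundaryForm ψ w z ≠ 0) ∧
      (∀ α, ∀ w ∈ Submodule.span ℂ {ω α}, ∀ z ∈ Submodule.span ℂ {ω α}, boundaryForm ψ w z = 0) ∧
      (∀ α z, boundaryForm ψ (ω α) z = 0 → z ∈ Submodule.span ℂ {ω α}) ∧
      (∀ w, w ≠ 0 → boundaryForm ψ w w = 0 → ∃ α ∈ Ico 0 Real.pi, w ∈ Submodule.span ℂ {ω α}) ∧
      (∀ α ∈ Ico 0 Real.pi, ∀ β ∈ Ico 0 Real.pi, ω β ∈ Submodule.span ℂ {ω α} → α = β)) :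
    ¬ IsEssentiallySelfAdjoint (radialOp ν l) ∧ HasExtensionFamily (radialOp ν l) u := by
  obtain ⟨h0, h1, h2, h3, h4⟩ := hΩ
  have D := h.boundaryData hχ
  refine ⟨fun hs => D.not_isSelfAdjoint_closure h0 hs.2, ?_⟩
  have hL : ∀ α, MemLp (u α) 2 (volume.restrict (Ioi 0)) := fun α =>
    memLp_of_apply fun i => ((h.sol_comb (ω α)).memLp_cutoff hχ i).ae_eq (by
      filter_upwards [ae_restrict_mem measurableSet_Ioi] with r hr
      rw [hu α r hr])
  refine ⟨fun α _ => hL α, ?_⟩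
  have he : ∀ α, (hL α).toLp (u α) = h.boundaryMap hχ (ω α) := by
    intro α
    rw [h.boundaryMap_apply]
    refine L2_ext fun i => ?_
    filter_upwards [ae_restrict_mem measurableSet_Ioi, (hL α).coeFn_toLp,
      vecToL2_apply ((h.sol_comb (ω α)).memLp_cutoff hχ) i] with r hr e1 e2
    rw [e1, e2, hu α r hr]
  simp only [he]
  exact D.exists_extensions h0 (fun α : Ico 0 Real.pi => ω α) (fun α => h1 α) (fun α => h2 α)
    (fun w hw hww => by
      obtain ⟨α, hα, hwα⟩ := h3 w hw hww
      exact ⟨⟨α, hα⟩, hwα⟩)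
    (fun α β hαβ => Subtype.ext (h4 α α.2 β β.2 hαβ))

theorem isUnit_matP {ν l : ℝ} (hl : 0 < l) (h : 0 < l ^ 2 - ν ^ 2) : IsUnit (matP ν l) := by
  have hs : 0 < √(l ^ 2 - ν ^ 2) := Real.sqrt_pos.2 h
  have hs2 : √(l ^ 2 - ν ^ 2) ^ 2 = l ^ 2 - ν ^ 2 := Real.sq_sqrt h.le
  rw [Matrix.isUnit_iff_isUnit_det, isUnit_iff_ne_zero, matP]
  generalize √(l ^ 2 - ν ^ 2) = s at hs hs2
  have h1 : -l - s ≠ 0 := by linarith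
  rw [Matrix.det_smul, Fintype.card_fin, Matrix.det_fin_two_of]
  refine mul_ne_zero (by positivity) ?_
  have h2 : (-l - s) * (l + s) - ν * -ν = -(2 * s * (l + s)) := by linear_combination hs2
  rw [h2]
  exact neg_ne_zero.2 (by positivity)

/-- The case `0 < δ < 1/4`. -/
theorem hasExtensionFamily_uSub {ν l : ℝ} {χ : ℝ → ℝ} (hχ : IsCutoff χ) (hl : 0 < l)
    (h : 0 < l ^ 2 - ν ^ 2) (h' : l ^ 2 - ν ^ 2 < 1 / 4) :
    ¬ IsEssentiallySelfAdjoint (radialOp ν l) ∧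
      HasExtensionFamily (radialOp ν l) (uSub χ ν l) := by
  have hs : 0 < √(l ^ 2 - ν ^ 2) := Real.sqrt_pos.2 h
  have hs2 : √(l ^ 2 - ν ^ 2) ^ 2 = l ^ 2 - ν ^ 2 := Real.sq_sqrt h.le
  have hdet : (matP ν l).det ≠ 0 :=
    ((Matrix.isUnit_iff_isUnit_det _).1 (isUnit_matP hl h)).ne_zero
  rw [Matrix.det_fin_two] at hdet
  have hdet' : ((matP ν l 0 0 : ℝ) : ℂ) * (matP ν l 1 1 : ℝ) -
      ((matP ν l 1 0 : ℝ) : ℂ) * (matP ν l 0 1 : ℝ) ≠ 0 := by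
    rw [mul_comm ((matP ν l 1 0 : ℝ) : ℂ)]
    exact_mod_cast hdet
  have hs4 : √(l ^ 2 - ν ^ 2) < 1 / 2 := by
    rw [Real.sqrt_lt' (by norm_num)]
    linarith
  have hu : ∀ α r i, uSub χ ν l α r i = ((χ r *
      (matP ν l i 0 * (Real.cos α * r ^ √(l ^ 2 - ν ^ 2)) +
        matP ν l i 1 * (Real.sin α * r ^ (-√(l ^ 2 - ν ^ 2)))) : ℝ) : ℂ) := by
    intro α r i
    simp only [uSub, Matrix.mulVec, dotProduct, Fin.sum_univ_two, Matrix.cons_val_zero,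
      Matrix.cons_val_one, Matrix.cons_val_fin_one]
  have hP : ∀ c : ℝ, c = 1 / (2 * √(l ^ 2 - ν ^ 2) * (-l - √(l ^ 2 - ν ^ 2))) →
      matP ν l 0 0 = c * (-l - √(l ^ 2 - ν ^ 2)) ∧ matP ν l 0 1 = c * ν ∧
      matP ν l 1 0 = c * -ν ∧ matP ν l 1 1 = c * (l + √(l ^ 2 - ν ^ 2)) := by
    rintro c rfl
    exact ⟨rfl, rfl, rfl, rfl⟩
  obtain ⟨e1, e2, e3, e4⟩ := hP _ rfl
  generalize 1 / (2 * √(l ^ 2 - ν ^ 2) * (-l - √(l ^ 2 - ν ^ 2))) = c at e1 e2 e3 e4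
  generalize √(l ^ 2 - ν ^ 2) = s at *
  have hs2c : (s : ℂ) ^ 2 = (l : ℂ) ^ 2 - (ν : ℂ) ^ 2 := by exact_mod_cast hs2
  have hb : IsRegularBasis ν l fun j i r => ((matP ν l i j : ℝ) : ℂ) *
      (r : ℂ) ^ ((![(s : ℂ), -(s : ℂ)] : Fin 2 → ℂ) j) := by
    refine isRegularBasis_cpow (fun j => ?_) (fun j => ?_) (fun j => ?_) hdet'
    · fin_cases j <;>
      simp only [Fin.zero_eta, Fin.mk_one, e1, e2, e3, e4, Matrix.cons_val_zero, Matrix.cons_val_one,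
        Matrix.cons_val_fin_one] <;> push_cast
      · linear_combination (c : ℂ) * hs2c
      · ring
    · fin_cases j <;>
      simp only [Fin.zero_eta, Fin.mk_one, e1, e2, e3, e4, Matrix.cons_val_zero, Matrix.cons_val_one,
        Matrix.cons_val_fin_one] <;> push_cast
      · ring
      · linear_combination (c : ℂ) * hs2c
    · fin_cases j <;> simp [abs_of_pos hs] <;> linarith
  refine hb.hasExtensionFamily hχ (ω := fun α => ![(Real.cos α : ℂ), (Real.sin α : ℂ)])
    (fun α r hr i => ?_) (isotropic_lines_real (neg_ne_zero.2 hdet') (fun w z => ?_) fun _ => rfl)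
  · rw [hu]
    push_cast [Complex.ofReal_cpow hr.le]
    ring
  · simp only [IsRegularBasis.boundaryForm, Complex.ofReal_one, Complex.one_cpow, mul_one, map_add, map_mul,
      Complex.conj_ofReal]
    ring

theorem matQ_sq {ν l : ℝ} (h : l ^ 2 - ν ^ 2 = 0) : matQ ν l ^ 2 = 0 := by
  rw [matQ, sq, Matrix.mul_fin_two]
  ext i j
  fin_cases i <;> fin_cases j <;> simp
  · linear_combination h
  · ring
  · ring
  · linear_combination h

/-- The case `δ = 0`. -/
theorem hasExtensionFamily_uCrit {ν l : ℝ} {χ : ℝ → ℝ} (hχ : IsCutoff χ) (hl : 0 < l)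
    (h : l ^ 2 - ν ^ 2 = 0) :
    ¬ IsEssentiallySelfAdjoint (radialOp ν l) ∧
      HasExtensionFamily (radialOp ν l) (uCrit χ ν l) := by
  refine (isRegularBasis_log hl h).hasExtensionFamily hχ
    (ω := fun α => ![(Real.cos α : ℂ), (Real.sin α : ℂ)])
    (fun α r hr i => ?_)
    (isotropic_lines_real (κ := -1) (by norm_num) (fun w z => ?_) fun _ => rfl)
  · fin_cases i <;>
    · simp only [uCrit, matQ, Matrix.mulVec, dotProduct, Fin.sum_univ_two]
      simp
      left
      ring
  · simp [IsRegularBasis.boundaryForm]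

theorem isUnit_matR {ν l : ℝ} (hl : 0 < l) (h : l ^ 2 - ν ^ 2 < 0) : IsUnit (matR ν l) := by
  have hs : 0 < √(ν ^ 2 - l ^ 2) := Real.sqrt_pos.2 (by linarith)
  have hs2 : √(ν ^ 2 - l ^ 2) ^ 2 = ν ^ 2 - l ^ 2 := Real.sq_sqrt (by linarith)
  rw [Matrix.isUnit_iff_isUnit_det, isUnit_iff_ne_zero, matR]
  generalize √(ν ^ 2 - l ^ 2) = s at hs hs2
  have hs2c : (s : ℂ) ^ 2 = (ν : ℂ) ^ 2 - (l : ℂ) ^ 2 := by exact_mod_cast hs2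
  have hsc : (s : ℂ) ≠ 0 := by exact_mod_cast hs.ne'
  have h1 : (l : ℂ) + Complex.I * s ≠ 0 := fun h0 => by
    have := congrArg Complex.re h0
    simp at this
    exact hl.ne' this
  have h1' : -(l : ℂ) - Complex.I * s ≠ 0 := fun h0 => h1 (by linear_combination -h0)
  rw [Matrix.det_smul, Fintype.card_fin, Matrix.det_fin_two_of]
  have h3 : 2 * Complex.I * (s : ℂ) ≠ 0 :=
    mul_ne_zero (mul_ne_zero two_ne_zero Complex.I_ne_zero) hsc
  refine mul_ne_zero (pow_ne_zero _ (one_div_ne_zero (mul_ne_zero h3 h1'))) ?_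
  have h2 : (-(l : ℂ) - Complex.I * s) * (l + Complex.I * s) - ν * -ν =
      -(2 * Complex.I * s * (l + Complex.I * s)) := by
    linear_combination -hs2c + (s : ℂ) ^ 2 * Complex.I_sq
  rw [h2]
  exact neg_ne_zero.2 (mul_ne_zero h3 h1)

/-- The case `δ < 0`. -/
theorem hasExtensionFamily_uSuper {ν l : ℝ} {χ : ℝ → ℝ} (hχ : IsCutoff χ) (hl : 0 < l)
    (h : l ^ 2 - ν ^ 2 < 0) :
    ¬ IsEssentiallySelfAdjoint (radialOp ν l) ∧
      HasExtensionFamily (radialOp ν l) (uSuper χ ν l) := by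
  have hs : 0 < √(ν ^ 2 - l ^ 2) := Real.sqrt_pos.2 (by linarith)
  have hs2 : √(ν ^ 2 - l ^ 2) ^ 2 = ν ^ 2 - l ^ 2 := Real.sq_sqrt (by linarith)
  have hdet : (matR ν l).det ≠ 0 :=
    ((Matrix.isUnit_iff_isUnit_det _).1 (isUnit_matR hl h)).ne_zero
  rw [Matrix.det_fin_two] at hdet
  have hu : ∀ α r i, uSuper χ ν l α r i = (χ r : ℂ) *
      (matR ν l i 0 * (Complex.exp (Complex.I * α) *
        (r : ℂ) ^ (Complex.I * (√(ν ^ 2 - l ^ 2) : ℂ))) +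
       matR ν l i 1 * (Complex.exp (-(Complex.I * α)) *
        (r : ℂ) ^ (-(Complex.I * (√(ν ^ 2 - l ^ 2) : ℂ))))) := by
    intro α r i
    simp only [uSuper, Matrix.mulVec, dotProduct, Fin.sum_univ_two, Matrix.cons_val_zero,
      Matrix.cons_val_one, Matrix.cons_val_fin_one]
  have hR : ∀ c : ℂ, c = 1 / (2 * Complex.I * (√(ν ^ 2 - l ^ 2) : ℂ) *
      (-(l : ℂ) - Complex.I * (√(ν ^ 2 - l ^ 2) : ℂ))) →
      matR ν l 0 0 = c * (-(l : ℂ) - Complex.I * (√(ν ^ 2 - l ^ 2) : ℂ)) ∧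
      matR ν l 0 1 = c * ν ∧ matR ν l 1 0 = c * -ν ∧
      matR ν l 1 1 = c * (l + Complex.I * (√(ν ^ 2 - l ^ 2) : ℂ)) := by
    rintro c rfl
    exact ⟨rfl, rfl, rfl, rfl⟩
  obtain ⟨e1, e2, e3, e4⟩ := hR _ rfl
  generalize 1 / (2 * Complex.I * (√(ν ^ 2 - l ^ 2) : ℂ) *
      (-(l : ℂ) - Complex.I * (√(ν ^ 2 - l ^ 2) : ℂ))) = c at e1 e2 e3 e4
  generalize √(ν ^ 2 - l ^ 2) = s at *
  have hs2c : (s : ℂ) ^ 2 = (ν : ℂ) ^ 2 - (l : ℂ) ^ 2 := by exact_mod_cast hs2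
  have hsc : (s : ℂ) ≠ 0 := by exact_mod_cast hs.ne'
  have hb : IsRegularBasis ν l fun j i r => matR ν l i j *
      (r : ℂ) ^ ((![Complex.I * s, -(Complex.I * s)] : Fin 2 → ℂ) j) := by
    refine isRegularBasis_cpow (fun j => ?_) (fun j => ?_) (fun j => ?_) ?_
    · fin_cases j <;>
      simp only [Fin.zero_eta, Fin.mk_one, e1, e2, e3, e4, Matrix.cons_val_zero, Matrix.cons_val_one,
        Matrix.cons_val_fin_one]
      · linear_combination -c * hs2c + c * (s : ℂ) ^ 2 * Complex.I_sq
      · ring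
    · fin_cases j <;>
      simp only [Fin.zero_eta, Fin.mk_one, e1, e2, e3, e4, Matrix.cons_val_zero, Matrix.cons_val_one,
        Matrix.cons_val_fin_one]
      · ring
      · linear_combination -c * hs2c + c * (s : ℂ) ^ 2 * Complex.I_sq
    · fin_cases j <;> simp
    · rwa [mul_comm (matR ν l 1 0)]
  have hν : (ν : ℂ) ≠ 0 := by
    rintro h0
    have : ν = 0 := by exact_mod_cast h0
    rw [this] at h
    nlinarith
  have hc : c ≠ 0 := by
    rintro rfl
    rw [e1, e2] at hdet
    simp at hdet
  -- the constant of the boundary form is `|c|² · 2 i σ ν`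
  refine hb.hasExtensionFamily hχ
    (ω := fun α => ![Complex.exp (Complex.I * α), Complex.exp (-(Complex.I * α))])
    (fun α r hr i => ?_) (isotropic_lines_exp
      (κ := conj c * c * (2 * Complex.I * s * ν)) (mul_ne_zero (mul_ne_zero ((map_ne_zero _).2 hc) hc)
        (mul_ne_zero (mul_ne_zero (mul_ne_zero two_ne_zero Complex.I_ne_zero) hsc) hν))
      (fun w z => ?_) fun _ => rfl)
  · rw [hu]
    simp only [Matrix.cons_val_zero, Matrix.cons_val_one, Matrix.cons_val_fin_one]
    ring
  · simp only [IsRegularBasis.boundaryForm, Complex.ofReal_one, Complex.one_cpow, mul_one, map_add, map_mul,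
      e1, e2, e3, e4, map_sub, map_neg, Complex.conj_ofReal, Complex.conj_I]
    linear_combination conj c * c * (conj (w 1) * z 0 - conj (w 0) * z 1) *
      ((s : ℂ) ^ 2 * Complex.I_sq - hs2c)

end RadialDirac

namespace RadialDirac

open MeasureTheory Set Filter Topology
open scoped ComplexConjugate InnerProductSpace

/-! ### The limit-point case -/

theorem lam_pos {w : ℝ} (hw : 0 < w) (k : ℕ) : 0 < lam w k := by
  have := Real.pi_pos
  rw [lam]
  positivity

theorem mem_closure_domain_of_mem_H10 {ν l : ℝ} {u : L2} (hu : u ∈ H10) :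
    u ∈ (radialOp ν l).closure.domain := by
  obtain ⟨f, hf⟩ := exists_mem_closure_graph_of_mem_H10 ν l hu
  rw [(isClosable_of_le_adjoint (radialOp_dense ν l)
    (radialOp_le_adjoint ν l)).graph_closure_eq_closure_graph] at hf
  exact mem_domain_iff_exists_graph.2 ⟨f, hf⟩

/-- The Wronskian with `p r^q`, divided by `r^(q + 1)`, is square-integrable near zero. For
`Re q ≥ 1/2` the homogeneous solution `r^(-q)` of its scalar equation is not square-integrable,
so it does not contribute; for `Re q < -1/2` it is square-integrable even after division by `r`. -/
theorem RadialODE.memLp_wronskian_div {ν l : ℝ} {U F : Fin 2 → ℝ → ℂ} (h : RadialODE ν l U F)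
    (hU : ∀ i, MemLp (U i) 2 (volume.restrict (Ioi 0)))
    (hF : ∀ i, MemLp (F i) 2 (volume.restrict (Ioi 0))) {p : Fin 2 → ℂ} {q : ℂ}
    (h0 : l * p 0 - ν * p 1 = q * p 0) (h1 : ν * p 0 - l * p 1 = q * p 1)
    (hq : 1 / 2 ≤ q.re ∨ q.re < -(1 / 2)) :
    MemLp (fun r : ℝ => (U 0 r * p 1 - U 1 r * p 0) / r) 2 (volume.restrict (Ioc 0 1)) := by
  have hp := h.isPrimitive_eigenvector h0 h1
  have hG : MemLp (fun r => F 0 r * p 0 + F 1 r * p 1) 2 (volume.restrict (Ioi 0)) :=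
    ((hF 0).mul_const _).add ((hF 1).mul_const _)
  rcases hq with hq | hq
  · refine memLp_div_of_tendsto (by rw [Complex.neg_re]; linarith) hp hG
      (tendsto_zero_of_memLp (by rw [Complex.neg_re]; linarith) hp hG ?_)
    exact (((hU 0).mul_const _).sub ((hU 1).mul_const _)).mono_measure
      (Measure.restrict_mono Ioc_subset_Ioi_self le_rfl)
  · exact memLp_div_of_half_lt (by rw [Complex.neg_re]; linarith) hp hG

/-- If `p` is an eigenvector for an exponent at least `1/2`, then every element of the domain of
the adjoint is, modulo the domain of the closure, a multiple of `p` at each point, and the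
bilinear product of its image with `p` vanishes: the Wronskian with `p` is zero, hence so is its
derivative. -/
theorem exists_closure_graph_parallel {ν l : ℝ} {p : Fin 2 → ℂ} {q : ℂ}
    (h0 : l * p 0 - ν * p 1 = q * p 0) (h1 : ν * p 0 - l * p 1 = q * p 1) (hp0 : p 0 ≠ 0)
    (hq : 1 / 2 ≤ q.re) {u f : L2} (hu : (u, f) ∈ (radialOp ν l).adjoint.graph) :
    ∃ n g, (n, g) ∈ (radialOp ν l).graph.topologicalClosure ∧
      (∀ᵐ r ∂(volume.restrict (Ioi 0)), (u - n) r 0 * p 1 - (u - n) r 1 * p 0 = 0) ∧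
      ∀ᵐ r ∂(volume.restrict (Ioi 0)), (f - g) r 0 * p 0 + (f - g) r 1 * p 1 = 0 := by
  obtain ⟨U, hU, hUu⟩ := exists_radialODE hu
  have hUL : ∀ i, MemLp (U i) 2 (volume.restrict (Ioi 0)) := fun i =>
    (memLp_apply u i).ae_eq (hUu i)
  have hfL := memLp_apply f
  have hY := hU.isPrimitive_eigenvector h0 h1
  have hYL : MemLp (fun r => U 0 r * p 1 - U 1 r * p 0) 2 (volume.restrict (Ioi 0)) :=
    ((hUL 0).mul_const _).sub ((hUL 1).mul_const _)
  have hYd := hU.memLp_wronskian_div hUL hfL h0 h1 (Or.inl hq)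
  have hYd' := memLp_div_Ioi hYL hYd
  have hY'L : MemLp (fun r => -q * (U 0 r * p 1 - U 1 r * p 0) / r + (f r 0 * p 0 + f r 1 * p 1)) 2
      (volume.restrict (Ioi 0)) := by
    refine ((hYd'.const_mul (-q)).add (((hfL 0).mul_const (p 0)).add
      ((hfL 1).mul_const (p 1)))).ae_eq
      (Eventually.of_forall fun r => ?_)
    simp only [Pi.add_apply]
    ring
  -- a vector function with the same Wronskian with `p`
  set N : Fin 2 → ℝ → ℂ := ![fun _ => 0, fun r => -(p 0)⁻¹ * (U 0 r * p 1 - U 1 r * p 0)] with hN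
  have hNL : ∀ i, MemLp (N i) 2 (volume.restrict (Ioi 0)) := by
    intro i
    fin_cases i
    · exact MemLp.zero'
    · exact hYL.const_mul _
  have hnH : vecToL2 hNL ∈ H10 := by
    refine mem_H10_of_memLp_div (U := N) (V := ![fun _ => 0, fun r => -(p 0)⁻¹ *
      (-q * (U 0 r * p 1 - U 1 r * p 0) / r + (f r 0 * p 0 + f r 1 * p 1))])
      (fun i => ?_) (fun i => ?_) (vecToL2_apply hNL) (fun i => ?_)
    · fin_cases i
      · exact IsPrimitive.of_hasDerivAt (fun _ _ => hasDerivAt_const _ _) continuousOn_const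
      · exact hY.const_mul _
    · fin_cases i
      · exact MemLp.zero'
      · exact hY'L.const_mul _
    · fin_cases i
      · refine MemLp.zero'.ae_eq (Eventually.of_forall fun r => ?_)
        simp [hN]
      · refine (hYd.const_mul (-(p 0)⁻¹)).ae_eq (Eventually.of_forall fun r => ?_)
        simp only [hN, Fin.mk_one, Matrix.cons_val_one, Matrix.cons_val_fin_one]
        ring
  obtain ⟨g, hg⟩ := exists_mem_closure_graph_of_mem_H10 ν l hnH
  have hsub : (u - vecToL2 hNL, f - g) ∈ (radialOp ν l).adjoint.graph :=
    (radialOp ν l).adjoint.graph.sub_mem hu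
      (closure_graph_le_adjoint_graph (radialOp_dense ν l) (radialOp_le_adjoint ν l) hg)
  have hpar : ∀ᵐ r ∂(volume.restrict (Ioi 0)),
      (u - vecToL2 hNL) r 0 * p 1 - (u - vecToL2 hNL) r 1 * p 0 = 0 := by
    filter_upwards [hUu 0, hUu 1, vecToL2_apply hNL 0, vecToL2_apply hNL 1,
      Lp.coeFn_sub u (vecToL2 hNL)] with r e0 e1 e2 e3 e4
    rw [e4]
    simp only [Pi.sub_apply, PiLp.sub_apply]
    rw [e0, e1, e2, e3]
    simp only [hN, Matrix.cons_val_zero, Matrix.cons_val_one, Matrix.cons_val_fin_one]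
    field_simp
    ring
  refine ⟨vecToL2 hNL, g, hg, hpar, ?_⟩
  obtain ⟨W, hW, hWu⟩ := exists_radialODE hsub
  have hz : (fun r => W 0 r * p 1 - W 1 r * p 0) =ᵐ[volume.restrict (Ioi 0)] 0 := by
    filter_upwards [hpar, hWu 0, hWu 1] with r e0 e1 e2
    rw [← e1, ← e2, e0]
    rfl
  filter_upwards [hz, (hW.isPrimitive_eigenvector h0 h1).ae_eq_zero hz] with r e1 e2
  rw [e1] at e2
  simpa using e2

/-- If the larger exponent is at least `1/2`, the boundary form of the adjoint vanishes. -/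
theorem inner_eq_of_eigenvector {ν l : ℝ} {p : Fin 2 → ℂ} {q : ℂ}
    (h0 : l * p 0 - ν * p 1 = q * p 0) (h1 : ν * p 0 - l * p 1 = q * p 1) (hp0 : p 0 ≠ 0)
    (hp : ∀ i, conj (p i) = p i) (hq : 1 / 2 ≤ q.re) {u f v g : L2}
    (hu : (u, f) ∈ (radialOp ν l).adjoint.graph) (hv : (v, g) ∈ (radialOp ν l).adjoint.graph) :
    ⟪f, v⟫_ℂ = ⟪u, g⟫_ℂ := by
  have hT := radialOp_dense ν l
  have hle := closure_graph_le_adjoint_graph hT (radialOp_le_adjoint ν l)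
  have key : ∀ a b : L2,
      (∀ᵐ r ∂(volume.restrict (Ioi 0)), a r 0 * p 0 + a r 1 * p 1 = 0) →
      (∀ᵐ r ∂(volume.restrict (Ioi 0)), b r 0 * p 1 - b r 1 * p 0 = 0) → ⟪a, b⟫_ℂ = 0 := by
    intro a b ha hb
    rw [inner_eq_integral]
    refine integral_eq_zero_of_ae ?_
    filter_upwards [ha, hb] with r e1 e2
    have e3 := congrArg conj e1
    simp only [map_add, map_mul, hp, map_zero] at e3
    refine (mul_eq_zero.1 (?_ : p 0 * _ = 0)).resolve_left hp0
    linear_combination b r 0 * e3 - conj (a r 1) * e2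
  obtain ⟨n, n', hn, hun, hfn⟩ := exists_closure_graph_parallel h0 h1 hp0 hq hu
  obtain ⟨m, m', hm, hvm, hgm⟩ := exists_closure_graph_parallel h0 h1 hp0 hq hv
  have e1 := inner_eq_of_mem_closure_graph hT hn hv
  have hun' := (radialOp ν l).adjoint.graph.sub_mem hu (hle hn)
  have e2 := inner_eq_of_mem_closure_graph hT hm hun'
  have e2' : ⟪f - n', m⟫_ℂ = ⟪u - n, m'⟫_ℂ := by
    rw [← inner_conj_symm, ← inner_conj_symm (u - n)]
    exact congrArg conj e2.symm
  have e3 := key _ _ hfn hvm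
  have e4 := key _ _ hgm hun
  have e4' : ⟪u - n, g - m'⟫_ℂ = 0 := by rw [← inner_conj_symm, e4, map_zero]
  rw [inner_sub_left] at e3 e4' e2'
  rw [inner_sub_right, inner_sub_right] at e3 e4'
  rw [inner_sub_left] at e2'
  linear_combination e1 + e2' + e3 - e4'

section LimitPoint

variable {ν l : ℝ}

theorem eigenvector_sqrt_fst (h : 0 ≤ l ^ 2 - ν ^ 2) :
    (l : ℂ) * (-l - √(l ^ 2 - ν ^ 2)) - ν * -ν =
      (√(l ^ 2 - ν ^ 2) : ℂ) * (-l - √(l ^ 2 - ν ^ 2)) := by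
  have hs : ((√(l ^ 2 - ν ^ 2) : ℝ) : ℂ) ^ 2 = (l : ℂ) ^ 2 - (ν : ℂ) ^ 2 := by
    exact_mod_cast Real.sq_sqrt h
  linear_combination hs

theorem isSelfAdjoint_closure_radialOp (hl : 0 < l) (h : 1 / 4 ≤ l ^ 2 - ν ^ 2) :
    (radialOp ν l).closure = (radialOp ν l).adjoint ∧ IsSelfAdjoint (radialOp ν l).closure := by
  have hs : 1 / 2 ≤ √(l ^ 2 - ν ^ 2) := Real.le_sqrt_of_sq_le (by linarith)
  refine isSelfAdjoint_closure (radialOp_dense ν l) (radialOp_le_adjoint ν l)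
    fun u f v g hu hv => inner_eq_of_eigenvector (p := ![-l - √(l ^ 2 - ν ^ 2), -ν])
      (q := √(l ^ 2 - ν ^ 2)) (eigenvector_sqrt_fst (by linarith)) ?_ ?_ ?_ ?_ hu hv
  · simp only [Matrix.cons_val_zero, Matrix.cons_val_one, Matrix.cons_val_fin_one]
    ring
  · simp only [Matrix.cons_val_zero]
    exact_mod_cast (by linarith : -l - √(l ^ 2 - ν ^ 2) < 0).ne
  · intro i
    fin_cases i <;> simp
  · rwa [Complex.ofReal_re]

theorem closure_domain_eq_H10 (hl : 0 < l) (h : 1 / 4 < l ^ 2 - ν ^ 2) :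
    (radialOp ν l).closure.domain = H10 := by
  refine le_antisymm (fun u hu => ?_) fun u hu => mem_closure_domain_of_mem_H10 hu
  rw [(isSelfAdjoint_closure_radialOp hl h.le).1] at hu
  obtain ⟨f, hf⟩ := mem_domain_iff_exists_graph.1 hu
  obtain ⟨U, hU, hUu⟩ := exists_radialODE hf
  have hUL : ∀ i, MemLp (U i) 2 (volume.restrict (Ioi 0)) := fun i =>
    (memLp_apply u i).ae_eq (hUu i)
  have hfL := memLp_apply f
  have hs : 1 / 2 < √(l ^ 2 - ν ^ 2) := Real.lt_sqrt_of_sq_lt (by linarith)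
  have h1 := eigenvector_sqrt_fst (ν := ν) (l := l) (by linarith)
  have hs2 : √(l ^ 2 - ν ^ 2) ^ 2 = l ^ 2 - ν ^ 2 := Real.sq_sqrt (by linarith)
  generalize √(l ^ 2 - ν ^ 2) = s at hs h1 hs2
  refine hU.mem_H10 hfL hUu (memLp_div_of_memLp_wronskian
    (p := ![![-l - s, -ν], ![ν, l + s]]) ?_ fun j => ?_)
  · simp only [Matrix.cons_val_zero, Matrix.cons_val_one, Matrix.cons_val_fin_one]
    have h2 : (-l - s) * (l + s) - -ν * ν ≠ 0 := by
      have : 0 < s * (l + s) := by positivity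
      nlinarith
    exact_mod_cast h2
  · fin_cases j
    · refine hU.memLp_wronskian_div hUL hfL (q := s) h1 ?_ (Or.inl ?_)
      · simp
        ring
      · rw [Complex.ofReal_re]
        exact hs.le
    · refine hU.memLp_wronskian_div hUL hfL (q := -s) ?_ ?_ (Or.inr ?_)
      · simp
        ring
      · simp
        linear_combination h1
      · rw [Complex.neg_re, Complex.ofReal_re]
        linarith

/-- At the critical value the solution with exponent `1/2`, cut off, lies in the domain of the
closure but its derivative is not square-integrable. -/
theorem H10_lt_closure_domain (hl : 0 < l) (h : l ^ 2 - ν ^ 2 = 1 / 4) {χ : ℝ → ℝ}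
    (hχ : IsCutoff χ) : H10 < (radialOp ν l).closure.domain := by
  rw [SetLike.lt_iff_le_and_exists]
  refine ⟨fun u hu => mem_closure_domain_of_mem_H10 hu, ?_⟩
  have hc : (l : ℂ) ^ 2 - (ν : ℂ) ^ 2 = 1 / 4 := by
    have h2 := congrArg Complex.ofReal h
    push_cast at h2
    exact h2
  have h0 : (l : ℂ) * (![-(l : ℂ) - 1 / 2, -(ν : ℂ)] : Fin 2 → ℂ) 0 -
      ν * (![-(l : ℂ) - 1 / 2, -(ν : ℂ)] : Fin 2 → ℂ) 1 =
      (1 / 2) * (![-(l : ℂ) - 1 / 2, -(ν : ℂ)] : Fin 2 → ℂ) 0 := by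
    simp only [Matrix.cons_val_zero, Matrix.cons_val_one, Matrix.cons_val_fin_one]
    linear_combination -hc
  have h1 : (ν : ℂ) * (![-(l : ℂ) - 1 / 2, -(ν : ℂ)] : Fin 2 → ℂ) 0 -
      l * (![-(l : ℂ) - 1 / 2, -(ν : ℂ)] : Fin 2 → ℂ) 1 =
      (1 / 2) * (![-(l : ℂ) - 1 / 2, -(ν : ℂ)] : Fin 2 → ℂ) 1 := by
    simp only [Matrix.cons_val_zero, Matrix.cons_val_one, Matrix.cons_val_fin_one]
    ring
  have hp0 : (![-(l : ℂ) - 1 / 2, -(ν : ℂ)] : Fin 2 → ℂ) 0 ≠ 0 := by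
    simp only [Matrix.cons_val_zero]
    intro h2
    have := congrArg Complex.re h2
    norm_num at this
    linarith
  generalize (![-(l : ℂ) - 1 / 2, -(ν : ℂ)] : Fin 2 → ℂ) = p at h0 h1 hp0
  have hψ : IsHomSolution ν l fun i r => p i * (r : ℂ) ^ (1 / 2 : ℂ) :=
    isHomSolution_cpow h0 h1 (by norm_num)
  refine ⟨vecToL2 (hψ.memLp_cutoff hχ), ?_, fun hmem => ?_⟩
  · rw [(isSelfAdjoint_closure_radialOp hl h.ge).1]
    exact mem_domain_iff_exists_graph.2 ⟨_, hψ.mem_adjoint_graph hχ⟩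
  obtain ⟨v, hv⟩ := exists_hasWeakDeriv_of_mem_H10 hmem
  obtain ⟨W, hW, hWu⟩ := (hv 0).exists_isPrimitive
    (locallyIntegrableOn_of_memLp (memLp_apply _ 0)) (locallyIntegrableOn_of_memLp (memLp_apply _ 0))
  have hz := (hW.sub (hψ.radialODE_cutoff hχ).fst).ae_eq_zero (by
    filter_upwards [hWu, vecToL2_apply (hψ.memLp_cutoff hχ) 0] with r e1 e2
    rw [← e1, e2]
    exact sub_self _)
  have hbad : MemLp (fun r : ℝ => (r : ℂ) ^ (-(1 / 2) : ℂ)) 2 (volume.restrict (Ioc 0 1)) := by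
    have hvL : MemLp (fun r => (1 / 2 * p 0)⁻¹ * v r 0) 2 (volume.restrict (Ioc 0 1)) :=
      (MemLp.mono_Ioc (memLp_apply v 0) 1).const_mul _
    refine hvL.ae_eq ?_
    have hne : ∀ᵐ r ∂(volume.restrict (Ioc (0 : ℝ) 1)), r ≠ 1 :=
      ae_restrict_of_ae (Measure.ae_ne volume 1)
    filter_upwards [ae_mono (Measure.restrict_mono Ioc_subset_Ioi_self le_rfl) hz,
      ae_restrict_mem measurableSet_Ioc, hne] with r e1 hr hr1
    have hr1' : r < 1 := lt_of_le_of_ne hr.2 hr1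
    have hrc : (r : ℂ) ≠ 0 := by exact_mod_cast hr.1.ne'
    simp only [Pi.zero_apply, hχ.eq_one r hr.1 hr.2, hχ.deriv_eq_zero_of_lt hr.1 hr1',
      Matrix.cons_val_one, Matrix.cons_val_fin_one, Complex.ofReal_one, Complex.ofReal_zero] at e1
    have e3 : (r : ℂ) ^ (-(1 / 2) : ℂ) = (r : ℂ) ^ (1 / 2 : ℂ) / r := by
      rw [show (-(1 / 2) : ℂ) = 1 / 2 - 1 by norm_num, Complex.cpow_sub _ _ hrc, Complex.cpow_one]
    rw [e3, inv_mul_eq_iff_eq_mul₀ (mul_ne_zero (by norm_num) hp0)]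
    linear_combination e1 + (r : ℂ) ^ (1 / 2 : ℂ) / r * h0
  have := (memLp_cpow_iff one_pos).1 hbad
  norm_num at this

end LimitPoint

end RadialDirac

theorem proposition2p3 (ω : ℝ) (hω : ω ∈ Set.Ioc 0 (2 * Real.pi)) (ν : ℝ) (k : ℕ)
    (l : ℝ) (hl : l = RadialDirac.lam ω k) (χ : ℝ → ℝ) (hχ : RadialDirac.IsCutoff χ) :
    (1 / 4 ≤ l ^ 2 - ν ^ 2 →
      RadialDirac.IsEssentiallySelfAdjoint (RadialDirac.radialOp ν l) ∧
      (1 / 4 < l ^ 2 - ν ^ 2 →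
        (RadialDirac.radialOp ν l).closure.domain = RadialDirac.H10) ∧
      (l ^ 2 - ν ^ 2 = 1 / 4 →
        RadialDirac.H10 < (RadialDirac.radialOp ν l).closure.domain)) ∧
    (0 < l ^ 2 - ν ^ 2 → l ^ 2 - ν ^ 2 < 1 / 4 →
      ¬ RadialDirac.IsEssentiallySelfAdjoint (RadialDirac.radialOp ν l) ∧
      IsUnit (RadialDirac.matP ν l) ∧
      RadialDirac.HasExtensionFamily (RadialDirac.radialOp ν l) (RadialDirac.uSub χ ν l)) ∧
    (l ^ 2 - ν ^ 2 = 0 →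
      ¬ RadialDirac.IsEssentiallySelfAdjoint (RadialDirac.radialOp ν l) ∧
      RadialDirac.matQ ν l ^ 2 = 0 ∧
      RadialDirac.HasExtensionFamily (RadialDirac.radialOp ν l) (RadialDirac.uCrit χ ν l)) ∧
    (l ^ 2 - ν ^ 2 < 0 →
      ¬ RadialDirac.IsEssentiallySelfAdjoint (RadialDirac.radialOp ν l) ∧
      IsUnit (RadialDirac.matR ν l) ∧
      RadialDirac.HasExtensionFamily (RadialDirac.radialOp ν l) (RadialDirac.uSuper χ ν l)) := by
  have hl0 : 0 < l := hl ▸ RadialDirac.lam_pos hω.1 k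
  refine ⟨fun h => ⟨⟨?_, (RadialDirac.isSelfAdjoint_closure_radialOp hl0 h).2⟩,
    fun h' => RadialDirac.closure_domain_eq_H10 hl0 h',
    fun h' => RadialDirac.H10_lt_closure_domain hl0 h' hχ⟩, fun h h' => ?_, fun h => ?_,
    fun h => ?_⟩
  · exact RadialDirac.isClosable_of_le_adjoint (RadialDirac.radialOp_dense ν l)
      (RadialDirac.radialOp_le_adjoint ν l)
  · obtain ⟨h1, h2⟩ := RadialDirac.hasExtensionFamily_uSub hχ hl0 h h'
    exact ⟨h1, RadialDirac.isUnit_matP hl0 h, h2⟩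
  · obtain ⟨h1, h2⟩ := RadialDirac.hasExtensionFamily_uCrit hχ hl0 h
    exact ⟨h1, RadialDirac.matQ_sq h, h2⟩
  · obtain ⟨h1, h2⟩ := RadialDirac.hasExtensionFamily_uSuper hχ hl0 h
    exact ⟨h1, RadialDirac.isUnit_matR hl0 h, h2⟩
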